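/- Let $n\ge 1$, let $\mu,M\in\mathbb R$, $C_0>0$, $V>0$, and let $(A_k)$, $(B_k)$, $(T_k)$, $(m_k)$, $k=0,1,2,\dots$, be sequences of real numbers. Then there is a constant $C>0$, depending only on these data, with the following property. Let $U\subset\mathbb R^n$ be a bounded open set of volume at most $V$ (located anywhere in $\mathbb R^n$), and let $\tau:U\to\mathbb C$ be smooth such that, for all $\xi\in U$ and all $k\ge 0$, $$\operatorname{Im}\tau(\xi)\ge 0,\qquad |D^k\tau(\xi)|\le T_k(1+|\xi|)^{m_k},\qquad |\det\operatorname{Hess}\tau(\xi)|\ge C_0(1+|\xi|)^{-M}.$$ Assume that $\tau$ has exactly one critical point in $U$ and that it is non-degenerate. Let $a\in S^{-\mu}_{1,0}(U)$ with constants $A_k$, that is, $a\in C^\infty(U)$ and $|D^ka(\xi)|\le A_k(1+|\xi|)^{-\mu-k}$ for all $\xi\in U$, $k\ge0$, and let $\chi\in S^0_{1,0}(\mathbb R^n)$ with constants $B_k$, that is, $\chi\in C^\infty(\mathbb R^n)$ and $|D^k\chi(\xi)|\le B_k(1+|\xi|)^{-k}$ for all $\xi\in\mathbb R^n$, $k\ge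 0$. Assume that $\chi$ and all its derivatives vanish outside $U$. Then for all $1\le p\le 2$ with $\frac1p+\frac1q=1$, all $t\ge 0$ and all Schwartz functions $f$ on $\mathbb R^n$, $$\left\|\int_{\mathbb R^n}e^{i(x\cdot\xi+\tau(\xi)t)}a(\xi)\chi(\xi)\widehat f(\xi)\,d\xi\right\|_{L^q(\mathbb R^n_x)}\le C(1+t)^{-\frac n2\left(\frac1p-\frac1q\right)}\|f\|_{W_p^{N_p}},\qquad N_p=\frac M2\Big(\frac1p-\frac1q\Big)-\mu.$$ Here $\widehat f(\xi)=\int e^{-ix\cdot\xi}f(x)\,dx$, $\|f\|_{W_p^s}=\|(1-\Delta)^{s/2}f\|_{L^p}$, $|D^kg(\xi)|$ is the norm of the $k$-th derivative of $g$ as a $k$-linear form, and the integrand is understood to be $0$ where $\chi=0$. -/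

import Mathlib

open MeasureTheory
open scoped ContDiff ENNReal SchwartzMap

noncomputable section

namespace FourierDecay

/-- `a` is smooth on the open set `U` and satisfies there the estimates of the symbol class
`S^m_{1,0}(U)`, with constant `A k` for the derivatives of order `k`. -/
def SymbolBoundOn {n : ℕ} (U : Set (EuclideanSpace ℝ (Fin n))) (m : ℝ) (A : ℕ → ℝ)
    (a : EuclideanSpace ℝ (Fin n) → ℂ) : Prop :=
  ContDiffOn ℝ ∞ a U ∧
    ∀ k : ℕ, ∀ ξ ∈ U, ‖iteratedFDeriv ℝ k a ξ‖ ≤ A k * (1 + ‖ξ‖) ^ (m - (k : ℝ))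

/-- The Hessian matrix `(∂_i ∂_j τ (ξ))_{i,j}` of a complex-valued function. -/
def hess {n : ℕ} (τ : EuclideanSpace ℝ (Fin n) → ℂ) (ξ : EuclideanSpace ℝ (Fin n)) :
    Matrix (Fin n) (Fin n) ℂ :=
  Matrix.of fun i j =>
    fderiv ℝ (fun η => fderiv ℝ τ η (EuclideanSpace.single j (1 : ℝ))) ξ
      (EuclideanSpace.single i (1 : ℝ))

/-- `τ` has exactly one critical point in `U`, and this critical point is non-degenerate. -/
def HasUniqueNondegCritPoint {n : ℕ} (U : Set (EuclideanSpace ℝ (Fin n)))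
    (τ : EuclideanSpace ℝ (Fin n) → ℂ) : Prop :=
  ∃ ξ₀ ∈ U, fderiv ℝ τ ξ₀ = 0 ∧ (hess τ ξ₀).det ≠ 0 ∧ ∀ ξ ∈ U, fderiv ℝ τ ξ = 0 → ξ = ξ₀

/-- The Fourier transform `∫ e^{-i x·ξ} f(x) dx`. -/
def fourierHat {n : ℕ} (f : EuclideanSpace ℝ (Fin n) → ℂ) (ξ : EuclideanSpace ℝ (Fin n)) : ℂ :=
  ∫ x : EuclideanSpace ℝ (Fin n), Complex.exp (-(Complex.I * (inner ℝ x ξ : ℝ))) * f x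

/-- The Bessel potential `⟨D⟩^s f`, where `⟨D⟩ = (1 - Δ)^{1/2}`, that is the Fourier multiplier
with symbol `(1 + |ξ|²)^{s/2}`. -/
def besselPot {n : ℕ} (s : ℝ) (f : EuclideanSpace ℝ (Fin n) → ℂ)
    (x : EuclideanSpace ℝ (Fin n)) : ℂ :=
  ((2 * Real.pi) ^ n : ℝ)⁻¹ • ∫ ξ : EuclideanSpace ℝ (Fin n),
    Complex.exp (Complex.I * (inner ℝ x ξ : ℝ)) *
      (((1 + ‖ξ‖ ^ 2) ^ (s / 2) : ℝ) : ℂ) * fourierHat f ξ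

/-- The norm `‖⟨D⟩^s f‖_{L^p}` of the Sobolev space `W_p^s`. -/
def sobolevNorm {n : ℕ} (p : ℝ≥0∞) (s : ℝ) (f : EuclideanSpace ℝ (Fin n) → ℂ) : ℝ≥0∞ :=
  eLpNorm (besselPot s f) p volume

/-- The oscillatory multiplier `∫ e^{i(x·ξ + τ(ξ) t)} a(ξ) χ(ξ) f̂(ξ) dξ`. -/
def oscMultiplier {n : ℕ} (τ a χ : EuclideanSpace ℝ (Fin n) → ℂ) (t : ℝ)
    (f : EuclideanSpace ℝ (Fin n) → ℂ) (x : EuclideanSpace ℝ (Fin n)) : ℂ :=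
  ∫ ξ : EuclideanSpace ℝ (Fin n),
    Complex.exp (Complex.I * ((inner ℝ x ξ : ℝ) + τ ξ * (t : ℂ))) * a ξ * χ ξ * fourierHat f ξ

end FourierDecay

end

noncomputable section

namespace FourierDecay

/-! Inserting `⟨ξ⟩^{-s}⟨ξ⟩^s` with `s = N_p` turns the operator into the Fourier multiplier with
symbol `e^{itτ} a χ ⟨ξ⟩^{-s}` acting on `⟨D⟩^s f`. Two bounds suffice: the symbol is `O(1)`, which
gives `L² → L²` by Plancherel, and its kernel is `O((1+t)^{-n/2})`, which gives `L¹ → L^∞`.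
Riesz–Thorin with `θ = 1/p - 1/q` interpolates between them (`eLpNorm_mulOp_le`).

Polynomial losses cost nothing. Since `U` has volume at most `V`, each `ξ ∈ U` is at bounded
distance from a point outside `U`, where `χ` vanishes to infinite order. Taylor's estimate from that
point and the symbol bounds give `|D^j χ| ≤ C δ^N` for every `N`, with `δ =
min(dist(ξ,Uᶜ),1)/(1+|ξ|)` (`exists_norm_iteratedFDeriv_le_bdryWt`). So `χ` absorbs both growth in
`|ξ|` and negative powers of the distance to the boundary.

For `t ≥ 1` the phase `x·ξ + tτ` has gradient `tG`, `G = x/t + ∇τ`. Instead of localising at a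
critical point, one integrates by parts `n+1` times with the denominator `1 + t|G|²`, which never
vanishes (`IsPhase.exists_gain`). This replaces the amplitude by one of size `δ^N (1+√t|G|)^{-n-1}`,
uniformly in `x`, because `x` enters `G` but not its derivatives; `Im τ ≥ 0` keeps the exponential
bounded. The Hessian bound makes `G` expanding with rate `cδ^K` on balls of radius `cδ^K`
(`PolyBd.exists_expanding`), so on such a ball the integral of `(1+√t|G|)^{-n-1}` is `O((√t
δ^K)^{-n})`. Averaging over the balls gives `O(t^{-n/2}|U|)` in total
(`lintegral_le_of_locally_expanding`).

Uniformity comes from indexing by all admissible data (`PhaseDatum`): the constants in `Sym`, `PSym`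
and `RSym` are common to the whole family. -/

/-- The partial derivative in the `i`-th coordinate direction. -/
def pd {n : ℕ} (i : Fin n) (f : EuclideanSpace ℝ (Fin n) → ℂ) (ξ : EuclideanSpace ℝ (Fin n)) : ℂ :=
  fderiv ℝ f ξ (EuclideanSpace.single i (1 : ℝ))

/-! ### Partial derivatives of complex-valued functions -/

section pd

variable {n : ℕ} {f g : EuclideanSpace ℝ (Fin n) → ℂ} {ξ : EuclideanSpace ℝ (Fin n)}

lemma pd_add (hf : DifferentiableAt ℝ f ξ) (hg : DifferentiableAt ℝ g ξ) (i : Fin n) :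
    pd i (fun η => f η + g η) ξ = pd i f ξ + pd i g ξ := by
  simp [pd, fderiv_fun_add hf hg]

lemma pd_mul (hf : DifferentiableAt ℝ f ξ) (hg : DifferentiableAt ℝ g ξ) (i : Fin n) :
    pd i (fun η => f η * g η) ξ = pd i f ξ * g ξ + f ξ * pd i g ξ := by
  simp [pd, fderiv_fun_mul hf hg]; ring

lemma pd_conj (hf : DifferentiableAt ℝ f ξ) (i : Fin n) :
    pd i (fun η => (starRingEnd ℂ) (f η)) ξ = (starRingEnd ℂ) (pd i f ξ) := by
  have h := (Complex.conjCLE.toContinuousLinearMap.hasFDerivAt (x := f ξ)).comp ξ hf.hasFDerivAt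
  have h' : HasFDerivAt (fun η => (starRingEnd ℂ) (f η))
      (Complex.conjCLE.toContinuousLinearMap.comp (fderiv ℝ f ξ)) ξ := h
  simp [pd, h'.fderiv]

lemma pd_inv (hf : DifferentiableAt ℝ f ξ) (h0 : f ξ ≠ 0) (i : Fin n) :
    pd i (fun η => (f η)⁻¹) ξ = -((f ξ)⁻¹ * (f ξ)⁻¹) * pd i f ξ := by
  have h : HasFDerivAt (fun η => (f η)⁻¹) _ ξ :=
    (hasDerivAt_inv h0).complexToReal_fderiv.comp ξ hf.hasFDerivAt
  simp only [pd, h.fderiv]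
  simp [sq]

lemma pd_congr {U : Set (EuclideanSpace ℝ (Fin n))} (hU : IsOpen U) (h : ∀ η ∈ U, f η = g η)
    (hξ : ξ ∈ U) (i : Fin n) : pd i f ξ = pd i g ξ := by
  have : f =ᶠ[nhds ξ] g := Filter.mem_of_superset (hU.mem_nhds hξ) h
  simp [pd, this.fderiv_eq]

end pd

section Smooth

variable {n : ℕ} {U : Set (EuclideanSpace ℝ (Fin n))} {f : EuclideanSpace ℝ (Fin n) → ℂ}

lemma contDiffOn_pd (hU : IsOpen U) (hf : ContDiffOn ℝ ∞ f U) (i : Fin n) :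
    ContDiffOn ℝ ∞ (pd i f) U :=
  (hf.fderiv_of_isOpen hU (by simp)).clm_apply contDiffOn_const

lemma norm_iteratedFDeriv_pd_le (hU : IsOpen U) (hf : ContDiffOn ℝ ∞ f U) (i : Fin n) (k : ℕ)
    {ξ : EuclideanSpace ℝ (Fin n)} (hξ : ξ ∈ U) :
    ‖iteratedFDeriv ℝ k (pd i f) ξ‖ ≤ ‖iteratedFDeriv ℝ (k + 1) f ξ‖ := by
  have hs' : ContDiffOn ℝ ∞ (fderiv ℝ f) U := hf.fderiv_of_isOpen hU (by simp)
  have h1 : ‖iteratedFDeriv ℝ k (pd i f) ξ‖ ≤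
      ‖(EuclideanSpace.single i (1 : ℝ) : EuclideanSpace ℝ (Fin n))‖ *
        ‖iteratedFDeriv ℝ k (fderiv ℝ f) ξ‖ :=
    norm_iteratedFDeriv_clm_apply_const (hs'.contDiffAt (hU.mem_nhds hξ)) (n := k) (N := ∞)
      (by exact_mod_cast le_top)
  rw [norm_iteratedFDeriv_fderiv] at h1
  simpa only [PiLp.norm_single, norm_one, one_mul] using h1

end Smooth

/-! ### Uniform symbol classes with losses and gains in a weight -/

/-- A family of open sets in `ℝⁿ` with scales `s ≥ 1` and functions `0 < δ ≤ 1` on them. -/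
structure SymbolFrame (ι : Type*) (n : ℕ) where
  U : ι → Set (EuclideanSpace ℝ (Fin n))
  s : ι → ℝ
  δ : ι → EuclideanSpace ℝ (Fin n) → ℝ
  isOpen_U : ∀ σ, IsOpen (U σ)
  one_le_s : ∀ σ, 1 ≤ s σ
  δ_pos : ∀ σ, ∀ ξ ∈ U σ, 0 < δ σ ξ
  δ_le_one : ∀ σ, ∀ ξ ∈ U σ, δ σ ξ ≤ 1

namespace SymbolFrame

variable {ι : Type*} {n : ℕ} (F : SymbolFrame ι n)

/-- `‖b‖ ≤ C W` with a constant that is uniform over the family. -/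
def UBd (W : ι → EuclideanSpace ℝ (Fin n) → ℝ) (b : ι → EuclideanSpace ℝ (Fin n) → ℂ) : Prop :=
  ∃ C : ℝ, 0 ≤ C ∧ ∀ σ, ∀ ξ ∈ F.U σ, ‖b σ ξ‖ ≤ C * W σ ξ

/-- Uniform symbol estimates of weight `W` up to order `j`: each derivative costs a factor `s`. -/
def Sym : ℕ → (ι → EuclideanSpace ℝ (Fin n) → ℝ) → (ι → EuclideanSpace ℝ (Fin n) → ℂ) → Prop
  | 0, W, b => F.UBd W b
  | j + 1, W, b => F.UBd W b ∧ (∀ σ, DifferentiableOn ℝ (b σ) (F.U σ)) ∧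
      ∀ i, Sym j (fun σ ξ => F.s σ * W σ ξ) (fun σ => pd i (b σ))

/-- Symbol estimates with a polynomial loss in `δ⁻¹`. -/
def PSym (j : ℕ) (W : ι → EuclideanSpace ℝ (Fin n) → ℝ)
    (b : ι → EuclideanSpace ℝ (Fin n) → ℂ) : Prop :=
  ∃ K : ℕ, F.Sym j (fun σ ξ => (F.δ σ ξ)⁻¹ ^ K * W σ ξ) b

/-- Symbol estimates with a gain of every power of `δ`. -/
def RSym (j : ℕ) (W : ι → EuclideanSpace ℝ (Fin n) → ℝ)
    (b : ι → EuclideanSpace ℝ (Fin n) → ℂ) : Prop :=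
  ∀ N : ℕ, F.Sym j (fun σ ξ => F.δ σ ξ ^ N * W σ ξ) b

variable {F} {W W' W₁ W₂ : ι → EuclideanSpace ℝ (Fin n) → ℝ}
  {b f g h : ι → EuclideanSpace ℝ (Fin n) → ℂ} {j : ℕ}

lemma Sym.ubd (hb : F.Sym j W b) : F.UBd W b := by
  cases j with
  | zero => exact hb
  | succ j => exact hb.1

lemma Sym.diffAt (hb : F.Sym (j + 1) W b) {σ : ι} {ξ : EuclideanSpace ℝ (Fin n)}
    (hξ : ξ ∈ F.U σ) : DifferentiableAt ℝ (b σ) ξ :=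
  (hb.2.1 σ).differentiableAt ((F.isOpen_U σ).mem_nhds hξ)

lemma Sym.mono (hb : F.Sym j W b) {C : ℝ}
    (hW : ∀ σ, ∀ ξ ∈ F.U σ, W σ ξ ≤ C * W' σ ξ) (hC : 0 ≤ C) : F.Sym j W' b := by
  have hu : ∀ {W W' : ι → EuclideanSpace ℝ (Fin n) → ℝ} {b : ι → EuclideanSpace ℝ (Fin n) → ℂ},
      F.UBd W b → (∀ σ, ∀ ξ ∈ F.U σ, W σ ξ ≤ C * W' σ ξ) → F.UBd W' b := by
    rintro W W' b ⟨C₁, h₁, h₂⟩ hW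
    refine ⟨C₁ * C, by positivity, fun σ ξ hξ => (h₂ σ ξ hξ).trans ?_⟩
    rw [mul_assoc]
    exact mul_le_mul_of_nonneg_left (hW σ ξ hξ) h₁
  induction j generalizing W W' b with
  | zero => exact hu hb hW
  | succ j ih =>
    refine ⟨hu hb.1 hW, hb.2.1, fun i => ih (hb.2.2 i) fun σ ξ hξ => ?_⟩
    have := mul_le_mul_of_nonneg_left (hW σ ξ hξ) (zero_le_one.trans (F.one_le_s σ))
    linarith

lemma Sym.congr (hb : F.Sym j W f) (hfg : ∀ σ, ∀ ξ ∈ F.U σ, f σ ξ = g σ ξ) : F.Sym j W g := by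
  have hu : ∀ {W : ι → EuclideanSpace ℝ (Fin n) → ℝ} {f g : ι → EuclideanSpace ℝ (Fin n) → ℂ},
      F.UBd W f → (∀ σ, ∀ ξ ∈ F.U σ, f σ ξ = g σ ξ) → F.UBd W g := by
    rintro W f g ⟨C₁, h₁, h₂⟩ hW
    exact ⟨C₁, h₁, fun σ ξ hξ => hW σ ξ hξ ▸ h₂ σ ξ hξ⟩
  induction j generalizing W f g with
  | zero => exact hu hb hfg
  | succ j ih =>
    refine ⟨hu hb.1 hfg, fun σ => (hb.2.1 σ).congr fun ξ hξ => (hfg σ ξ hξ).symm,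
      fun i => ih (hb.2.2 i) fun σ ξ hξ => ?_⟩
    exact pd_congr (F.isOpen_U σ) (hfg σ) hξ i

lemma Sym.of_succ (hb : F.Sym (j + 1) W b) : F.Sym j W b := by
  induction j generalizing W b with
  | zero => exact hb.1
  | succ j ih => exact ⟨hb.1, hb.2.1, fun i => ih (hb.2.2 i)⟩

lemma Sym.add (hf : F.Sym j W f) (hg : F.Sym j W g) :
    F.Sym j W (fun σ ξ => f σ ξ + g σ ξ) := by
  have hu : ∀ {W : ι → EuclideanSpace ℝ (Fin n) → ℝ} {f g : ι → EuclideanSpace ℝ (Fin n) → ℂ},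
      F.UBd W f → F.UBd W g → F.UBd W (fun σ ξ => f σ ξ + g σ ξ) := by
    rintro W f g ⟨C₁, h₁, h₂⟩ ⟨C₂, h₃, h₄⟩
    refine ⟨C₁ + C₂, by positivity, fun σ ξ hξ => (norm_add_le _ _).trans ?_⟩
    rw [add_mul]
    exact add_le_add (h₂ σ ξ hξ) (h₄ σ ξ hξ)
  induction j generalizing W f g with
  | zero => exact hu hf hg
  | succ j ih =>
    refine ⟨hu hf.1 hg.1, fun σ => (hf.2.1 σ).fun_add (hg.2.1 σ), fun i => ?_⟩
    refine (ih (hf.2.2 i) (hg.2.2 i)).congr fun σ ξ hξ => ?_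
    exact (pd_add (hf.diffAt hξ) (hg.diffAt hξ) i).symm

lemma Sym.mul (hf : F.Sym j W f) (hg : F.Sym j W' g) :
    F.Sym j (fun σ ξ => W σ ξ * W' σ ξ) (fun σ ξ => f σ ξ * g σ ξ) := by
  have hu : ∀ {W W' : ι → EuclideanSpace ℝ (Fin n) → ℝ}
      {f g : ι → EuclideanSpace ℝ (Fin n) → ℂ}, F.UBd W f → F.UBd W' g →
      F.UBd (fun σ ξ => W σ ξ * W' σ ξ) (fun σ ξ => f σ ξ * g σ ξ) := by
    rintro W W' f g ⟨C₁, h₁, h₂⟩ ⟨C₂, h₃, h₄⟩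
    refine ⟨C₁ * C₂, by positivity, fun σ ξ hξ => ?_⟩
    rw [norm_mul, mul_mul_mul_comm]
    exact mul_le_mul (h₂ σ ξ hξ) (h₄ σ ξ hξ) (norm_nonneg _) ((norm_nonneg _).trans (h₂ σ ξ hξ))
  induction j generalizing W W' f g with
  | zero => exact hu hf hg
  | succ j ih =>
    refine ⟨hu hf.1 hg.1, fun σ => (hf.2.1 σ).fun_mul (hg.2.1 σ), fun i => ?_⟩
    have h1 := ih (hf.2.2 i) hg.of_succ
    have h2 := ih hf.of_succ (hg.2.2 i)
    refine Sym.congr (Sym.add (h1.mono (C := 1) (fun σ ξ _ => ?_) zero_le_one)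
      (h2.mono (C := 1) (fun σ ξ _ => ?_) zero_le_one)) fun σ ξ hξ =>
      (pd_mul (hf.diffAt hξ) (hg.diffAt hξ) i).symm
    · exact le_of_eq (by ring)
    · exact le_of_eq (by ring)

lemma Sym.conj (hf : F.Sym j W f) : F.Sym j W (fun σ ξ => (starRingEnd ℂ) (f σ ξ)) := by
  have hu : ∀ {W : ι → EuclideanSpace ℝ (Fin n) → ℝ} {f : ι → EuclideanSpace ℝ (Fin n) → ℂ},
      F.UBd W f → F.UBd W (fun σ ξ => (starRingEnd ℂ) (f σ ξ)) := by
    rintro W f ⟨C₁, h₁, h₂⟩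
    exact ⟨C₁, h₁, fun σ ξ hξ => by simpa using h₂ σ ξ hξ⟩
  induction j generalizing W f with
  | zero => exact hu hf
  | succ j ih =>
    refine ⟨hu hf.1, fun σ => ?_, fun i => (ih (hf.2.2 i)).congr fun σ ξ hξ =>
      (pd_conj (hf.diffAt hξ) i).symm⟩
    exact Complex.conjCLE.toContinuousLinearMap.differentiable.comp_differentiableOn (hf.2.1 σ)

lemma Sym.zero (hW : ∀ σ, ∀ ξ ∈ F.U σ, 0 ≤ W σ ξ) : F.Sym j W (fun _ _ => 0) := by
  have hu : ∀ {W : ι → EuclideanSpace ℝ (Fin n) → ℝ}, F.UBd W (fun _ _ => 0) :=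
    ⟨0, le_rfl, fun σ ξ _ => by simp⟩
  induction j generalizing W with
  | zero => exact hu
  | succ j ih =>
    refine ⟨hu, fun σ => differentiableOn_const _, fun i => (ih fun σ ξ hξ => ?_).congr
      fun σ ξ hξ => by simp [pd]⟩
    exact mul_nonneg (zero_le_one.trans (F.one_le_s σ)) (hW σ ξ hξ)

/-- Constants that are bounded over the family. -/
lemma Sym.const {c : ι → ℂ} {C : ℝ} (hC : ∀ σ, ‖c σ‖ ≤ C) :
    F.Sym j (fun _ _ => 1) (fun σ _ => c σ) := by
  have hu : F.UBd (fun _ _ => 1) (fun σ _ => c σ) :=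
    ⟨|C|, abs_nonneg _, fun σ ξ _ => by simpa using (hC σ).trans (le_abs_self C)⟩
  cases j with
  | zero => exact hu
  | succ j =>
    refine ⟨hu, fun σ => differentiableOn_const _, fun i => (Sym.zero fun σ ξ hξ => ?_).congr
      fun σ ξ hξ => by simp [pd]⟩
    simpa using zero_le_one.trans (F.one_le_s σ)

lemma Sym.sum {κ : Type*} (t : Finset κ) {f : κ → ι → EuclideanSpace ℝ (Fin n) → ℂ}
    (hW : ∀ σ, ∀ ξ ∈ F.U σ, 0 ≤ W σ ξ) (hf : ∀ k, F.Sym j W (f k)) :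
    F.Sym j W (fun σ ξ => ∑ k ∈ t, f k σ ξ) := by
  classical
  induction t using Finset.induction_on with
  | empty => simpa using Sym.zero hW
  | insert a t ha ih =>
    refine ((hf a).add ih).congr fun σ ξ _ => ?_
    rw [Finset.sum_insert ha]

/-- Bounds on the Fréchet derivatives up to order `j` give symbol estimates of order `j`. -/
lemma Sym.of_iteratedFDeriv (hW : ∀ σ, ∀ ξ ∈ F.U σ, 0 ≤ W σ ξ)
    (hs : ∀ σ, ContDiffOn ℝ ∞ (f σ) (F.U σ))
    (hf : ∀ k ≤ j, ∃ C : ℝ, ∀ σ, ∀ ξ ∈ F.U σ, ‖iteratedFDeriv ℝ k (f σ) ξ‖ ≤ C * W σ ξ) :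
    F.Sym j W f := by
  have hu : ∀ {W : ι → EuclideanSpace ℝ (Fin n) → ℝ} {f : ι → EuclideanSpace ℝ (Fin n) → ℂ},
      (∀ σ, ∀ ξ ∈ F.U σ, 0 ≤ W σ ξ) →
      (∃ C : ℝ, ∀ σ, ∀ ξ ∈ F.U σ, ‖iteratedFDeriv ℝ 0 (f σ) ξ‖ ≤ C * W σ ξ) → F.UBd W f := by
    rintro W f hW ⟨C, hC⟩
    refine ⟨|C|, abs_nonneg _, fun σ ξ hξ => ?_⟩
    have := hC σ ξ hξ
    rw [norm_iteratedFDeriv_zero] at this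
    exact this.trans (mul_le_mul_of_nonneg_right (le_abs_self C) (hW σ ξ hξ))
  induction j generalizing W f with
  | zero => exact hu hW (hf 0 le_rfl)
  | succ j ih =>
    refine ⟨hu hW (hf 0 (Nat.zero_le _)), fun σ => (hs σ).differentiableOn (by simp), fun i => ?_⟩
    refine ih (fun σ ξ hξ => mul_nonneg (zero_le_one.trans (F.one_le_s σ)) (hW σ ξ hξ))
      (fun σ => contDiffOn_pd (F.isOpen_U σ) (hs σ) i) fun k hk => ?_
    obtain ⟨C, hC⟩ := hf (k + 1) (by omega)
    refine ⟨|C|, fun σ ξ hξ => ?_⟩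
    have h1 := norm_iteratedFDeriv_pd_le (F.isOpen_U σ) (hs σ) i k hξ
    have h2 := hC σ ξ hξ
    have h3 : C * W σ ξ ≤ |C| * W σ ξ := mul_le_mul_of_nonneg_right (le_abs_self C) (hW σ ξ hξ)
    -- Since `s ≥ 1`, a derivative bounded without loss also satisfies the bound that allows a
    -- factor `s`.
    have h4 : W σ ξ ≤ F.s σ * W σ ξ := le_mul_of_one_le_left (hW σ ξ hξ) (F.one_le_s σ)
    have h5 := mul_le_mul_of_nonneg_left h4 (abs_nonneg C)
    linarith

lemma one_le_inv_δ {σ : ι} {ξ : EuclideanSpace ℝ (Fin n)} (hξ : ξ ∈ F.U σ) : 1 ≤ (F.δ σ ξ)⁻¹ :=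
  one_le_inv_iff₀.2 ⟨F.δ_pos σ ξ hξ, F.δ_le_one σ ξ hξ⟩

lemma PSym.of_sym (hb : F.Sym j W b) : F.PSym j W b := ⟨0, by simpa using hb⟩

/-- The exponent may be enlarged because `δ⁻¹ ≥ 1`; this lets finitely many symbols share one
exponent. -/
lemma PSym.exists_le (hb : F.PSym j W b) (hW : ∀ σ, ∀ ξ ∈ F.U σ, 0 ≤ W σ ξ) :
    ∃ K₀ : ℕ, ∀ K ≥ K₀, F.Sym j (fun σ ξ => (F.δ σ ξ)⁻¹ ^ K * W σ ξ) b := by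
  obtain ⟨K₀, hK⟩ := hb
  refine ⟨K₀, fun K hle => hK.mono (C := 1) (fun σ ξ hξ => ?_) zero_le_one⟩
  rw [one_mul]
  exact mul_le_mul_of_nonneg_right (pow_le_pow_right₀ (one_le_inv_δ hξ) hle) (hW σ ξ hξ)

lemma PSym.mono (hb : F.PSym j W b) {C : ℝ}
    (hW : ∀ σ, ∀ ξ ∈ F.U σ, W σ ξ ≤ C * W' σ ξ) (hC : 0 ≤ C) : F.PSym j W' b := by
  obtain ⟨K, hK⟩ := hb
  refine ⟨K, hK.mono (fun σ ξ hξ => ?_) hC⟩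
  have := mul_le_mul_of_nonneg_left (hW σ ξ hξ)
    (pow_nonneg (inv_nonneg.2 (F.δ_pos σ ξ hξ).le) K)
  linarith

lemma PSym.congr (hb : F.PSym j W f) (hfg : ∀ σ, ∀ ξ ∈ F.U σ, f σ ξ = g σ ξ) : F.PSym j W g :=
  let ⟨K, hK⟩ := hb; ⟨K, hK.congr hfg⟩

lemma PSym.mul (hf : F.PSym j W f) (hg : F.PSym j W' g) :
    F.PSym j (fun σ ξ => W σ ξ * W' σ ξ) (fun σ ξ => f σ ξ * g σ ξ) := by
  obtain ⟨K, hK⟩ := hf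
  obtain ⟨K', hK'⟩ := hg
  refine ⟨K + K', (hK.mul hK').mono (C := 1) (fun σ ξ _ => le_of_eq ?_) zero_le_one⟩
  ring

lemma PSym.add (hf : F.PSym j W f) (hg : F.PSym j W g) (hW : ∀ σ, ∀ ξ ∈ F.U σ, 0 ≤ W σ ξ) :
    F.PSym j W (fun σ ξ => f σ ξ + g σ ξ) := by
  obtain ⟨K, hK⟩ := hf.exists_le hW
  obtain ⟨K', hK'⟩ := hg.exists_le hW
  exact ⟨max K K', (hK _ (le_max_left _ _)).add (hK' _ (le_max_right _ _))⟩

lemma PSym.sum {κ : Type*} (t : Finset κ) {f : κ → ι → EuclideanSpace ℝ (Fin n) → ℂ}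
    (hW : ∀ σ, ∀ ξ ∈ F.U σ, 0 ≤ W σ ξ) (hf : ∀ k, F.PSym j W (f k)) :
    F.PSym j W (fun σ ξ => ∑ k ∈ t, f k σ ξ) := by
  classical
  induction t using Finset.induction_on with
  | empty => simpa using PSym.of_sym (Sym.zero hW)
  | insert a t ha ih =>
    refine ((hf a).add ih hW).congr fun σ ξ _ => ?_
    rw [Finset.sum_insert ha]

lemma PSym.conj (hf : F.PSym j W f) : F.PSym j W (fun σ ξ => (starRingEnd ℂ) (f σ ξ)) :=
  let ⟨K, hK⟩ := hf; ⟨K, hK.conj⟩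

lemma PSym.of_succ (hb : F.PSym (j + 1) W b) : F.PSym j W b :=
  let ⟨K, hK⟩ := hb; ⟨K, hK.of_succ⟩

lemma PSym.pd (hb : F.PSym (j + 1) W b) (i : Fin n) :
    F.PSym j (fun σ ξ => F.s σ * W σ ξ) (fun σ => FourierDecay.pd i (b σ)) := by
  obtain ⟨K, hK⟩ := hb
  exact ⟨K, (hK.2.2 i).mono (C := 1) (fun σ ξ _ => le_of_eq (by ring)) zero_le_one⟩

/-- A symbol whose derivatives are symbols. -/
lemma PSym.of_pd (hb : F.PSym 0 W b) (hW : ∀ σ, ∀ ξ ∈ F.U σ, 0 ≤ W σ ξ)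
    (hd : ∀ σ, DifferentiableOn ℝ (b σ) (F.U σ))
    (hp : ∀ i, F.PSym j (fun σ ξ => F.s σ * W σ ξ) (fun σ => FourierDecay.pd i (b σ))) :
    F.PSym (j + 1) W b := by
  have hsW : ∀ σ, ∀ ξ ∈ F.U σ, 0 ≤ F.s σ * W σ ξ := fun σ ξ hξ =>
    mul_nonneg (zero_le_one.trans (F.one_le_s σ)) (hW σ ξ hξ)
  choose K hK using fun i => (hp i).exists_le hsW
  obtain ⟨K₀, hK₀⟩ := hb.exists_le hW
  -- A single exponent must serve the symbol and all its partial derivatives; the sum dominates each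
  -- of them.
  refine ⟨K₀ + ∑ i, K i, hK₀ _ (Nat.le_add_right _ _), hd, fun i => ?_⟩
  have hi : K i ≤ ∑ i, K i :=
    Finset.single_le_sum (fun _ _ => Nat.zero_le _) (Finset.mem_univ i)
  exact (hK i (K₀ + ∑ i, K i) (by omega)).mono (C := 1) (fun σ ξ _ => le_of_eq (by ring))
    zero_le_one

/-- Induction through `∂(1/h) = -h⁻² ∂h`. The condition `W W' ≤ C` says that `W'` is at most a
multiple of `1/W`, so the weight `W'² · sW` of the derivative is at most `C · sW'`. -/
lemma PSym.inv (hh : F.PSym j W h) {C : ℝ} (hC : 0 ≤ C)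
    (hW' : ∀ σ, ∀ ξ ∈ F.U σ, ‖(h σ ξ)⁻¹‖ ≤ W' σ ξ) (h0 : ∀ σ, ∀ ξ ∈ F.U σ, h σ ξ ≠ 0)
    (hWW : ∀ σ, ∀ ξ ∈ F.U σ, W σ ξ * W' σ ξ ≤ C) :
    F.PSym j W' (fun σ ξ => (h σ ξ)⁻¹) := by
  have hn : ∀ σ, ∀ ξ ∈ F.U σ, 0 ≤ W' σ ξ := fun σ ξ hξ => (norm_nonneg _).trans (hW' σ ξ hξ)
  have hu : F.UBd W' (fun σ ξ => (h σ ξ)⁻¹) := ⟨1, zero_le_one, by simpa using hW'⟩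
  induction j with
  | zero => exact PSym.of_sym hu
  | succ j ih =>
    have hd : ∀ {σ ξ}, ξ ∈ F.U σ → DifferentiableAt ℝ (h σ) ξ := by
      obtain ⟨K, hK⟩ := hh
      exact fun hξ => hK.diffAt hξ
    refine PSym.of_pd (PSym.of_sym (j := 0) hu) hn (fun σ ξ hξ => ((hd hξ).fun_inv (h0 σ ξ hξ)).differentiableWithinAt)
      fun i => ?_
    have hi := ih hh.of_succ
    have hm : F.PSym j (fun _ _ => 1) (fun _ _ => (-1 : ℂ)) :=
      PSym.of_sym (Sym.const (C := 1) (by simp))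
    refine PSym.congr (f := fun σ ξ => (-1) * ((h σ ξ)⁻¹ * (h σ ξ)⁻¹) * FourierDecay.pd i (h σ) ξ)
      (((hm.mul (hi.mul hi)).mul (hh.pd i)).mono (C := C) (fun σ ξ hξ => ?_) hC) fun σ ξ hξ => ?_
    · have h1 := mul_le_mul_of_nonneg_left (hWW σ ξ hξ)
        (mul_nonneg (zero_le_one.trans (F.one_le_s σ)) (hn σ ξ hξ))
      linarith
    · rw [pd_inv (hd hξ) (h0 σ ξ hξ)]; ring

lemma RSym.mono (hb : F.RSym j W b) {C : ℝ}
    (hW : ∀ σ, ∀ ξ ∈ F.U σ, W σ ξ ≤ C * W' σ ξ) (hC : 0 ≤ C) : F.RSym j W' b := by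
  refine fun N => (hb N).mono (fun σ ξ hξ => ?_) hC
  have := mul_le_mul_of_nonneg_left (hW σ ξ hξ) (pow_nonneg (F.δ_pos σ ξ hξ).le N)
  linarith

lemma RSym.congr (hb : F.RSym j W f) (hfg : ∀ σ, ∀ ξ ∈ F.U σ, f σ ξ = g σ ξ) : F.RSym j W g :=
  fun N => (hb N).congr hfg

lemma RSym.of_succ (hb : F.RSym (j + 1) W b) : F.RSym j W b := fun N => (hb N).of_succ

lemma RSym.add (hf : F.RSym j W f) (hg : F.RSym j W g) :
    F.RSym j W (fun σ ξ => f σ ξ + g σ ξ) := fun N => (hf N).add (hg N)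

lemma RSym.sum {κ : Type*} (t : Finset κ) {f : κ → ι → EuclideanSpace ℝ (Fin n) → ℂ}
    (hW : ∀ σ, ∀ ξ ∈ F.U σ, 0 ≤ W σ ξ) (hf : ∀ k, F.RSym j W (f k)) :
    F.RSym j W (fun σ ξ => ∑ k ∈ t, f k σ ξ) := fun N => Sym.sum t
  (fun σ ξ hξ => mul_nonneg (pow_nonneg (F.δ_pos σ ξ hξ).le N) (hW σ ξ hξ)) fun k => hf k N

lemma RSym.pd (hb : F.RSym (j + 1) W b) (i : Fin n) :
    F.RSym j (fun σ ξ => F.s σ * W σ ξ) (fun σ => FourierDecay.pd i (b σ)) :=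
  fun N => ((hb N).2.2 i).mono (C := 1) (fun σ ξ _ => le_of_eq (by ring)) zero_le_one

/-- The loss `δ^{-K}` is paid by asking the second factor for `K` more powers of `δ`. -/
lemma PSym.mul_rSym (hf : F.PSym j W f) (hg : F.RSym j W' g) :
    F.RSym j (fun σ ξ => W σ ξ * W' σ ξ) (fun σ ξ => f σ ξ * g σ ξ) := by
  obtain ⟨K, hK⟩ := hf
  refine fun N => (hK.mul (hg (K + N))).mono (C := 1) (fun σ ξ hξ => le_of_eq ?_) zero_le_one
  have := (F.δ_pos σ ξ hξ).ne'
  rw [pow_add, inv_pow]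
  field_simp

end SymbolFrame

/-! ### Integration by parts without boundary regularity -/

/-- The integral of a partial derivative over an open set vanishes if the function vanishes to
second order at the boundary. -/
lemma setIntegral_pd_eq_zero {n : ℕ} {U : Set (EuclideanSpace ℝ (Fin n))} (hU : IsOpen U)
    (hV : volume U ≠ ⊤) {f : EuclideanSpace ℝ (Fin n) → ℂ} {C : ℝ}
    (hC : 0 ≤ C) (hf : DifferentiableOn ℝ f U) (hb : ∀ ξ ∈ U, ‖f ξ‖ ≤ C)
    (hb2 : ∀ ξ ∈ U, ‖f ξ‖ ≤ C * Metric.infDist ξ Uᶜ ^ 2) (i : Fin n)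
    (hd : ∀ ξ ∈ U, ‖pd i f ξ‖ ≤ C) : ∫ ξ in U, pd i f ξ = 0 := by
  -- The extension by zero is differentiable everywhere: at a point `ξ` outside `U`, `|g(ξ+h)| ≤
  -- C|h|² = o(|h|)`. Nothing is needed about the shape of the boundary.
  set g := U.indicator f with hg
  have hgU : ∀ ξ ∈ U, HasFDerivAt g (fderiv ℝ f ξ) ξ := fun ξ hξ => by
    refine (hf.differentiableAt (hU.mem_nhds hξ)).hasFDerivAt.congr_of_eventuallyEq ?_
    filter_upwards [hU.mem_nhds hξ] with η hη
    simp [hg, hη]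
  have hgc : ∀ ξ ∉ U, HasFDerivAt g (0 : EuclideanSpace ℝ (Fin n) →L[ℝ] ℂ) ξ := fun ξ hξ => by
    have h0 : g ξ = 0 := by simp [hg, hξ]
    rw [hasFDerivAt_iff_isLittleO_nhds_zero]
    have hbig : (fun h : EuclideanSpace ℝ (Fin n) => g (ξ + h)) =O[nhds 0] fun h => ‖h‖ ^ 2 := by
      refine Asymptotics.IsBigO.of_bound C (Filter.Eventually.of_forall fun h => ?_)
      by_cases hh : ξ + h ∈ U
      · have h1 : Metric.infDist (ξ + h) Uᶜ ≤ ‖h‖ := by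
          simpa using Metric.infDist_le_dist_of_mem (x := ξ + h) (s := Uᶜ) hξ
        have h2 := hb2 _ hh
        simp only [hg, hh, Set.indicator_of_mem, norm_pow, norm_norm]
        refine h2.trans (mul_le_mul_of_nonneg_left ?_ hC)
        exact pow_le_pow_left₀ Metric.infDist_nonneg h1 2
      · simp only [hg, hh, not_false_eq_true, Set.indicator_of_notMem, norm_zero]
        positivity
    have hlit : (fun h : EuclideanSpace ℝ (Fin n) => ‖h‖ ^ 2) =o[nhds 0] fun h => h := by
      have := Asymptotics.isLittleO_norm_pow_id (E' := EuclideanSpace ℝ (Fin n)) one_lt_two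
      simpa using this
    simpa [h0] using hbig.trans_isLittleO hlit
  have hgd : Differentiable ℝ g := fun ξ => by
    by_cases hξ : ξ ∈ U
    · exact (hgU ξ hξ).differentiableAt
    · exact (hgc ξ hξ).differentiableAt
  have hpd : ∀ ξ, pd i g ξ = U.indicator (pd i f) ξ := fun ξ => by
    by_cases hξ : ξ ∈ U
    · simp [pd, (hgU ξ hξ).fderiv, hξ]
    · simp [pd, (hgc ξ hξ).fderiv, hξ]
  have hbound : ∀ {u : EuclideanSpace ℝ (Fin n) → ℂ}, Measurable (U.indicator u) →
      (∀ ξ ∈ U, ‖u ξ‖ ≤ C) → Integrable (U.indicator u) := fun {u} hm hu => by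
    have hc : Integrable (U.indicator fun _ : EuclideanSpace ℝ (Fin n) => C) :=
      (integrable_indicator_iff hU.measurableSet).2 (integrableOn_const hV)
    refine hc.mono hm.aestronglyMeasurable (Filter.Eventually.of_forall fun ξ => ?_)
    by_cases hξ : ξ ∈ U
    · simpa [hξ, abs_of_nonneg hC] using hu ξ hξ
    · simp [hξ]
  have hig : Integrable g := hbound hgd.continuous.measurable hb
  have hpd' : pd i g = U.indicator (pd i f) := funext hpd
  have hid : Integrable (pd i g) := by
    have hm : Measurable (pd i g) := measurable_fderiv_apply_const ℝ g _
    rw [hpd'] at hm ⊢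
    exact hbound hm hd
  have key := integral_bilinear_hasLineDerivAt_right_eq_neg_left_of_integrable
    (μ := (volume : Measure (EuclideanSpace ℝ (Fin n)))) (f := fun _ => (1 : ℂ))
    (f' := fun _ => (0 : ℂ)) (g := g) (g' := pd i g) (v := EuclideanSpace.single i (1 : ℝ))
    (B := ContinuousLinearMap.mul ℝ ℂ) (by simp) (by simpa using hid) (by simpa using hig)
    (fun x _ => by
      simpa using (hasFDerivAt_const (1 : ℂ) x).hasLineDerivAt (EuclideanSpace.single i (1 : ℝ)))
    (fun x _ => (hgd x).hasFDerivAt.hasLineDerivAt (EuclideanSpace.single i (1 : ℝ)))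
  rw [← integral_indicator hU.measurableSet, ← hpd']
  simpa using key

namespace SymbolFrame

variable {ι : Type*} {n : ℕ} {F : SymbolFrame ι n}
  {φ : ι → EuclideanSpace ℝ (Fin n) → ℂ} {G : Fin n → ι → EuclideanSpace ℝ (Fin n) → ℂ}
  {b : ι → EuclideanSpace ℝ (Fin n) → ℂ} {j : ℕ}

variable (F G) in
/-- The weight `1 + s |G|`. -/
def wt (σ : ι) (ξ : EuclideanSpace ℝ (Fin n)) : ℝ := 1 + F.s σ * ‖fun i => G i σ ξ‖

variable (F) in
lemma s_pos {σ : ι} : 0 < F.s σ := zero_lt_one.trans_le (F.one_le_s σ)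

lemma one_le_wt (σ : ι) (ξ : EuclideanSpace ℝ (Fin n)) : 1 ≤ F.wt G σ ξ :=
  le_add_of_nonneg_right (mul_nonneg F.s_pos.le (norm_nonneg _))

lemma wt_pos (σ : ι) (ξ : EuclideanSpace ℝ (Fin n)) : 0 < F.wt G σ ξ :=
  zero_lt_one.trans_le (one_le_wt σ ξ)

lemma norm_le_wt_div (i : Fin n) (σ : ι) (ξ : EuclideanSpace ℝ (Fin n)) :
    ‖G i σ ξ‖ ≤ F.wt G σ ξ / F.s σ := by
  rw [le_div_iff₀ F.s_pos, wt]
  have := norm_le_pi_norm (fun i => G i σ ξ) i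
  nlinarith [F.s_pos (σ := σ)]

variable (F G) in
/-- The regularised square `1 + s² ∑ |G_i|²`. -/
def wtSq (σ : ι) (ξ : EuclideanSpace ℝ (Fin n)) : ℂ :=
  1 + (F.s σ : ℂ) ^ 2 * ∑ i, G i σ ξ * (starRingEnd ℂ) (G i σ ξ)

lemma wtSq_eq (σ : ι) (ξ : EuclideanSpace ℝ (Fin n)) :
    F.wtSq G σ ξ = ((1 + F.s σ ^ 2 * ∑ i, ‖G i σ ξ‖ ^ 2 : ℝ) : ℂ) := by
  simp only [wtSq, Complex.mul_conj']
  push_cast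
  rfl

/-- The norm inside `wt` is the sup norm, which is at most the Euclidean one, and `(1+y)² ≤
2(1+y²)`. So `wtSq`, which can be differentiated and inverted, controls the square of the weight
`wt`. -/
lemma wt_sq_le (σ : ι) (ξ : EuclideanSpace ℝ (Fin n)) :
    F.wt G σ ξ ^ 2 ≤ 2 * ‖F.wtSq G σ ξ‖ := by
  have hS : 0 ≤ ∑ i, ‖G i σ ξ‖ ^ 2 := by positivity
  have h1 : ‖fun i => G i σ ξ‖ ≤ √(∑ i, ‖G i σ ξ‖ ^ 2) := by
    refine (pi_norm_le_iff_of_nonneg (Real.sqrt_nonneg _)).2 fun i => ?_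
    refine Real.le_sqrt_of_sq_le ?_
    exact Finset.single_le_sum (f := fun i => ‖G i σ ξ‖ ^ 2) (fun _ _ => by positivity)
      (Finset.mem_univ i)
  have h2 : ‖fun i => G i σ ξ‖ ^ 2 ≤ ∑ i, ‖G i σ ξ‖ ^ 2 := by
    rw [← Real.sq_sqrt hS]
    exact pow_le_pow_left₀ (norm_nonneg _) h1 2
  rw [wtSq_eq, Complex.norm_real, Real.norm_of_nonneg (by positivity), wt]
  nlinarith [mul_le_mul_of_nonneg_left h2 (sq_nonneg (F.s σ)),
    sq_nonneg (1 - F.s σ * ‖fun i => G i σ ξ‖)]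

lemma wtSq_ne_zero (σ : ι) (ξ : EuclideanSpace ℝ (Fin n)) : F.wtSq G σ ξ ≠ 0 := by
  intro h
  have h1 := F.wt_sq_le (G := G) σ ξ
  have h2 := F.wt_pos (G := G) σ ξ
  rw [h, norm_zero, mul_zero] at h1
  nlinarith

lemma pSym_wtSq (hG : ∀ i, F.PSym j (fun σ ξ => F.wt G σ ξ / F.s σ) (G i)) :
    F.PSym j (fun σ ξ => F.wt G σ ξ ^ 2) (F.wtSq G) := by
  have h1 : F.PSym j (fun σ ξ => F.wt G σ ξ ^ 2) (fun _ _ => (1 : ℂ)) :=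
    (PSym.of_sym (Sym.const (C := 1) (by simp))).mono (C := 1)
      (fun σ ξ _ => (one_le_pow₀ (one_le_wt σ ξ)).trans_eq (one_mul _).symm)
      zero_le_one
  have h2 : F.PSym j (fun σ ξ => (F.wt G σ ξ / F.s σ) * (F.wt G σ ξ / F.s σ))
      (fun σ ξ => ∑ i, G i σ ξ * (starRingEnd ℂ) (G i σ ξ)) :=
    PSym.sum _ (fun σ ξ _ => mul_self_nonneg _) fun i => (hG i).mul (hG i).conj
  have h3 : F.PSym j (fun σ _ => F.s σ ^ 2) (fun σ _ => (F.s σ : ℂ) ^ 2) := by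
    have hu : F.UBd (fun σ _ => F.s σ ^ 2) (fun σ _ => (F.s σ : ℂ) ^ 2) :=
      ⟨1, zero_le_one, fun σ ξ _ => by simp⟩
    refine PSym.of_sym ?_
    cases j with
    | zero => exact hu
    | succ j =>
      exact ⟨hu, fun σ => differentiableOn_const _, fun i => (Sym.zero fun σ ξ hξ =>
        mul_nonneg F.s_pos.le (sq_nonneg _)).congr fun σ ξ hξ => by simp [FourierDecay.pd]⟩
  refine h1.add ((h3.mul h2).mono (C := 1) (fun σ ξ _ => le_of_eq ?_) zero_le_one)
    fun σ ξ _ => sq_nonneg _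
  have := (F.s_pos (σ := σ)).ne'
  field_simp

lemma pSym_inv_wtSq (hG : ∀ i, F.PSym j (fun σ ξ => F.wt G σ ξ / F.s σ) (G i)) :
    F.PSym j (fun σ ξ => (F.wt G σ ξ ^ 2)⁻¹) (fun σ ξ => (F.wtSq G σ ξ)⁻¹) := by
  refine PSym.mono (W := fun σ ξ => 2 * (F.wt G σ ξ ^ 2)⁻¹) ((pSym_wtSq hG).inv (C := 2)
    zero_le_two (fun σ ξ _ => ?_) (fun σ ξ _ => wtSq_ne_zero σ ξ) fun σ ξ _ => ?_)
    (C := 2) (fun _ _ _ => le_rfl) zero_le_two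
  · have h1 := F.wt_sq_le (G := G) σ ξ
    have h2 := pow_pos (F.wt_pos (G := G) σ ξ) 2
    rw [norm_inv, ← div_eq_mul_inv, inv_le_comm₀ (by linarith) (by positivity), inv_div]
    linarith
  · have h2 := pow_pos (F.wt_pos (G := G) σ ξ) 2
    refine le_of_eq ?_
    rw [mul_left_comm, mul_inv_cancel₀ h2.ne', mul_one]

variable (F φ G) in
/-- The assumptions on the phase `φ` with gradient `s² G`. -/
structure IsPhase : Prop where
  diff : ∀ σ, DifferentiableOn ℝ (φ σ) (F.U σ)
  pd_eq : ∀ σ, ∀ ξ ∈ F.U σ, ∀ i, pd i (φ σ) ξ = (F.s σ : ℂ) ^ 2 * G i σ ξ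
  im_nonneg : ∀ σ, ∀ ξ ∈ F.U σ, 0 ≤ (φ σ ξ).im
  δ_le : ∀ σ, ∀ ξ ∈ F.U σ, F.δ σ ξ ≤ Metric.infDist ξ (F.U σ)ᶜ
  volume_ne_top : ∀ σ, volume (F.U σ) ≠ ⊤
  sym : ∀ j i, F.PSym j (fun σ ξ => F.wt G σ ξ / F.s σ) (G i)

lemma IsPhase.norm_exp_le (hφ : F.IsPhase φ G) {σ : ι} {ξ : EuclideanSpace ℝ (Fin n)}
    (hξ : ξ ∈ F.U σ) : ‖Complex.exp (Complex.I * φ σ ξ)‖ ≤ 1 := by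
  rw [Complex.norm_exp]
  simpa using hφ.im_nonneg σ ξ hξ

lemma IsPhase.pd_exp_mul (hφ : F.IsPhase φ G) {σ : ι} {ξ : EuclideanSpace ℝ (Fin n)}
    (hξ : ξ ∈ F.U σ) {c : EuclideanSpace ℝ (Fin n) → ℂ} (hc : DifferentiableAt ℝ c ξ) (i : Fin n) :
    pd i (fun η => Complex.exp (Complex.I * φ σ η) * c η) ξ =
      Complex.exp (Complex.I * φ σ ξ) * (Complex.I * (F.s σ : ℂ) ^ 2 * (G i σ ξ * c ξ) + pd i c ξ) := by
  have hd : DifferentiableAt ℝ (φ σ) ξ :=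
    (hφ.diff σ).differentiableAt ((F.isOpen_U σ).mem_nhds hξ)
  have he : HasFDerivAt (fun η => Complex.exp (Complex.I * φ σ η)) _ ξ :=
    (hd.hasFDerivAt.const_mul Complex.I).cexp
  rw [pd_mul he.differentiableAt hc]
  have : pd i (fun η => Complex.exp (Complex.I * φ σ η)) ξ =
      Complex.exp (Complex.I * φ σ ξ) * (Complex.I * pd i (φ σ) ξ) := by
    simp [pd, he.fderiv]
  rw [this, hφ.pd_eq σ ξ hξ i]
  ring

/-- Integration by parts against `exp (i φ)`. -/
lemma IsPhase.integral_pd (hφ : F.IsPhase φ G) {W : ι → EuclideanSpace ℝ (Fin n) → ℝ}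
    {c : ι → EuclideanSpace ℝ (Fin n) → ℂ} (hc : F.RSym 1 W c)
    (hW : ∀ σ, ∀ ξ ∈ F.U σ, 0 ≤ W σ ξ)
    (hWs : ∀ σ, ∀ ξ ∈ F.U σ, F.wt G σ ξ * F.s σ * W σ ξ ≤ 1) (σ : ι) (i : Fin n) :
    ∫ ξ in F.U σ, Complex.exp (Complex.I * φ σ ξ) *
      (Complex.I * (F.s σ : ℂ) ^ 2 * (G i σ ξ * c σ ξ) + pd i (c σ) ξ) = 0 := by
  -- Two powers of `δ` give the second order vanishing at the boundary, as `δ` is at most the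
  -- distance to the complement.
  obtain ⟨C₁, hC₁, h₁⟩ := (hc 2).ubd
  obtain ⟨C₂, hC₂, h₂⟩ := (hc.pd i 0).ubd
  have hU := F.isOpen_U σ
  have hs := F.one_le_s σ
  have hdiff : ∀ ξ ∈ F.U σ, DifferentiableAt ℝ (c σ) ξ := fun ξ hξ => (hc 0).diffAt hξ
  have hW1 : ∀ ξ ∈ F.U σ, F.s σ * W σ ξ ≤ 1 := fun ξ hξ => by
    refine le_trans ?_ (hWs σ ξ hξ)
    rw [mul_assoc]
    exact le_mul_of_one_le_left (mul_nonneg F.s_pos.le (hW σ ξ hξ)) (one_le_wt σ ξ)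
  have hW2 : ∀ ξ ∈ F.U σ, W σ ξ ≤ 1 := fun ξ hξ =>
    (le_mul_of_one_le_left (hW σ ξ hξ) hs).trans (hW1 ξ hξ)
  have hcb : ∀ ξ ∈ F.U σ, ‖c σ ξ‖ ≤ C₁ * W σ ξ := fun ξ hξ => by
    refine (h₁ σ ξ hξ).trans (mul_le_mul_of_nonneg_left ?_ hC₁)
    exact mul_le_of_le_one_left (hW σ ξ hξ)
      (pow_le_one₀ (F.δ_pos σ ξ hξ).le (F.δ_le_one σ ξ hξ))
  have hnb : ∀ ξ ∈ F.U σ, ‖Complex.exp (Complex.I * φ σ ξ) * c σ ξ‖ ≤ ‖c σ ξ‖ := fun ξ hξ => by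
    rw [norm_mul]
    exact mul_le_of_le_one_left (norm_nonneg _) (hφ.norm_exp_le hξ)
  rw [← setIntegral_pd_eq_zero (f := fun η => Complex.exp (Complex.I * φ σ η) * c σ η) hU
    (hφ.volume_ne_top σ) (C := C₁ * F.s σ + C₂)
    (by have := F.s_pos (σ := σ); positivity) ?_ ?_ ?_ i ?_]
  · exact setIntegral_congr_fun hU.measurableSet fun ξ hξ =>
      (hφ.pd_exp_mul hξ (hdiff ξ hξ) i).symm
  · intro ξ hξ
    have hd := (hφ.diff σ).differentiableAt (hU.mem_nhds hξ)
    exact (((hd.const_mul Complex.I).cexp).fun_mul (hdiff ξ hξ)).differentiableWithinAt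
  · intro ξ hξ
    refine (hnb ξ hξ).trans ((hcb ξ hξ).trans ?_)
    nlinarith [mul_le_mul_of_nonneg_left (hW2 ξ hξ) hC₁]
  · intro ξ hξ
    refine (hnb ξ hξ).trans ((h₁ σ ξ hξ).trans ?_)
    have h3 : F.δ σ ξ ^ 2 ≤ Metric.infDist ξ (F.U σ)ᶜ ^ 2 :=
      pow_le_pow_left₀ (F.δ_pos σ ξ hξ).le (hφ.δ_le σ ξ hξ) 2
    have h4 : F.δ σ ξ ^ 2 * W σ ξ ≤ Metric.infDist ξ (F.U σ)ᶜ ^ 2 :=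
      (mul_le_of_le_one_right (sq_nonneg _) (hW2 ξ hξ)).trans h3
    refine (mul_le_mul_of_nonneg_left h4 hC₁).trans
      (mul_le_mul_of_nonneg_right ?_ (sq_nonneg _))
    nlinarith
  · intro ξ hξ
    rw [hφ.pd_exp_mul hξ (hdiff ξ hξ) i, norm_mul]
    refine (mul_le_of_le_one_left (norm_nonneg _) (hφ.norm_exp_le hξ)).trans
      ((norm_add_le _ _).trans (add_le_add ?_ ?_))
    · simp only [norm_mul, Complex.norm_I, one_mul, norm_pow, Complex.norm_real,
        Real.norm_of_nonneg F.s_pos.le]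
      have hs0 := F.s_pos (σ := σ)
      calc F.s σ ^ 2 * (‖G i σ ξ‖ * ‖c σ ξ‖)
          ≤ F.s σ ^ 2 * (F.wt G σ ξ / F.s σ * (C₁ * W σ ξ)) :=
            mul_le_mul_of_nonneg_left (mul_le_mul (norm_le_wt_div i σ ξ) (hcb ξ hξ)
              (norm_nonneg _) (div_nonneg (wt_pos σ ξ).le hs0.le)) (sq_nonneg _)
        _ = C₁ * (F.wt G σ ξ * F.s σ * W σ ξ) := by field_simp
        _ ≤ C₁ * F.s σ := mul_le_mul_of_nonneg_left ((hWs σ ξ hξ).trans hs) hC₁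
    · refine (h₂ σ ξ hξ).trans ?_
      simpa using mul_le_mul_of_nonneg_left (hW1 ξ hξ) hC₂

lemma IsPhase.integrableOn (hφ : F.IsPhase φ G) {W : ι → EuclideanSpace ℝ (Fin n) → ℝ}
    (hb : F.RSym (j + 1) W b) (hW : ∀ σ, ∀ ξ ∈ F.U σ, W σ ξ ≤ 1) (σ : ι) :
    IntegrableOn (fun ξ => Complex.exp (Complex.I * φ σ ξ) * b σ ξ) (F.U σ) := by
  obtain ⟨C, hC, h⟩ := (hb 0).ubd
  have hU := F.isOpen_U σ
  have hcont : ContinuousOn (fun ξ => Complex.exp (Complex.I * φ σ ξ) * b σ ξ) (F.U σ) :=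
    ((continuousOn_const.mul (hφ.diff σ).continuousOn).cexp).mul ((hb 0).2.1 σ).continuousOn
  have : IsFiniteMeasure (volume.restrict (F.U σ)) :=
    isFiniteMeasure_restrict.2 (hφ.volume_ne_top σ)
  refine Integrable.of_bound (hcont.aestronglyMeasurable hU.measurableSet) C ?_
  filter_upwards [ae_restrict_mem hU.measurableSet] with ξ hξ
  rw [norm_mul]
  refine (mul_le_of_le_one_left (norm_nonneg _) (hφ.norm_exp_le hξ)).trans ((h σ ξ hξ).trans ?_)
  simpa using mul_le_mul_of_nonneg_left (hW σ ξ hξ) hC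

/-- One step of integration by parts gains a factor `(1 + s|G|)⁻¹`. -/
lemma IsPhase.exists_gain (hφ : F.IsPhase φ G) {k : ℕ}
    (hb : F.RSym (j + 2) (fun σ ξ => (F.wt G σ ξ ^ k)⁻¹) b) :
    ∃ b', F.RSym (j + 1) (fun σ ξ => (F.wt G σ ξ ^ (k + 1))⁻¹) b' ∧
      ∀ σ, ∫ ξ in F.U σ, Complex.exp (Complex.I * φ σ ξ) * b σ ξ =
        ∫ ξ in F.U σ, Complex.exp (Complex.I * φ σ ξ) * b' σ ξ := by
  have hle : ∀ (k : ℕ) σ, ∀ ξ ∈ F.U σ, (F.wt G σ ξ ^ k)⁻¹ ≤ 1 := fun k σ ξ _ =>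
    inv_le_one_of_one_le₀ (one_le_pow₀ (one_le_wt σ ξ))
  have hnn : ∀ (k : ℕ) σ, ∀ ξ ∈ F.U σ, 0 ≤ (F.wt G σ ξ ^ k)⁻¹ := fun k σ ξ _ =>
    inv_nonneg.2 (pow_nonneg (wt_pos σ ξ).le k)
  set w : ι → EuclideanSpace ℝ (Fin n) → ℂ := fun σ ξ => (F.wtSq G σ ξ)⁻¹ with hw
  have hwP : ∀ j, F.PSym j (fun σ ξ => (F.wt G σ ξ ^ 2)⁻¹) w := fun j => pSym_inv_wtSq (hφ.sym j)
  -- With `w = 1/(1+s²∑|G_i|²)` one has `b = w b + s² ∑ G_i c_i`. As `s² G_i e^{iφ} = -i ∂_i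
  -- e^{iφ}`, the sum integrates by parts to `i ∑ ∂_i c_i`.
  set c : Fin n → ι → EuclideanSpace ℝ (Fin n) → ℂ :=
    fun i σ ξ => w σ ξ * (starRingEnd ℂ) (G i σ ξ) * b σ ξ with hc
  -- The weights multiply to `wt⁻² · (wt/s) · wt⁻ᵏ`: one power of `wt` is gained, and the factor
  -- `1/s` pays for the derivative that falls on `c_i`.
  have hcR : ∀ i, F.RSym (j + 2) (fun σ ξ => (F.wt G σ ξ ^ (k + 1))⁻¹ / F.s σ) (c i) := fun i => by
    refine RSym.mono (((hwP _).mul (hφ.sym _ i).conj).mul_rSym hb) (C := 1)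
      (fun σ ξ _ => le_of_eq ?_) zero_le_one
    have h1 := (F.wt_pos (G := G) σ ξ).ne'
    have h2 := (F.s_pos (σ := σ)).ne'
    field_simp
    ring
  have hcd : ∀ i, F.RSym (j + 1) (fun σ ξ => (F.wt G σ ξ ^ (k + 1))⁻¹)
      (fun σ => pd i (c i σ)) := fun i => by
    refine ((hcR i).pd i).mono (C := 1) (fun σ ξ _ => le_of_eq ?_) zero_le_one
    have h2 := (F.s_pos (σ := σ)).ne'
    field_simp
  have hwb : F.RSym (j + 1) (fun σ ξ => (F.wt G σ ξ ^ (k + 1))⁻¹) (fun σ ξ => w σ ξ * b σ ξ) := by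
    refine RSym.mono ((hwP _).mul_rSym hb.of_succ) (C := 1) (fun σ ξ _ => ?_) zero_le_one
    rw [one_mul, ← mul_inv, ← pow_add]
    exact inv_anti₀ (pow_pos (wt_pos σ ξ) _) (pow_le_pow_right₀ (one_le_wt σ ξ) (by omega))
  have hsum : F.RSym (j + 1) (fun σ ξ => (F.wt G σ ξ ^ (k + 1))⁻¹)
      (fun σ ξ => ∑ i, pd i (c i σ) ξ) := RSym.sum _ (hnn (k + 1)) hcd
  have hI : F.PSym (j + 1) (fun _ _ => 1) (fun _ _ => Complex.I) :=
    PSym.of_sym (Sym.const (C := 1) (by simp))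
  have hb' : F.RSym (j + 1) (fun σ ξ => (F.wt G σ ξ ^ (k + 1))⁻¹)
      (fun σ ξ => w σ ξ * b σ ξ + Complex.I * ∑ i, pd i (c i σ) ξ) := by
    refine hwb.add ((hI.mul_rSym hsum).mono (C := 1) (fun σ ξ _ => le_of_eq (by ring)) zero_le_one)
  refine ⟨_, hb', fun σ => ?_⟩
  have hU := (F.isOpen_U σ).measurableSet
  have hint1 := hφ.integrableOn hb (hle k) σ
  have hint2 := hφ.integrableOn hb' (hle (k + 1)) σ
  have hzero : ∀ i, ∫ ξ in F.U σ, Complex.exp (Complex.I * φ σ ξ) *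
      (Complex.I * (F.s σ : ℂ) ^ 2 * (G i σ ξ * c i σ ξ) + pd i (c i σ) ξ) = 0 := fun i => by
    have h1 : F.RSym 1 (fun σ ξ => (F.wt G σ ξ ^ (k + 1))⁻¹ / F.s σ) (c i) := by
      intro N
      have := hcR i N
      exact ⟨this.1, this.2.1, fun i => (this.2.2 i).ubd⟩
    refine hφ.integral_pd h1 (fun σ ξ hξ => div_nonneg (hnn _ σ ξ hξ) F.s_pos.le)
      (fun σ ξ hξ => ?_) σ i
    refine le_trans (le_of_eq ?_) (hle k σ ξ hξ)
    have h1 := (F.wt_pos (G := G) σ ξ).ne'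
    have h2 := (F.s_pos (σ := σ)).ne'
    rw [pow_succ]
    field_simp
  have hGc : ∀ i, F.RSym (j + 1) (fun σ ξ => (F.wt G σ ξ ^ k)⁻¹ / F.s σ ^ 2)
      (fun σ ξ => G i σ ξ * c i σ ξ) := fun i => by
    refine RSym.mono ((hφ.sym _ i).mul_rSym (hcR i).of_succ) (C := 1)
      (fun σ ξ _ => le_of_eq ?_) zero_le_one
    have h1 := (F.wt_pos (G := G) σ ξ).ne'
    have h2 := (F.s_pos (σ := σ)).ne'
    rw [pow_succ]
    field_simp
  have hGint : ∀ i, IntegrableOn (fun ξ => Complex.exp (Complex.I * φ σ ξ) *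
      (Complex.I * (F.s σ : ℂ) ^ 2 * (G i σ ξ * c i σ ξ) + pd i (c i σ) ξ)) (F.U σ) := fun i => by
    have h1 := hφ.integrableOn (hGc i) (fun σ ξ hξ => div_le_one_of_le₀
      ((hle k σ ξ hξ).trans (one_le_pow₀ (F.one_le_s σ))) (sq_nonneg _)) σ
    have h2 := hφ.integrableOn (hcd i) (hle (k + 1)) σ
    refine ((h1.const_mul (Complex.I * (F.s σ : ℂ) ^ 2)).add h2).congr ?_
    refine Filter.Eventually.of_forall fun ξ => ?_
    simp only [Pi.add_apply]
    ring
  rw [← sub_eq_zero, ← integral_sub hint1 hint2]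
  -- The difference of the two integrands is exactly the divergence `∑ -i ∂_i(e^{iφ} c_i)`.
  have hpt : ∀ ξ, Complex.exp (Complex.I * φ σ ξ) * b σ ξ - Complex.exp (Complex.I * φ σ ξ) *
      (w σ ξ * b σ ξ + Complex.I * ∑ i, pd i (c i σ) ξ) =
      ∑ i, (-Complex.I) * (Complex.exp (Complex.I * φ σ ξ) *
      (Complex.I * (F.s σ : ℂ) ^ 2 * (G i σ ξ * c i σ ξ) + pd i (c i σ) ξ)) := fun ξ => by
    have h1 : w σ ξ * F.wtSq G σ ξ = 1 := inv_mul_cancel₀ (wtSq_ne_zero σ ξ)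
    rw [wtSq, mul_add, mul_one, Finset.mul_sum, Finset.mul_sum] at h1
    have h2 : b σ ξ = w σ ξ * b σ ξ + (F.s σ : ℂ) ^ 2 * ∑ i, G i σ ξ * c i σ ξ := by
      calc b σ ξ = 1 * b σ ξ := (one_mul _).symm
        _ = _ := by
          rw [← h1, add_mul, Finset.sum_mul, Finset.mul_sum]
          congr 1
          refine Finset.sum_congr rfl fun i _ => ?_
          simp only [hc]
          ring
    rw [← Finset.mul_sum, ← Finset.mul_sum, Finset.sum_add_distrib, ← Finset.mul_sum]
    linear_combination Complex.exp (Complex.I * φ σ ξ) * h2 +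
      Complex.exp (Complex.I * φ σ ξ) * (F.s σ : ℂ) ^ 2 * (∑ i, G i σ ξ * c i σ ξ) *
        Complex.I_mul_I
  simp_rw [hpt]
  rw [integral_finsetSum _ fun i _ => (hGint i).const_mul _]
  refine Finset.sum_eq_zero fun i _ => ?_
  rw [integral_const_mul, hzero i, mul_zero]

/-- Each step spends one order of differentiability, so `k` steps starting from order `k + 1` leave
order one. -/
lemma IsPhase.exists_gain_iterate (hφ : F.IsPhase φ G) (k : ℕ)
    (hb : F.RSym (k + 1) (fun _ _ => 1) b) :
    ∃ b', F.RSym 1 (fun σ ξ => (F.wt G σ ξ ^ k)⁻¹) b' ∧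
      ∀ σ, ∫ ξ in F.U σ, Complex.exp (Complex.I * φ σ ξ) * b σ ξ =
        ∫ ξ in F.U σ, Complex.exp (Complex.I * φ σ ξ) * b' σ ξ := by
  have key : ∀ l j, F.RSym (j + l + 1) (fun _ _ => 1) b →
      ∃ b', F.RSym (j + 1) (fun σ ξ => (F.wt G σ ξ ^ l)⁻¹) b' ∧
      ∀ σ, ∫ ξ in F.U σ, Complex.exp (Complex.I * φ σ ξ) * b σ ξ =
        ∫ ξ in F.U σ, Complex.exp (Complex.I * φ σ ξ) * b' σ ξ := by
    intro l
    induction l with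
    | zero => exact fun j h => ⟨b, by simpa using h, fun _ => rfl⟩
    | succ l ih =>
      intro j h
      obtain ⟨b₁, h₁, e₁⟩ := ih (j + 1) (by convert h using 1; omega)
      obtain ⟨b₂, h₂, e₂⟩ := hφ.exists_gain h₁
      exact ⟨b₂, h₂, fun σ => (e₁ σ).trans (e₂ σ)⟩
  exact key k 0 (by simpa using hb)

end SymbolFrame

/-! ### The boundary weight -/

/-- The weight `min (dist (ξ, Uᶜ), 1) / (1 + |ξ|)`. -/
def bdryWt {n : ℕ} (U : Set (EuclideanSpace ℝ (Fin n))) (ξ : EuclideanSpace ℝ (Fin n)) : ℝ :=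
  min (Metric.infDist ξ Uᶜ) 1 / (1 + ‖ξ‖)

section bdryWt

variable {n : ℕ} {U : Set (EuclideanSpace ℝ (Fin n))} {ξ η : EuclideanSpace ℝ (Fin n)}

lemma bdryWt_nonneg (ξ : EuclideanSpace ℝ (Fin n)) : 0 ≤ bdryWt U ξ :=
  div_nonneg (le_min Metric.infDist_nonneg zero_le_one) (by positivity)

lemma continuous_bdryWt : Continuous (bdryWt U) := by
  refine ((Metric.continuous_infDist_pt _).min continuous_const).div
    (continuous_const.add continuous_norm) fun ξ => ?_
  positivity

lemma bdryWt_pos (hU : IsOpen U) (hne : Uᶜ.Nonempty) (hξ : ξ ∈ U) : 0 < bdryWt U ξ := by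
  refine div_pos (lt_min ?_ zero_lt_one) (by positivity)
  exact (hU.isClosed_compl.notMem_iff_infDist_pos hne).1 (by simpa using hξ)

lemma bdryWt_le_min (ξ : EuclideanSpace ℝ (Fin n)) :
    bdryWt U ξ ≤ min (Metric.infDist ξ Uᶜ) 1 :=
  div_le_self (le_min Metric.infDist_nonneg zero_le_one) (by simp)

lemma bdryWt_le_one (ξ : EuclideanSpace ℝ (Fin n)) : bdryWt U ξ ≤ 1 :=
  (bdryWt_le_min ξ).trans (min_le_right _ _)

lemma bdryWt_le_infDist (ξ : EuclideanSpace ℝ (Fin n)) : bdryWt U ξ ≤ Metric.infDist ξ Uᶜ :=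
  (bdryWt_le_min ξ).trans (min_le_left _ _)

lemma one_add_norm_mul_bdryWt_le (ξ : EuclideanSpace ℝ (Fin n)) :
    (1 + ‖ξ‖) * bdryWt U ξ ≤ 1 := by
  rw [bdryWt, mul_div_cancel₀ _ (by positivity)]
  exact min_le_right _ _

/-- Both `min(dist,1)` and `1+|ξ|` are 1-Lipschitz, and the displacement is at most a quarter of the
first at `ξ`, hence at most `1/4`. The weight is thus comparable throughout a ball of radius a
quarter of its value. -/
lemma bdryWt_slow (h : ‖ξ - η‖ ≤ bdryWt U ξ / 4) :
    bdryWt U ξ ≤ 2 * bdryWt U η ∧ bdryWt U η ≤ 2 * bdryWt U ξ := by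
  set a := min (Metric.infDist ξ Uᶜ) 1 with ha
  set b := min (Metric.infDist η Uᶜ) 1 with hb
  have ha0 : 0 ≤ a := le_min Metric.infDist_nonneg zero_le_one
  have hb0 : 0 ≤ b := le_min Metric.infDist_nonneg zero_le_one
  have h1 : ‖ξ - η‖ ≤ a / 4 := h.trans (by linarith [bdryWt_le_min (U := U) ξ])
  have h2 : ‖ξ - η‖ ≤ 1 / 4 := h1.trans (by linarith [min_le_right (Metric.infDist ξ Uᶜ) 1])
  have d1 : Metric.infDist ξ Uᶜ ≤ Metric.infDist η Uᶜ + ‖ξ - η‖ := by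
    simpa [dist_eq_norm] using Metric.infDist_le_infDist_add_dist (s := Uᶜ) (x := ξ) (y := η)
  have d2 : Metric.infDist η Uᶜ ≤ Metric.infDist ξ Uᶜ + ‖ξ - η‖ := by
    simpa [dist_eq_norm, norm_sub_rev] using
      Metric.infDist_le_infDist_add_dist (s := Uᶜ) (x := η) (y := ξ)
  have hn0 := norm_nonneg (ξ - η)
  have hab : a ≤ b + ‖ξ - η‖ := by
    rw [hb, ← min_add_add_right]
    exact min_le_min d1 (by linarith)
  have hba : b ≤ a + ‖ξ - η‖ := by
    rw [ha, ← min_add_add_right]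
    exact min_le_min d2 (by linarith)
  have n1 : ‖ξ‖ ≤ ‖η‖ + ‖ξ - η‖ := by simpa using norm_add_le η (ξ - η)
  have n2 : ‖η‖ ≤ ‖ξ‖ + ‖ξ - η‖ := by simpa using norm_sub_le ξ (ξ - η)
  have hξ := norm_nonneg ξ
  have hη := norm_nonneg η
  constructor
  · rw [bdryWt, bdryWt, ← ha, ← hb, ← mul_div_assoc, div_le_div_iff₀ (by positivity) (by positivity)]
    nlinarith
  · rw [bdryWt, bdryWt, ← ha, ← hb, ← mul_div_assoc, div_le_div_iff₀ (by positivity) (by positivity)]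
    nlinarith

end bdryWt

/-! ### Integrals of powers of `(1 + s|G|)⁻¹` for expanding maps -/

/-- The integral of `(1 + |y|)^{-n-1}`. -/
def bracketInt (n : ℕ) : ℝ :=
  (∫⁻ y : EuclideanSpace ℝ (Fin n), ENNReal.ofReal ((1 + ‖y‖) ^ (n + 1))⁻¹).toReal

lemma lintegral_bracket (n : ℕ) :
    ∫⁻ y : EuclideanSpace ℝ (Fin n), ENNReal.ofReal ((1 + ‖y‖) ^ (n + 1))⁻¹ =
      ENNReal.ofReal (bracketInt n) := by
  rw [bracketInt, ENNReal.ofReal_toReal]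
  have h := finite_integral_one_add_norm (E := EuclideanSpace ℝ (Fin n)) (μ := volume)
    (r := n + 1) (by simp)
  convert h.ne using 6 with y
  rw [Real.rpow_neg (by positivity)]
  norm_cast

lemma lintegral_bracket_scale {n : ℕ} {R : ℝ} (hR : 0 < R) (z : EuclideanSpace ℝ (Fin n)) :
    ∫⁻ y : EuclideanSpace ℝ (Fin n), ENNReal.ofReal ((1 + R * ‖y - z‖) ^ (n + 1))⁻¹ =
      ENNReal.ofReal ((R ^ n)⁻¹ * bracketInt n) := by
  rw [lintegral_sub_right_eq_self
    (fun y : EuclideanSpace ℝ (Fin n) => ENNReal.ofReal ((1 + R * ‖y‖) ^ (n + 1))⁻¹) z]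
  have hm : Measurable fun y : EuclideanSpace ℝ (Fin n) =>
      ENNReal.ofReal ((1 + ‖y‖) ^ (n + 1))⁻¹ := by fun_prop
  have h := lintegral_map (μ := volume) hm (measurable_const_smul R)
  rw [Measure.map_addHaar_smul _ hR.ne', lintegral_smul_measure, lintegral_bracket] at h
  simp only [norm_smul, Real.norm_of_nonneg hR.le, finrank_euclideanSpace, Fintype.card_fin] at h
  rw [← h, smul_eq_mul, ← ENNReal.ofReal_mul (abs_nonneg _), abs_of_nonneg (by positivity)]

/-- If `G` is expanding on `S` then `(1 + s|G|)^{-n-1}` has an integral of size `s⁻ⁿ` over `S`. -/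
lemma lintegral_le_of_expanding {n : ℕ} {X : Type*} [NormedAddCommGroup X]
    {S : Set (EuclideanSpace ℝ (Fin n))} {G : EuclideanSpace ℝ (Fin n) → X} {s l : ℝ} (hs : 0 < s)
    (hl : 0 < l) (hS : MeasurableSet S)
    (hG : ∀ ξ ∈ S, ∀ ξ' ∈ S, l * ‖ξ - ξ'‖ ≤ ‖G ξ - G ξ'‖) :
    ∫⁻ ξ in S, ENNReal.ofReal ((1 + s * ‖G ξ‖) ^ (n + 1))⁻¹ ≤
      ENNReal.ofReal (2 ^ (n + 1) * (((s * l) ^ n)⁻¹ * bracketInt n)) := by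
  rcases S.eq_empty_or_nonempty with rfl | hne
  · simp
  have hbd : BddBelow ((fun ξ => ‖G ξ‖) '' S) := ⟨0, by rintro _ ⟨ξ, -, rfl⟩; exact norm_nonneg _⟩
  -- `G` need not vanish on `S`, nor attain its least norm there. A point `z` minimising `|G|` up to
  -- `1/s` replaces the critical point: `l|ξ-z| ≤ |G ξ| + |G z| ≤ 2|G ξ| + 1/s`.
  obtain ⟨_, ⟨z, hz, rfl⟩, hlt⟩ := exists_lt_of_csInf_lt (hne.image fun ξ => ‖G ξ‖)
    (lt_add_of_pos_right (sInf ((fun ξ => ‖G ξ‖) '' S)) (inv_pos.2 hs))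
  have key : ∀ ξ ∈ S, ((1 + s * ‖G ξ‖) ^ (n + 1))⁻¹ ≤
      2 ^ (n + 1) * ((1 + s * l * ‖ξ - z‖) ^ (n + 1))⁻¹ := fun ξ hξ => by
    have h1 : sInf ((fun ξ => ‖G ξ‖) '' S) ≤ ‖G ξ‖ := csInf_le hbd ⟨ξ, hξ, rfl⟩
    have h2 := (hG ξ hξ z hz).trans (norm_sub_le _ _)
    have h3 : l * ‖ξ - z‖ ≤ 2 * ‖G ξ‖ + s⁻¹ := by
      have : ‖G z‖ ≤ ‖G ξ‖ + s⁻¹ := by simpa using hlt.le.trans (by linarith)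
      linarith
    have h4 : s * (l * ‖ξ - z‖) ≤ 2 * (s * ‖G ξ‖) + 1 := by
      have := mul_le_mul_of_nonneg_left h3 hs.le
      rw [mul_add, mul_inv_cancel₀ hs.ne'] at this
      linarith
    have h5 : 0 ≤ s * l * ‖ξ - z‖ := by positivity
    rw [← div_eq_mul_inv, ← div_pow, ← inv_pow]
    refine pow_le_pow_left₀ (by positivity) ?_ _
    rw [inv_le_comm₀ (by positivity) (by positivity), inv_div, div_le_iff₀ two_pos]
    nlinarith
  calc ∫⁻ ξ in S, ENNReal.ofReal ((1 + s * ‖G ξ‖) ^ (n + 1))⁻¹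
      ≤ ∫⁻ ξ in S, ENNReal.ofReal (2 ^ (n + 1)) *
          ENNReal.ofReal ((1 + s * l * ‖ξ - z‖) ^ (n + 1))⁻¹ := by
        refine setLIntegral_mono' hS fun ξ hξ => ?_
        rw [← ENNReal.ofReal_mul (by positivity)]
        exact ENNReal.ofReal_le_ofReal (key ξ hξ)
    _ ≤ ∫⁻ ξ, ENNReal.ofReal (2 ^ (n + 1)) *
          ENNReal.ofReal ((1 + s * l * ‖ξ - z‖) ^ (n + 1))⁻¹ := setLIntegral_le_lintegral _ _
    _ = _ := by
        rw [lintegral_const_mul' _ _ ENNReal.ofReal_ne_top, lintegral_bracket_scale (by positivity),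
          ← ENNReal.ofReal_mul (by positivity)]

/-- A map that is locally expanding, with rates controlled by powers of the boundary weight,
takes small values only on a small set. -/
lemma lintegral_le_of_locally_expanding {n : ℕ} {X : Type*} [NormedAddCommGroup X] (c : ℝ)
    (hc : 0 < c) (hc4 : c ≤ 1 / 4) (K : ℕ) (hK : 1 ≤ K) :
    ∃ D : ℝ, ∀ (U : Set (EuclideanSpace ℝ (Fin n))) (G : EuclideanSpace ℝ (Fin n) → X) (s : ℝ),
      IsOpen U → Uᶜ.Nonempty → ContinuousOn G U → 0 < s →
      (∀ ξ ∈ U, ∀ ξ', ‖ξ' - ξ‖ ≤ c * bdryWt U ξ ^ K →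
        c * bdryWt U ξ ^ K * ‖ξ' - ξ‖ ≤ ‖G ξ' - G ξ‖) →
      ∫⁻ ξ in U, ENNReal.ofReal (bdryWt U ξ ^ (K * n + K * n) * ((1 + s * ‖G ξ‖) ^ (n + 1))⁻¹) ≤
        ENNReal.ofReal (D * (s ^ n)⁻¹) * volume U := by
  set v := (volume (Metric.ball (0 : EuclideanSpace ℝ (Fin n)) 1)).toReal with hv
  have hv0 : 0 < v := ENNReal.toReal_pos (Metric.measure_ball_pos _ _ one_pos).ne'
    measure_ball_lt_top.ne
  refine ⟨(2 / c) ^ n / v * 2 ^ (K * n) * (2 ^ (n + 1) * (((c / 2 ^ K) ^ n)⁻¹ * bracketInt n)),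
    fun U G s hU hne hG hs hexp => ?_⟩
  set d := bdryWt U with hd
  have hd0 : ∀ ξ, 0 ≤ d ξ := bdryWt_nonneg
  -- Half of the expansion radius: if two balls `B(ξ, r ξ)` share a point, their centres are within
  -- the expansion radius of the centre with the larger weight.
  set r : EuclideanSpace ℝ (Fin n) → ℝ := fun ξ => c / 2 * d ξ ^ K with hr
  have hrc : Continuous r := continuous_const.mul (continuous_bdryWt.pow K)
  have hr4 : ∀ ξ, r ξ ≤ d ξ / 4 := fun ξ => by
    have h1 : d ξ ^ K ≤ d ξ := pow_le_of_le_one (hd0 ξ) (bdryWt_le_one ξ) (by omega)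
    have h2 : c / 2 * d ξ ^ K ≤ 1 / 4 * d ξ :=
      mul_le_mul (by linarith) h1 (pow_nonneg (hd0 ξ) _) (by norm_num)
    simp only [hr]; linarith
  set w : EuclideanSpace ℝ (Fin n) → ℝ := fun ξ => ((1 + s * ‖G ξ‖) ^ (n + 1))⁻¹ with hw
  have hw0 : ∀ ξ, 0 ≤ w ξ := fun ξ => by simp only [hw]; positivity
  have hwc : ContinuousOn w U := by
    refine ((continuousOn_const.add (continuousOn_const.mul hG.norm)).pow _).inv₀ fun ξ _ => ?_
    have : 0 < 1 + s * ‖G ξ‖ := by positivity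
    exact pow_ne_zero _ this.ne'
  -- Normalised so that `q ξ` times the volume of `B(ξ, r ξ)` is the integrand to be estimated.
  -- Writing the volume as an integral over `η` and exchanging the integrals takes the place of a
  -- covering argument.
  set q : EuclideanSpace ℝ (Fin n) → ℝ := fun ξ => (2 / c) ^ n / v * (d ξ ^ (K * n) * w ξ) with hq
  have hqc : ContinuousOn q U :=
    continuousOn_const.mul ((continuous_bdryWt.pow _).continuousOn.mul hwc)
  have hvol : ∀ ξ ∈ U, ENNReal.ofReal (d ξ ^ (K * n + K * n) * w ξ) =
      ENNReal.ofReal (q ξ) * volume (Metric.ball ξ (r ξ)) := fun ξ hξ => by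
    have hdp : 0 < d ξ := bdryWt_pos hU hne hξ
    have hrp : 0 < r ξ := by simp only [hr]; positivity
    rw [Measure.addHaar_ball_of_pos _ _ hrp, finrank_euclideanSpace, Fintype.card_fin,
      ← ENNReal.ofReal_toReal (measure_ball_lt_top (μ := volume)
        (x := (0 : EuclideanSpace ℝ (Fin n))) (r := 1)).ne, ← hv,
      ← ENNReal.ofReal_mul (by positivity),
      ← ENNReal.ofReal_mul (by have := hw0 ξ; positivity)]
    congr 1
    simp only [hq, hr, mul_pow, div_pow, ← pow_mul]
    field_simp
    ring
  set P : EuclideanSpace ℝ (Fin n) → EuclideanSpace ℝ (Fin n) → ℝ≥0∞ := fun ξ η =>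
    ENNReal.ofReal (q ξ) * (Metric.ball ξ (r ξ)).indicator (fun _ => 1) η with hP
  have hPm : AEMeasurable (Function.uncurry P) ((volume.restrict U).prod volume) := by
    have h1 : AEMeasurable (fun ξ => ENNReal.ofReal (q ξ)) (volume.restrict U) :=
      (hqc.aemeasurable hU.measurableSet).ennreal_ofReal
    have h2 : MeasurableSet {p : EuclideanSpace ℝ (Fin n) × EuclideanSpace ℝ (Fin n) |
        dist p.2 p.1 < r p.1} :=
      (isOpen_lt (continuous_snd.dist continuous_fst) (hrc.comp continuous_fst)).measurableSet
    have h3 : Measurable fun p : EuclideanSpace ℝ (Fin n) × EuclideanSpace ℝ (Fin n) =>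
        (Metric.ball p.1 (r p.1)).indicator (fun _ => (1 : ℝ≥0∞)) p.2 := by
      have : (fun p : EuclideanSpace ℝ (Fin n) × EuclideanSpace ℝ (Fin n) =>
        (Metric.ball p.1 (r p.1)).indicator (fun _ => (1 : ℝ≥0∞)) p.2) =
        Set.indicator {p | dist p.2 p.1 < r p.1} (fun _ => 1) := by
        ext p; simp [Set.indicator]
      rw [this]
      exact measurable_const.indicator h2
    exact h1.comp_fst.mul h3.aemeasurable
  have hinner : ∀ η, ∫⁻ ξ in U, P ξ η ≤ U.indicator (fun _ => ENNReal.ofReal ((2 / c) ^ n / v *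
      2 ^ (K * n) * (2 ^ (n + 1) * (((c / 2 ^ K) ^ n)⁻¹ * bracketInt n)) * (s ^ n)⁻¹)) η := by
    intro η
    -- The centres whose ball contains `η`. There the weight is comparable to `d η`, so `G` is
    -- expanding on all of `S` with rate `c 2⁻ᴷ (d η)ᴷ`.
    set S := {ξ ∈ U | dist η ξ < r ξ} with hSdef
    have hSm : MeasurableSet S := hU.measurableSet.inter
      (isOpen_lt (continuous_const.dist continuous_id) hrc).measurableSet
    have hslow : ∀ ξ ∈ S, d ξ ≤ 2 * d η ∧ d η ≤ 2 * d ξ := fun ξ hξ =>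
      bdryWt_slow (by rw [← dist_eq_norm, dist_comm]; exact hξ.2.le.trans (hr4 ξ))
    have hPS : ∫⁻ ξ in U, P ξ η = ∫⁻ ξ in S, ENNReal.ofReal (q ξ) := by
      have : S = {ξ | dist η ξ < r ξ} ∩ U := by rw [hSdef]; ext; simp [and_comm]
      have hm : MeasurableSet {ξ | dist η ξ < r ξ} :=
        (isOpen_lt (continuous_const.dist continuous_id) hrc).measurableSet
      rw [this, ← Measure.restrict_restrict hm, ← lintegral_indicator hm]
      refine lintegral_congr fun ξ => ?_
      by_cases h : dist η ξ < r ξ <;> simp [hP, h]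
    rw [hPS]
    by_cases hη : η ∈ U
    · rw [Set.indicator_of_mem hη]
      have hdη : 0 < d η := bdryWt_pos hU hne hη
      have hSexp : ∀ ξ ∈ S, ∀ ξ' ∈ S, c / 2 ^ K * d η ^ K * ‖ξ - ξ'‖ ≤ ‖G ξ - G ξ'‖ := by
        have main : ∀ ξ ∈ S, ∀ ξ' ∈ S, d ξ' ≤ d ξ →
            c / 2 ^ K * d η ^ K * ‖ξ' - ξ‖ ≤ ‖G ξ' - G ξ‖ := by
          intro ξ hξ ξ' hξ' hle
          have h1 : ‖ξ' - ξ‖ ≤ c * d ξ ^ K := by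
            have ha := dist_triangle_left ξ' ξ η
            have hb : r ξ' ≤ r ξ :=
              mul_le_mul_of_nonneg_left (pow_le_pow_left₀ (hd0 _) hle K) (by positivity)
            have h3 : r ξ + r ξ = c * d ξ ^ K := by simp only [hr]; ring
            rw [← dist_eq_norm]
            linarith [hξ.2, hξ'.2]
          refine le_trans (mul_le_mul_of_nonneg_right ?_ (norm_nonneg _)) (hexp ξ hξ.1 ξ' h1)
          rw [div_mul_eq_mul_div, mul_div_assoc, ← div_pow]
          refine mul_le_mul_of_nonneg_left (pow_le_pow_left₀ (by positivity) ?_ K) hc.le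
          linarith [(hslow ξ hξ).2]
        intro ξ hξ ξ' hξ'
        rcases le_total (d ξ) (d ξ') with h | h
        · exact main ξ' hξ' ξ hξ h
        · have := main ξ hξ ξ' hξ' h
          rwa [norm_sub_rev ξ' ξ, norm_sub_rev (G ξ')] at this
      have hA := lintegral_le_of_expanding hs (l := c / 2 ^ K * d η ^ K) (by positivity) hSm hSexp
      calc ∫⁻ ξ in S, ENNReal.ofReal (q ξ)
          ≤ ∫⁻ ξ in S, ENNReal.ofReal ((2 / c) ^ n / v * (2 * d η) ^ (K * n)) *
              ENNReal.ofReal (w ξ) := by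
            refine setLIntegral_mono' hSm fun ξ hξ => ?_
            rw [← ENNReal.ofReal_mul (by positivity)]
            refine ENNReal.ofReal_le_ofReal ?_
            simp only [hq]
            rw [← mul_assoc]
            refine mul_le_mul_of_nonneg_right (mul_le_mul_of_nonneg_left ?_ (by positivity)) (hw0 ξ)
            exact pow_le_pow_left₀ (hd0 ξ) (hslow ξ hξ).1 _
        _ = ENNReal.ofReal ((2 / c) ^ n / v * (2 * d η) ^ (K * n)) *
              ∫⁻ ξ in S, ENNReal.ofReal (w ξ) := lintegral_const_mul' _ _ ENNReal.ofReal_ne_top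
        _ ≤ _ := by
            refine (mul_le_mul_right hA _).trans ?_
            rw [← ENNReal.ofReal_mul (by positivity)]
            -- The power `(d η)^{Kn}` left in `q` cancels the `(d η)^{-Kn}` produced by the
            -- expansion rate.
            refine ENNReal.ofReal_le_ofReal (le_of_eq ?_)
            simp only [mul_pow, div_pow, ← pow_mul]
            field_simp
    · rw [Set.indicator_of_notMem hη]
      have hSe : S = ∅ := by
        refine Set.eq_empty_of_forall_notMem fun ξ hξ => ?_
        have h1 := Metric.infDist_le_dist_of_mem (x := ξ) (s := Uᶜ) hη
        have h2 := bdryWt_le_infDist (U := U) ξ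
        have h3 := bdryWt_pos hU hne hξ.1
        have h4 := hr4 ξ
        have h5 := hξ.2
        rw [dist_comm] at h5
        simp only [hd] at h4
        linarith
      simp [hSe]
  calc ∫⁻ ξ in U, ENNReal.ofReal (d ξ ^ (K * n + K * n) * w ξ)
      = ∫⁻ ξ in U, ∫⁻ η, P ξ η := by
        refine setLIntegral_congr_fun hU.measurableSet fun ξ hξ => ?_
        simp only [hP]
        rw [lintegral_const_mul' _ _ ENNReal.ofReal_ne_top,
          lintegral_indicator_const Metric.isOpen_ball.measurableSet, one_mul]
        exact hvol ξ hξ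
    _ = ∫⁻ η, ∫⁻ ξ in U, P ξ η := lintegral_lintegral_swap hPm
    _ ≤ ∫⁻ η, U.indicator (fun _ => _) η := lintegral_mono hinner
    _ = _ := by rw [lintegral_indicator_const hU.measurableSet]

/-! ### Decay of the cut-off at the boundary -/

section Flat

variable {n : ℕ}

/-- Taylor's estimate at a point of flatness. -/
lemma norm_iteratedFDeriv_le_of_flat {χ : EuclideanSpace ℝ (Fin n) → ℂ} (hχ : ContDiff ℝ ∞ χ)
    {ξ ζ : EuclideanSpace ℝ (Fin n)} (hζ : ∀ k, iteratedFDeriv ℝ k χ ζ = 0) {C : ℝ} (N j : ℕ)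
    (hC : ∀ η ∈ segment ℝ ζ ξ, ‖iteratedFDeriv ℝ (j + N) χ η‖ ≤ C) :
    ∀ η ∈ segment ℝ ζ ξ, ‖iteratedFDeriv ℝ j χ η‖ ≤ C * ‖η - ζ‖ ^ N := by
  induction N generalizing j with
  | zero => simpa using hC
  | succ N ih =>
    intro η hη
    have hsub : segment ℝ ζ η ⊆ segment ℝ ζ ξ :=
      (convex_segment ζ ξ).segment_subset (left_mem_segment ℝ ζ ξ) hη
    have h1 := ih (j + 1) (by rw [show j + 1 + N = j + (N + 1) by omega]; exact hC)
    have hle : ∀ z ∈ segment ℝ ζ η, ‖z - ζ‖ ≤ ‖η - ζ‖ := by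
      intro z hz
      simpa [dist_eq_norm] using (convex_closedBall ζ (dist η ζ)).segment_subset
        (Metric.mem_closedBall_self dist_nonneg) (Metric.mem_closedBall.2 le_rfl) hz
    have hC0 : 0 ≤ C := (norm_nonneg _).trans (hC ζ (left_mem_segment ℝ ζ ξ))
    -- The derivative of order `j + 1` is already `O(|η-ζ|^N)` and the one of order `j` vanishes at
    -- `ζ`, so the mean value inequality adds one power.
    have h2 := (convex_segment ζ η).norm_image_sub_le_of_norm_fderiv_le
      (f := iteratedFDeriv ℝ j χ) (𝕜 := ℝ) (C := C * ‖η - ζ‖ ^ N)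
      (fun z _ => (hχ.differentiable_iteratedFDeriv (by exact_mod_cast WithTop.coe_lt_top j)) z)
      (fun z hz => by
        rw [norm_fderiv_iteratedFDeriv]
        exact (h1 z (hsub hz)).trans (mul_le_mul_of_nonneg_left
          (pow_le_pow_left₀ (norm_nonneg _) (hle z hz) N) hC0))
      (left_mem_segment ℝ ζ η) (right_mem_segment ℝ ζ η)
    rw [hζ j, sub_zero] at h2
    rw [pow_succ, ← mul_assoc]
    exact h2

end Flat

/-- A set of volume at most `V` has points at a bounded distance from the complement only. -/
lemma exists_infDist_compl_le {n : ℕ} (hn : 1 ≤ n) (V : ℝ) :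
    ∃ D : ℝ, 1 ≤ D ∧ ∀ U : Set (EuclideanSpace ℝ (Fin n)), volume U ≤ ENNReal.ofReal V →
      ∀ ξ, Metric.infDist ξ Uᶜ ≤ D := by
  set v := (volume (Metric.ball (0 : EuclideanSpace ℝ (Fin n)) 1)).toReal with hv
  have hv0 : 0 < v := ENNReal.toReal_pos (Metric.measure_ball_pos _ _ one_pos).ne'
    measure_ball_lt_top.ne
  refine ⟨max 1 (|V| / v), le_max_left _ _, fun U hU ξ => ?_⟩
  set d := Metric.infDist ξ Uᶜ with hd
  by_contra! hlt
  have hd1 : 1 < d := (le_max_left _ _).trans_lt hlt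
  -- A ball of radius `d` in `U` forces `dⁿ v ≤ |V|`, and `d ≤ dⁿ` because `d > 1` and `n ≥ 1`.
  have hsub : Metric.ball ξ d ⊆ U := by
    intro η hη
    by_contra hηU
    have := Metric.infDist_le_dist_of_mem (x := ξ) (s := Uᶜ) hηU
    rw [Metric.mem_ball, dist_comm] at hη
    exact absurd hη (not_lt.2 this)
  have h1 := (measure_mono hsub).trans hU
  rw [Measure.addHaar_ball_of_pos _ _ (by linarith), finrank_euclideanSpace, Fintype.card_fin,
      ← ENNReal.ofReal_toReal (measure_ball_lt_top (μ := volume)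
        (x := (0 : EuclideanSpace ℝ (Fin n))) (r := 1)).ne, ← hv,
      ← ENNReal.ofReal_mul (by positivity)] at h1
  have h2 : d ^ n * v ≤ |V| := by
    have := h1.trans (ENNReal.ofReal_le_ofReal (le_abs_self V))
    rwa [ENNReal.ofReal_le_ofReal_iff (abs_nonneg V)] at this
  have h3 : d ≤ d ^ n := le_self_pow₀ hd1.le (by omega)
  have h4 : |V| / v < d := (le_max_right _ _).trans_lt hlt
  rw [div_lt_iff₀ hv0] at h4
  nlinarith

/-- A symbol supported in a set of bounded volume decays faster than every power of the
boundary weight. -/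
lemma exists_norm_iteratedFDeriv_le_bdryWt {n : ℕ} (hn : 1 ≤ n) (V : ℝ) (B : ℕ → ℝ) (j N : ℕ) :
    ∃ C : ℝ, ∀ (U : Set (EuclideanSpace ℝ (Fin n))) (χ : EuclideanSpace ℝ (Fin n) → ℂ),
      IsOpen U → Uᶜ.Nonempty → volume U ≤ ENNReal.ofReal V → SymbolBoundOn Set.univ 0 B χ →
      (∀ ξ ∉ U, ∀ k : ℕ, iteratedFDeriv ℝ k χ ξ = 0) →
      ∀ ξ ∈ U, ‖iteratedFDeriv ℝ j χ ξ‖ ≤ C * bdryWt U ξ ^ N := by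
  obtain ⟨D, hD1, hD⟩ := exists_infDist_compl_le hn V
  refine ⟨|B (j + N)| * (1 + D) ^ (j + N) * D ^ N, fun U χ hU hne hV hχ hflat ξ hξ => ?_⟩
  -- The expansion is around the nearest point `ζ` outside `U`. The segment stays within `D` of `ξ`,
  -- so `1+|η| ≥ (1+|ξ|)/(1+D)` on it. The derivative of order `j+N` then supplies
  -- `(1+|ξ|)^{-(j+N)}`, and `N` of these powers combine with `dist^N` into the weight.
  obtain ⟨ζ, hζ, hζd⟩ := hU.isClosed_compl.exists_infDist_eq_dist hne ξ
  have hcd : ContDiff ℝ ∞ χ := contDiffOn_univ.1 hχ.1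
  set R := 1 + ‖ξ‖ with hR
  have hR0 : 0 < R := by positivity
  have hR1 : 1 ≤ R := by simp [hR]
  have hseg : ∀ η ∈ segment ℝ ζ ξ,
      ‖iteratedFDeriv ℝ (j + N) χ η‖ ≤ |B (j + N)| * ((1 + D) / R) ^ (j + N) := by
    intro η hη
    have h1 := hχ.2 (j + N) η trivial
    have h2 : dist η ξ ≤ D := by
      have : η ∈ Metric.closedBall ξ D := (convex_closedBall ξ D).segment_subset
        (by rw [Metric.mem_closedBall, dist_comm, ← hζd]; exact hD U hV ξ)
        (Metric.mem_closedBall_self (by linarith)) hη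
      exact this
    have h3 : ‖ξ‖ ≤ ‖η‖ + D := by
      have := norm_add_le η (ξ - η)
      rw [dist_eq_norm, norm_sub_rev] at h2
      rw [add_sub_cancel] at this
      linarith
    have h4 : R ≤ (1 + D) * (1 + ‖η‖) := by
      rw [hR]; nlinarith [norm_nonneg η]
    rw [zero_sub, Real.rpow_neg (by positivity), Real.rpow_natCast, ← inv_pow] at h1
    refine h1.trans ((mul_le_mul_of_nonneg_right (le_abs_self _) (by positivity)).trans
      (mul_le_mul_of_nonneg_left (pow_le_pow_left₀ (by positivity) ?_ _) (abs_nonneg _)))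
    rw [inv_eq_one_div, div_le_div_iff₀ (by positivity) hR0]
    linarith
  have h1 := norm_iteratedFDeriv_le_of_flat hcd (hflat ζ hζ) N j hseg ξ (right_mem_segment ℝ ζ ξ)
  set d := Metric.infDist ξ Uᶜ with hd
  have hd0 : 0 ≤ d := Metric.infDist_nonneg
  rw [← dist_eq_norm, ← hζd] at h1
  have h2 : d ≤ D * min d 1 := by
    rcases le_total d 1 with h | h
    · rw [min_eq_left h]; nlinarith
    · rw [min_eq_right h, mul_one]; exact hD U hV ξ
  refine h1.trans ?_
  rw [mul_assoc, mul_assoc, mul_assoc]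
  refine mul_le_mul_of_nonneg_left ?_ (abs_nonneg _)
  rw [bdryWt, ← hd, ← hR, div_pow, div_pow, div_mul_eq_mul_div, mul_div_assoc]
  refine mul_le_mul_of_nonneg_left ?_ (by positivity)
  rw [← mul_div_assoc, ← mul_pow]
  exact div_le_div₀ (by positivity) (pow_le_pow_left₀ hd0 h2 N) (by positivity)
    (pow_le_pow_right₀ hR1 (by omega))

/-! ### Non-degenerate Hessians and local expansion -/

/-- A quantitative lower bound for an invertible matrix. -/
lemma norm_det_mul_norm_le {n : ℕ} (H : Matrix (Fin n) (Fin n) ℂ) {b : ℝ} (hb : 1 ≤ b)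
    (hH : ∀ i j, ‖H i j‖ ≤ b) (u : EuclideanSpace ℝ (Fin n)) :
    ‖H.det‖ * ‖u‖ ≤ n * (n * (n.factorial * b ^ n)) *
      ‖Matrix.vecMul (fun i => (u i : ℂ)) H‖ := by
  set y := Matrix.vecMul (fun i => (u i : ℂ)) H with hy
  -- A cofactor is the determinant of `H` with one row replaced by a basis vector; the entries are
  -- still at most `b` because `b ≥ 1`.
  have hadj : ∀ j i, ‖H.adjugate j i‖ ≤ n.factorial * b ^ n := by
    intro j i
    rw [Matrix.adjugate_apply]
    have := Matrix.det_le (A := H.updateRow i (Pi.single j 1))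
      (abv := (⟨⟨norm, norm_mul⟩, norm_nonneg, by simp, norm_add_le⟩ : AbsoluteValue ℂ ℝ))
      (x := b) (fun k l => by
        change ‖(H.updateRow i (Pi.single j 1) k l : ℂ)‖ ≤ b
        rw [Matrix.updateRow_apply]
        split_ifs
        · by_cases h : l = j
          · subst h; simpa using hb
          · simp [h]; linarith
        · exact hH k l)
    simpa using this
  have hyi : ∀ i, ‖H.det‖ * |u i| ≤ n * (n.factorial * b ^ n) * ‖y‖ := by
    intro i
    have h1 : Matrix.vecMul y H.adjugate = H.det • fun i => (u i : ℂ) := by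
      rw [hy, Matrix.vecMul_vecMul, Matrix.mul_adjugate, Matrix.vecMul_smul, Matrix.vecMul_one]
    have h2 : H.det * (u i : ℂ) = ∑ j, y j * H.adjugate j i := by
      have := congrFun h1 i
      simpa [Matrix.vecMul, dotProduct] using this.symm
    have h3 : ‖H.det‖ * |u i| = ‖∑ j, y j * H.adjugate j i‖ := by
      rw [← h2, norm_mul, Complex.norm_real, Real.norm_eq_abs]
    rw [h3]
    refine (norm_sum_le _ _).trans ?_
    have h4 : ∀ j ∈ Finset.univ, ‖y j * H.adjugate j i‖ ≤ ‖y‖ * (n.factorial * b ^ n) := by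
      intro j _
      rw [norm_mul]
      exact mul_le_mul (norm_le_pi_norm y j) (hadj j i) (norm_nonneg _) (norm_nonneg _)
    refine (Finset.sum_le_card_nsmul _ _ _ h4).trans (le_of_eq ?_)
    simp; ring
  have hu : ‖u‖ ≤ ∑ i, |u i| := by
    rw [EuclideanSpace.norm_eq]
    refine Real.sqrt_le_iff.2 ⟨by positivity, ?_⟩
    simp only [Real.norm_eq_abs]
    exact Finset.sum_sq_le_sq_sum_of_nonneg fun i _ => abs_nonneg _
  calc ‖H.det‖ * ‖u‖ ≤ ‖H.det‖ * ∑ i, |u i| := mul_le_mul_of_nonneg_left hu (norm_nonneg _)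
    _ = ∑ i, ‖H.det‖ * |u i| := Finset.mul_sum _ _ _
    _ ≤ ∑ _i : Fin n, n * (n.factorial * b ^ n) * ‖y‖ := Finset.sum_le_sum fun i _ => hyi i
    _ = _ := by simp; ring

namespace SymbolFrame

variable {ι : Type*} {n : ℕ} {F : SymbolFrame ι n} {f : ι → EuclideanSpace ℝ (Fin n) → ℂ}

variable (F f) in
/-- Every derivative is bounded, uniformly over the family, by a power of `δ⁻¹`. -/
def PolyBd : Prop :=
  (∀ σ, ContDiffOn ℝ ∞ (f σ) (F.U σ)) ∧ ∀ k : ℕ, ∃ (C : ℝ) (K : ℕ), 0 ≤ C ∧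
    ∀ σ, ∀ ξ ∈ F.U σ, ‖iteratedFDeriv ℝ k (f σ) ξ‖ ≤ C * (F.δ σ ξ)⁻¹ ^ K

lemma PolyBd.pd (hf : F.PolyBd f) (i : Fin n) : F.PolyBd fun σ => pd i (f σ) := by
  refine ⟨fun σ => contDiffOn_pd (F.isOpen_U σ) (hf.1 σ) i, fun k => ?_⟩
  obtain ⟨C, K, hC, h⟩ := hf.2 (k + 1)
  exact ⟨C, K, hC, fun σ ξ hξ =>
    (norm_iteratedFDeriv_pd_le (F.isOpen_U σ) (hf.1 σ) i k hξ).trans (h σ ξ hξ)⟩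

lemma PolyBd.pSym (hf : F.PolyBd f) (j : ℕ) : F.PSym j (fun _ _ => 1) f := by
  choose C K hC h using hf.2
  refine ⟨∑ k ∈ Finset.range (j + 1), K k, Sym.of_iteratedFDeriv (fun σ ξ hξ => ?_) hf.1
    fun k hk => ⟨C k, fun σ ξ hξ => (h k σ ξ hξ).trans (mul_le_mul_of_nonneg_left ?_ (hC k))⟩⟩
  · have := F.δ_pos σ ξ hξ
    positivity
  · rw [mul_one]
    refine pow_le_pow_right₀ (one_le_inv_δ hξ) ?_
    exact Finset.single_le_sum (f := K) (fun _ _ => Nat.zero_le _)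
      (Finset.mem_range.2 (Nat.lt_succ_of_le hk))

/-- The denominator of the boundary weight is there for this: growth in `|ξ|` becomes a loss in `δ`,
of the same kind as nearness to the boundary. -/
lemma one_add_norm_le_inv_δ (hδ : ∀ σ, F.δ σ = bdryWt (F.U σ)) {σ : ι}
    {ξ : EuclideanSpace ℝ (Fin n)} (hξ : ξ ∈ F.U σ) : 1 + ‖ξ‖ ≤ (F.δ σ ξ)⁻¹ := by
  rw [← one_div, le_div_iff₀ (F.δ_pos σ ξ hξ), hδ]
  exact one_add_norm_mul_bdryWt_le ξ

/-- Polynomial bounds in `1 + |ξ|` are polynomial bounds in the boundary weight. -/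
lemma PolyBd.of_one_add_norm (hδ : ∀ σ, F.δ σ = bdryWt (F.U σ)) {A e : ℕ → ℝ}
    (hs : ∀ σ, ContDiffOn ℝ ∞ (f σ) (F.U σ))
    (hf : ∀ k σ, ∀ ξ ∈ F.U σ, ‖iteratedFDeriv ℝ k (f σ) ξ‖ ≤ A k * (1 + ‖ξ‖) ^ e k) :
    F.PolyBd f := by
  refine ⟨hs, fun k => ⟨|A k|, ⌈|e k|⌉₊, abs_nonneg _, fun σ ξ hξ => (hf k σ ξ hξ).trans ?_⟩⟩
  have h1 : 1 ≤ 1 + ‖ξ‖ := by simp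
  have h2 := one_add_norm_le_inv_δ hδ hξ
  have h3 : (1 + ‖ξ‖) ^ e k ≤ (1 + ‖ξ‖) ^ (⌈|e k|⌉₊ : ℝ) :=
    Real.rpow_le_rpow_of_exponent_le h1 ((le_abs_self _).trans (Nat.le_ceil _))
  rw [Real.rpow_natCast] at h3
  exact mul_le_mul (le_abs_self _) (h3.trans (pow_le_pow_left₀ (by positivity) h2 _))
    (by positivity) (abs_nonneg _)

/-- The gradient of a function with non-degenerate Hessian is locally expanding. -/
lemma PolyBd.exists_expanding {τ : ι → EuclideanSpace ℝ (Fin n) → ℂ} (hτ : F.PolyBd τ)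
    (hn : 1 ≤ n) (hδ : ∀ σ, F.δ σ = bdryWt (F.U σ)) {C₀ : ℝ} (hC₀ : 0 < C₀) {K₀ : ℕ}
    (hdet : ∀ σ, ∀ ξ ∈ F.U σ, C₀ * F.δ σ ξ ^ K₀ ≤ ‖(hess (τ σ) ξ).det‖) :
    ∃ (c : ℝ) (K : ℕ), 0 < c ∧ c ≤ 1 / 4 ∧ 1 ≤ K ∧ ∀ σ, ∀ ξ ∈ F.U σ, ∀ ξ',
      ‖ξ' - ξ‖ ≤ c * F.δ σ ξ ^ K → c * F.δ σ ξ ^ K * ‖ξ' - ξ‖ ≤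
        ‖(fun i => FourierDecay.pd i (τ σ) ξ') - fun i => FourierDecay.pd i (τ σ) ξ‖ := by
  have hG : ∀ i, F.PolyBd fun σ => FourierDecay.pd i (τ σ) := fun i => hτ.pd i
  choose C₁ K₁ hC₁ h₁ using fun i j => ((hG j).pd i).2 0
  choose C₂ K₂ hC₂ h₂ using fun i => (hG i).2 2
  set b₁ := 1 + ∑ i, ∑ j, C₁ i j with hb₁
  set k₁ := ∑ i, ∑ j, K₁ i j with hk₁
  set b₂ := ∑ i, C₂ i with hb₂
  set k₂ := ∑ i, K₂ i with hk₂
  have hb₁1 : 1 ≤ b₁ := le_add_of_nonneg_right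
    (Finset.sum_nonneg fun i _ => Finset.sum_nonneg fun j _ => hC₁ i j)
  have hb₂0 : 0 ≤ b₂ := Finset.sum_nonneg fun i _ => hC₂ i
  have e₁ : ∀ i j σ, ∀ ξ ∈ F.U σ, ‖hess (τ σ) ξ i j‖ ≤ b₁ * (F.δ σ ξ)⁻¹ ^ k₁ := by
    intro i j σ ξ hξ
    have h := h₁ i j σ ξ hξ
    rw [norm_iteratedFDeriv_zero] at h
    refine h.trans ?_
    have hd := F.δ_pos σ ξ hξ
    refine mul_le_mul ?_ (pow_le_pow_right₀ (one_le_inv_δ hξ) ?_) (by positivity) (by linarith)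
    · have ha := Finset.single_le_sum (f := fun j => C₁ i j) (fun j _ => hC₁ i j)
        (Finset.mem_univ j)
      have hb := Finset.single_le_sum (f := fun i => ∑ j, C₁ i j)
        (fun i _ => Finset.sum_nonneg fun j _ => hC₁ i j) (Finset.mem_univ i)
      linarith
    · exact (Finset.single_le_sum (f := fun j => K₁ i j) (fun _ _ => Nat.zero_le _)
        (Finset.mem_univ j)).trans (Finset.single_le_sum (f := fun i => ∑ j, K₁ i j)
        (fun _ _ => Nat.zero_le _) (Finset.mem_univ i))
  have e₂ : ∀ i σ, ∀ ξ ∈ F.U σ,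
      ‖fderiv ℝ (fderiv ℝ (FourierDecay.pd i (τ σ))) ξ‖ ≤ b₂ * (F.δ σ ξ)⁻¹ ^ k₂ := by
    intro i σ ξ hξ
    have h := h₂ i σ ξ hξ
    rw [← norm_iteratedFDeriv_fderiv, norm_iteratedFDeriv_one] at h
    refine h.trans ?_
    have hd := F.δ_pos σ ξ hξ
    exact mul_le_mul (Finset.single_le_sum (f := C₂) (fun i _ => hC₂ i) (Finset.mem_univ i))
      (pow_le_pow_right₀ (one_le_inv_δ hξ) (Finset.single_le_sum (f := K₂)
        (fun _ _ => Nat.zero_le _) (Finset.mem_univ i))) (by positivity) hb₂0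
  set Q : ℝ := n * (n * (n.factorial * b₁ ^ n)) with hQ
  have hn0 : (0 : ℝ) < n := by exact_mod_cast hn
  have hQ0 : 0 < Q := by
    have : (0 : ℝ) < n.factorial := by exact_mod_cast n.factorial_pos
    positivity
  set c₁ := C₀ / Q with hc₁
  have hc₁0 : 0 < c₁ := div_pos hC₀ hQ0
  set k₃ := K₀ + k₁ * n with hk₃
  set b₃ := b₂ * 2 ^ k₂ with hb₃
  have hb₃0 : 0 ≤ b₃ := by positivity
  -- The bound `1/4` keeps the ball around `ξ` inside `U`, where `δ` is comparable to its value `d`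
  -- at `ξ`. The other two make the Taylor remainder `b₃ d^{-k₂}|u|²` at most half of the Hessian
  -- term `c₁ d^{k₃}|u|`, and the claimed rate at most the half that remains.
  refine ⟨min (1 / 4) (min (c₁ / 2) (c₁ / (2 * (b₃ + 1)))), k₂ + k₃ + 1, by positivity,
    min_le_left _ _, by omega, fun σ ξ hξ ξ' hξ' => ?_⟩
  set c := min (1 / 4) (min (c₁ / 2) (c₁ / (2 * (b₃ + 1)))) with hc
  have hc0 : 0 < c := by positivity
  have hc4 : c ≤ 1 / 4 := min_le_left _ _
  have hc2 : c ≤ c₁ / 2 := (min_le_right _ _).trans (min_le_left _ _)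
  have hc3 : c * b₃ ≤ c₁ / 2 := by
    have h : c ≤ c₁ / (2 * (b₃ + 1)) := (min_le_right _ _).trans (min_le_right _ _)
    rw [le_div_iff₀ (by positivity)] at h
    nlinarith
  set d := F.δ σ ξ with hd
  have hd0 : 0 < d := F.δ_pos σ ξ hξ
  have hd1 : d ≤ 1 := F.δ_le_one σ ξ hξ
  set u := ξ' - ξ with hu
  have hud : ‖u‖ ≤ d / 4 := by
    refine hξ'.trans ?_
    have h1 : d ^ (k₂ + k₃ + 1) ≤ d := pow_le_of_le_one hd0.le hd1 (by omega)
    nlinarith [mul_le_mul hc4 h1 (by positivity) (by norm_num)]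
  have hball : ∀ z ∈ Metric.closedBall ξ ‖u‖, z ∈ F.U σ ∧ (F.δ σ z)⁻¹ ≤ 2 * d⁻¹ := by
    intro z hz
    have hzd : ‖ξ - z‖ ≤ bdryWt (F.U σ) ξ / 4 := by
      rw [← hδ, ← hd, ← dist_eq_norm, dist_comm]
      exact (Metric.mem_closedBall.1 hz).trans hud
    have hzU : z ∈ F.U σ := by
      by_contra hzU
      have h1 := Metric.infDist_le_dist_of_mem (x := ξ) (s := (F.U σ)ᶜ) hzU
      have h2 := bdryWt_le_infDist (U := F.U σ) ξ
      rw [hδ] at hd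
      rw [dist_eq_norm] at h1
      linarith
    refine ⟨hzU, ?_⟩
    have h1 := (bdryWt_slow hzd).1
    rw [← hδ, ← hd] at h1
    have h2 := F.δ_pos σ z hzU
    rw [← div_eq_mul_inv, le_div_iff₀ hd0, inv_mul_le_iff₀ h2]
    linarith
  have hconv := convex_closedBall ξ ‖u‖
  have hmem : ξ ∈ Metric.closedBall ξ ‖u‖ := Metric.mem_closedBall_self (norm_nonneg _)
  have hmem' : ξ' ∈ Metric.closedBall ξ ‖u‖ := by rw [Metric.mem_closedBall, dist_eq_norm]
  have hTay : ∀ i, ‖FourierDecay.pd i (τ σ) ξ' - FourierDecay.pd i (τ σ) ξ -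
      fderiv ℝ (FourierDecay.pd i (τ σ)) ξ u‖ ≤ b₃ * d⁻¹ ^ k₂ * ‖u‖ * ‖u‖ := by
    intro i
    have hsm := (hG i).1 σ
    have hU := F.isOpen_U σ
    have hsm' : ContDiffOn ℝ ∞ (fderiv ℝ (FourierDecay.pd i (τ σ))) (F.U σ) :=
      hsm.fderiv_of_isOpen hU (by simp)
    refine Convex.norm_image_sub_le_of_norm_fderiv_le' (𝕜 := ℝ) (s := Metric.closedBall ξ ‖u‖)
      (fun z hz => (hsm.differentiableOn (by simp)).differentiableAt
        (hU.mem_nhds (hball z hz).1)) (fun z hz => ?_) hconv hmem hmem'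
    have := Convex.norm_image_sub_le_of_norm_fderiv_le (𝕜 := ℝ) (s := Metric.closedBall ξ ‖u‖)
      (f := fderiv ℝ (FourierDecay.pd i (τ σ))) (C := b₃ * d⁻¹ ^ k₂)
      (fun z hz => (hsm'.differentiableOn (by simp)).differentiableAt
        (hU.mem_nhds (hball z hz).1)) (fun z hz => ?_) hconv hmem hz
    · refine this.trans (mul_le_mul_of_nonneg_left ?_ (by positivity))
      rw [← dist_eq_norm]
      exact hz
    · refine (e₂ i σ z (hball z hz).1).trans ?_
      rw [hb₃, mul_assoc, ← mul_pow]
      refine mul_le_mul_of_nonneg_left (pow_le_pow_left₀ ?_ (hball z hz).2 _) hb₂0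
      exact inv_nonneg.2 (F.δ_pos σ z (hball z hz).1).le
  set y := Matrix.vecMul (fun i => (u i : ℂ)) (hess (τ σ) ξ) with hy
  have hyj : ∀ j, y j = fderiv ℝ (FourierDecay.pd j (τ σ)) ξ u := by
    intro j
    have hsum : u = ∑ i, u i • (EuclideanSpace.single i (1 : ℝ) : EuclideanSpace ℝ (Fin n)) := by
      ext k
      simp [Finset.sum_apply, Pi.single_apply]
    conv_rhs => rw [hsum]
    simp only [map_sum, map_smul, hy, Matrix.vecMul, dotProduct, hess, Matrix.of_apply,
      Complex.real_smul]
    rfl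
  -- The Hessian entries are at most `b₁ d^{-k₁}`, so the cofactor bound costs `d^{k₁ n}` on top of
  -- the `d^{K₀}` of the determinant.
  have hlow : c₁ * d ^ k₃ * ‖u‖ ≤ ‖y‖ := by
    have hbd : 1 ≤ b₁ * d⁻¹ ^ k₁ := one_le_mul_of_one_le_of_one_le hb₁1
      (one_le_pow₀ (one_le_inv_δ hξ))
    have h1 := norm_det_mul_norm_le (hess (τ σ) ξ) hbd (fun i j => e₁ i j σ ξ hξ) u
    have h2 := mul_le_mul_of_nonneg_right (hdet σ ξ hξ) (norm_nonneg u)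
    have h3 := h2.trans h1
    have h4 : (n : ℝ) * (n * (n.factorial * (b₁ * d⁻¹ ^ k₁) ^ n)) = Q * (d ^ (k₁ * n))⁻¹ := by
      rw [hQ, mul_pow, ← pow_mul, inv_pow]; ring
    rw [h4, ← hd, ← hy] at h3
    have h5 : 0 < d ^ (k₁ * n) := by positivity
    rw [hc₁, hk₃, pow_add, div_mul_eq_mul_div, div_mul_eq_mul_div, div_le_iff₀ hQ0]
    have h6 := mul_le_mul_of_nonneg_right h3 h5.le
    have h7 : Q * (d ^ (k₁ * n))⁻¹ * ‖y‖ * d ^ (k₁ * n) = ‖y‖ * Q := by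
      field_simp
    rw [h7] at h6
    linarith
  set Δ := (fun i => FourierDecay.pd i (τ σ) ξ') - fun i => FourierDecay.pd i (τ σ) ξ with hΔ
  have hdiff : ‖Δ - y‖ ≤ b₃ * d⁻¹ ^ k₂ * ‖u‖ * ‖u‖ := by
    refine (pi_norm_le_iff_of_nonneg (by positivity)).2 fun i => ?_
    simp only [hΔ, Pi.sub_apply, hyj]
    exact hTay i
  have hsmall : b₃ * d⁻¹ ^ k₂ * ‖u‖ * ‖u‖ ≤ c₁ / 2 * d ^ k₃ * ‖u‖ := by
    refine mul_le_mul_of_nonneg_right ?_ (norm_nonneg _)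
    have h1 : b₃ * d⁻¹ ^ k₂ * ‖u‖ ≤ b₃ * d⁻¹ ^ k₂ * (c * d ^ (k₂ + k₃ + 1)) :=
      mul_le_mul_of_nonneg_left hξ' (by positivity)
    have h2 : b₃ * d⁻¹ ^ k₂ * (c * d ^ (k₂ + k₃ + 1)) = c * b₃ * (d ^ k₃ * d) := by
      rw [pow_succ, pow_add, inv_pow]; field_simp
    have h3 : d ^ k₃ * d ≤ d ^ k₃ := mul_le_of_le_one_right (by positivity) hd1
    calc _ ≤ c * b₃ * (d ^ k₃ * d) := h1.trans_eq h2
      _ ≤ c₁ / 2 * d ^ k₃ := mul_le_mul hc3 h3 (by positivity) (by positivity)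
  have hfin : c * d ^ (k₂ + k₃ + 1) ≤ c₁ / 2 * d ^ k₃ :=
    mul_le_mul hc2 (pow_le_pow_of_le_one hd0.le hd1 (by omega)) (by positivity) (by positivity)
  have htri : ‖y‖ ≤ ‖Δ‖ + ‖Δ - y‖ := by
    have := norm_sub_le Δ (Δ - y)
    rwa [sub_sub_cancel] at this
  have := mul_le_mul_of_nonneg_right hfin (norm_nonneg u)
  nlinarith

end SymbolFrame

/-! ### Coordinates and powers of `1 + |ξ|²` as symbols -/

lemma pd_coord {n : ℕ} (i k : Fin n) (ξ : EuclideanSpace ℝ (Fin n)) :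
    pd i (fun η => ((η k : ℝ) : ℂ)) ξ = if k = i then 1 else 0 := by
  have h : HasFDerivAt (fun η : EuclideanSpace ℝ (Fin n) => ((η k : ℝ) : ℂ))
      (Complex.ofRealCLM.comp (EuclideanSpace.proj k)) ξ :=
    (Complex.ofRealCLM.comp (EuclideanSpace.proj k)).hasFDerivAt
  simp only [pd, h.fderiv]
  split_ifs with hk <;> simp [hk]

lemma hasFDerivAt_bracket {n : ℕ} (α : ℝ) (ξ : EuclideanSpace ℝ (Fin n)) :
    HasFDerivAt (fun η : EuclideanSpace ℝ (Fin n) => (((1 + ‖η‖ ^ 2) ^ α : ℝ) : ℂ))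
      (Complex.ofRealCLM.comp ((α * (1 + ‖ξ‖ ^ 2) ^ (α - 1)) • (2 • innerSL ℝ ξ))) ξ := by
  have h1 : HasFDerivAt (fun η : EuclideanSpace ℝ (Fin n) => 1 + ‖η‖ ^ 2) (2 • innerSL ℝ ξ) ξ :=
    (hasStrictFDerivAt_norm_sq ξ).hasFDerivAt.const_add 1
  have h2 := h1.rpow_const (p := α) (Or.inl (by positivity))
  exact Complex.ofRealCLM.hasFDerivAt.comp ξ h2

lemma pd_bracket {n : ℕ} (α : ℝ) (i : Fin n) (ξ : EuclideanSpace ℝ (Fin n)) :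
    pd i (fun η => (((1 + ‖η‖ ^ 2) ^ α : ℝ) : ℂ)) ξ =
      ((2 * α : ℝ) : ℂ) * (ξ i : ℂ) * (((1 + ‖ξ‖ ^ 2) ^ (α - 1) : ℝ) : ℂ) := by
  rw [pd, (hasFDerivAt_bracket α ξ).fderiv]
  simp [EuclideanSpace.inner_single_right]
  ring

namespace SymbolFrame

variable {ι : Type*} {n : ℕ} {F : SymbolFrame ι n}

lemma pSym_coord (hδ : ∀ σ, F.δ σ = bdryWt (F.U σ)) (k : Fin n) (j : ℕ) :
    F.PSym j (fun _ _ => 1) (fun _ ξ => ((ξ k : ℝ) : ℂ)) := by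
  have hu : F.UBd (fun σ ξ => (F.δ σ ξ)⁻¹ ^ 1 * 1) (fun _ ξ => ((ξ k : ℝ) : ℂ)) := by
    refine ⟨1, zero_le_one, fun σ ξ hξ => ?_⟩
    have h1 : ‖ξ k‖ ≤ ‖ξ‖ := PiLp.norm_apply_le ξ k
    have h2 := one_add_norm_le_inv_δ hδ hξ
    simp only [Complex.norm_real, pow_one, mul_one, one_mul]
    linarith
  refine ⟨1, ?_⟩
  cases j with
  | zero => exact hu
  | succ j =>
    refine ⟨hu, fun σ => ?_, fun i => ?_⟩
    · exact (Complex.ofRealCLM.comp (EuclideanSpace.proj k)).differentiable.differentiableOn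
    · refine Sym.congr (f := fun _ _ => if k = i then 1 else 0)
        ((Sym.const (C := 1) fun σ => by split_ifs <;> simp).mono (C := 1) (fun σ ξ hξ => ?_)
          zero_le_one) fun σ ξ hξ => (pd_coord i k ξ).symm
      have := one_le_mul_of_one_le_of_one_le (F.one_le_s σ) (one_le_inv_δ hξ)
      simpa using this

/-- A derivative lowers the exponent by one and brings out `2α ξ_i`, so the induction runs over all
bounded families of exponents. The exponent varies with the index because the Sobolev order depends
on `p`. -/
lemma pSym_bracket (hδ : ∀ σ, F.δ σ = bdryWt (F.U σ)) {α : ι → ℝ} {α₀ : ℝ}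
    (hα : ∀ σ, |α σ| ≤ α₀) (j : ℕ) :
    F.PSym j (fun _ _ => 1) (fun σ ξ => (((1 + ‖ξ‖ ^ 2) ^ α σ : ℝ) : ℂ)) := by
  have hu : ∀ {α : ι → ℝ} {α₀ : ℝ}, (∀ σ, |α σ| ≤ α₀) →
      F.PSym 0 (fun _ _ => 1) (fun σ ξ => (((1 + ‖ξ‖ ^ 2) ^ α σ : ℝ) : ℂ)) := by
    intro α α₀ hα
    refine ⟨2 * ⌈α₀⌉₊, 1, zero_le_one, fun σ ξ hξ => ?_⟩
    have h2 := one_add_norm_le_inv_δ hδ hξ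
    have h3 : (1 + ‖ξ‖ ^ 2) ^ α σ ≤ (1 + ‖ξ‖ ^ 2) ^ (⌈α₀⌉₊ : ℝ) :=
      Real.rpow_le_rpow_of_exponent_le (by simp)
        ((le_abs_self _).trans ((hα σ).trans (Nat.le_ceil _)))
    rw [Real.rpow_natCast] at h3
    rw [Complex.norm_real, Real.norm_of_nonneg (by positivity), one_mul]
    simp only [mul_one, pow_mul]
    refine h3.trans (pow_le_pow_left₀ (by positivity) ?_ _)
    nlinarith [norm_nonneg ξ]
  induction j generalizing α α₀ with
  | zero => exact hu hα
  | succ j ih =>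
    refine PSym.of_pd (hu hα) (fun _ _ _ => zero_le_one)
      (fun σ ξ _ => (hasFDerivAt_bracket (α σ) ξ).differentiableAt.differentiableWithinAt)
      fun i => ?_
    have h1 : F.PSym j (fun _ _ => 1) (fun σ _ => ((2 * α σ : ℝ) : ℂ)) :=
      PSym.of_sym (Sym.const (C := 2 * α₀) fun σ => by
        rw [Complex.norm_real, norm_mul, Real.norm_two, Real.norm_eq_abs]
        linarith [hα σ])
    have h2 := ih (α := fun σ => α σ - 1) (α₀ := α₀ + 1) fun σ => by
      have := abs_sub (α σ) 1
      rw [abs_one] at this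
      linarith [hα σ]
    refine (((h1.mul (pSym_coord hδ i j)).mul h2).congr fun σ ξ _ =>
      (pd_bracket (α σ) i ξ).symm).mono (C := 1) (fun σ ξ _ => ?_) zero_le_one
    simpa using F.one_le_s σ

end SymbolFrame

/-! ### The dispersive bound for the kernel -/

/-- The data of an oscillatory integral together with their uniform bounds. -/
structure PhaseDatum (n : ℕ) (μ M C₀ V N₀ : ℝ) (A B T m : ℕ → ℝ) where
  U : Set (EuclideanSpace ℝ (Fin n))
  τ : EuclideanSpace ℝ (Fin n) → ℂ
  a : EuclideanSpace ℝ (Fin n) → ℂ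
  χ : EuclideanSpace ℝ (Fin n) → ℂ
  x : EuclideanSpace ℝ (Fin n)
  t : ℝ
  N : ℝ
  isOpen_U : IsOpen U
  compl_nonempty : Uᶜ.Nonempty
  volume_le : volume U ≤ ENNReal.ofReal V
  smooth_τ : ContDiffOn ℝ ∞ τ U
  im_nonneg : ∀ ξ ∈ U, 0 ≤ (τ ξ).im
  bound_τ : ∀ k : ℕ, ∀ ξ ∈ U, ‖iteratedFDeriv ℝ k τ ξ‖ ≤ T k * (1 + ‖ξ‖) ^ m k
  det_ge : ∀ ξ ∈ U, C₀ * (1 + ‖ξ‖) ^ (-M) ≤ ‖(hess τ ξ).det‖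
  symbol_a : SymbolBoundOn U (-μ) A a
  symbol_χ : SymbolBoundOn Set.univ 0 B χ
  flat_χ : ∀ ξ ∉ U, ∀ k : ℕ, iteratedFDeriv ℝ k χ ξ = 0
  one_le_t : 1 ≤ t
  abs_N_le : |N| ≤ N₀

namespace PhaseDatum

variable {n : ℕ} {μ M C₀ V N₀ : ℝ} {A B T m : ℕ → ℝ}

/-- The symbol frame of the data: the scale is `√t`. -/
def frame (n : ℕ) (μ M C₀ V N₀ : ℝ) (A B T m : ℕ → ℝ) :
    SymbolFrame (PhaseDatum n μ M C₀ V N₀ A B T m) n where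
  U σ := σ.U
  s σ := √σ.t
  δ σ := bdryWt σ.U
  isOpen_U σ := σ.isOpen_U
  one_le_s σ := Real.one_le_sqrt.2 σ.one_le_t
  δ_pos σ _ hξ := bdryWt_pos σ.isOpen_U σ.compl_nonempty hξ
  δ_le_one _ ξ _ := bdryWt_le_one ξ

/-- The phase `x·ξ + t τ(ξ)`. -/
def phase (σ : PhaseDatum n μ M C₀ V N₀ A B T m) (ξ : EuclideanSpace ℝ (Fin n)) : ℂ :=
  (inner ℝ σ.x ξ : ℝ) + σ.τ ξ * (σ.t : ℂ)

/-- The gradient of the phase divided by `t`. -/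
def grad (i : Fin n) (σ : PhaseDatum n μ M C₀ V N₀ A B T m) (ξ : EuclideanSpace ℝ (Fin n)) : ℂ :=
  ((σ.x i / σ.t : ℝ) : ℂ) + pd i σ.τ ξ

/-- The amplitude `a χ ⟨ξ⟩^{-N}`. -/
def amp (σ : PhaseDatum n μ M C₀ V N₀ A B T m) (ξ : EuclideanSpace ℝ (Fin n)) : ℂ :=
  σ.a ξ * σ.χ ξ * (((1 + ‖ξ‖ ^ 2) ^ (-(σ.N / 2)) : ℝ) : ℂ)

lemma polyBd_τ : (frame n μ M C₀ V N₀ A B T m).PolyBd fun σ => σ.τ :=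
  SymbolFrame.PolyBd.of_one_add_norm (fun _ => rfl) (fun σ => σ.smooth_τ)
    fun k σ ξ hξ => σ.bound_τ k ξ hξ

lemma polyBd_a : (frame n μ M C₀ V N₀ A B T m).PolyBd fun σ => σ.a :=
  SymbolFrame.PolyBd.of_one_add_norm (fun _ => rfl) (fun σ => σ.symbol_a.1)
    fun k σ ξ hξ => σ.symbol_a.2 k ξ hξ

lemma rSym_χ (hn : 1 ≤ n) (j : ℕ) :
    (frame n μ M C₀ V N₀ A B T m).RSym j (fun _ _ => 1) fun σ => σ.χ := by
  intro N
  refine SymbolFrame.Sym.of_iteratedFDeriv (fun σ ξ hξ => ?_)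
    (fun σ => σ.symbol_χ.1.mono (Set.subset_univ _)) fun k _ => ?_
  · simpa using pow_nonneg ((frame n μ M C₀ V N₀ A B T m).δ_pos σ ξ hξ).le N
  · obtain ⟨C, hC⟩ := exists_norm_iteratedFDeriv_le_bdryWt hn V B k N
    refine ⟨C, fun σ ξ hξ => ?_⟩
    rw [mul_one]
    exact hC σ.U σ.χ σ.isOpen_U σ.compl_nonempty σ.volume_le
      σ.symbol_χ σ.flat_χ ξ hξ

/-- `a` and the bracket lose a fixed power of `δ`, while `χ` gains every power, so the product gains
every power. -/
lemma rSym_amp (hn : 1 ≤ n) (j : ℕ) :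
    (frame n μ M C₀ V N₀ A B T m).RSym j (fun _ _ => 1) amp := by
  have h1 := (frame n μ M C₀ V N₀ A B T m).pSym_bracket (fun _ => rfl)
    (α := fun σ => -(σ.N / 2)) (α₀ := N₀)
    (fun σ => by
      have := σ.abs_N_le
      rw [abs_neg, abs_div, abs_two]
      linarith [abs_nonneg σ.N]) j
  refine ((h1.mul_rSym ((polyBd_a.pSym j).mul_rSym (rSym_χ hn j))).congr fun σ ξ hξ => ?_).mono
    (C := 1) (fun _ _ _ => by simp) zero_le_one
  simp only [amp]
  ring

lemma hasFDerivAt_phase (σ : PhaseDatum n μ M C₀ V N₀ A B T m) {ξ : EuclideanSpace ℝ (Fin n)}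
    (hξ : ξ ∈ σ.U) : HasFDerivAt σ.phase
      (Complex.ofRealCLM.comp (innerSL ℝ σ.x) + (σ.t : ℂ) • fderiv ℝ σ.τ ξ) ξ := by
  have hd : DifferentiableAt ℝ σ.τ ξ :=
    (σ.smooth_τ.differentiableOn (by simp)).differentiableAt (σ.isOpen_U.mem_nhds hξ)
  have h1 : HasFDerivAt (fun η : EuclideanSpace ℝ (Fin n) => ((inner ℝ σ.x η : ℝ) : ℂ))
      (Complex.ofRealCLM.comp (innerSL ℝ σ.x)) ξ :=
    (Complex.ofRealCLM.comp (innerSL ℝ σ.x)).hasFDerivAt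
  exact h1.add (hd.hasFDerivAt.mul_const (σ.t : ℂ))

lemma pd_phase (σ : PhaseDatum n μ M C₀ V N₀ A B T m) {ξ : EuclideanSpace ℝ (Fin n)} (hξ : ξ ∈ σ.U)
    (i : Fin n) : pd i σ.phase ξ = (σ.t : ℂ) * grad i σ ξ := by
  have ht : (σ.t : ℂ) ≠ 0 := by
    have := σ.one_le_t
    exact_mod_cast (by linarith : σ.t ≠ 0)
  rw [pd, (σ.hasFDerivAt_phase hξ).fderiv]
  simp [grad, pd, EuclideanSpace.inner_single_right]
  field_simp

/-- The symbol estimate for `grad` is uniform in `x`: the size `wt/s` holds by definition of `wt`,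
and the shift `x/t` is constant, so it disappears after one derivative. The weight is then `s · wt/s
≥ 1`, enough for the derivatives of `τ`. -/
lemma isPhase : (frame n μ M C₀ V N₀ A B T m).IsPhase phase grad where
  diff σ ξ hξ := (σ.hasFDerivAt_phase hξ).differentiableAt.differentiableWithinAt
  pd_eq σ ξ hξ i := by
    rw [σ.pd_phase hξ i]
    congr 1
    have : (√σ.t) ^ 2 = σ.t := Real.sq_sqrt (zero_le_one.trans σ.one_le_t)
    exact_mod_cast this.symm
  im_nonneg σ ξ hξ := by
    have := mul_nonneg (σ.im_nonneg ξ hξ) (zero_le_one.trans σ.one_le_t)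
    simpa [phase] using this
  δ_le σ ξ _ := bdryWt_le_infDist ξ
  volume_ne_top σ := (σ.volume_le.trans_lt ENNReal.ofReal_lt_top).ne
  sym j i := by
    set F := frame n μ M C₀ V N₀ A B T m
    have hu : F.UBd (fun σ ξ => F.wt grad σ ξ / F.s σ) (grad i) :=
      ⟨1, zero_le_one, fun σ ξ _ => by simpa using SymbolFrame.norm_le_wt_div i σ ξ⟩
    cases j with
    | zero => exact SymbolFrame.PSym.of_sym hu
    | succ j =>
      have hd : ∀ σ : PhaseDatum n μ M C₀ V N₀ A B T m, DifferentiableOn ℝ (pd i σ.τ) σ.U :=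
        fun σ => (contDiffOn_pd σ.isOpen_U σ.smooth_τ i).differentiableOn (by simp)
      refine SymbolFrame.PSym.of_pd (SymbolFrame.PSym.of_sym (j := 0) hu)
        (fun σ ξ _ => div_nonneg (SymbolFrame.wt_pos σ ξ).le F.s_pos.le)
        (fun σ => (hd σ).const_add _) fun k => ?_
      refine (((polyBd_τ.pd i).pd k).pSym j |>.congr fun σ ξ hξ => ?_).mono (C := 1)
        (fun σ ξ _ => ?_) zero_le_one
      · simp only [pd]
        congr 1
        exact (fderiv_const_add _).symm
      · have h1 := F.one_le_wt (G := grad) σ ξ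
        have h2 := (F.s_pos (σ := σ)).ne'
        rw [one_mul, mul_div_cancel₀ _ h2]
        exact h1

/-- The dispersive estimate for the kernel. -/
theorem exists_kernel_bound (hn : 1 ≤ n) (hC₀ : 0 < C₀) :
    ∃ C : ℝ, 0 ≤ C ∧ ∀ σ : PhaseDatum n μ M C₀ V N₀ A B T m,
      ‖∫ ξ in σ.U, Complex.exp (Complex.I * σ.phase ξ) * σ.amp ξ‖ ≤ C * (√σ.t ^ n)⁻¹ := by
  set F := frame n μ M C₀ V N₀ A B T m with hF
  obtain ⟨c, K, hc, hc4, hK, hexp⟩ := (polyBd_τ (n := n) (μ := μ) (M := M) (C₀ := C₀) (V := V)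
    (N₀ := N₀) (A := A) (B := B) (T := T) (m := m)).exists_expanding hn (fun _ => rfl) hC₀
    -- Whatever the sign of `M`, `1+|ξ| ≤ δ⁻¹` gives `(1+|ξ|)^{-M} ≥ δ^{⌈|M|⌉}`.
    (K₀ := ⌈|M|⌉₊) (fun σ ξ hξ => by
      refine le_trans (mul_le_mul_of_nonneg_left ?_ hC₀.le) (σ.det_ge ξ hξ)
      have h1 : 1 ≤ 1 + ‖ξ‖ := by simp
      have h2 := SymbolFrame.one_add_norm_le_inv_δ (F := F) (fun _ => rfl) hξ
      have h3 : (1 + ‖ξ‖) ^ (-(⌈|M|⌉₊ : ℝ)) ≤ (1 + ‖ξ‖) ^ (-M) :=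
        Real.rpow_le_rpow_of_exponent_le h1
          (neg_le_neg ((le_abs_self _).trans (Nat.le_ceil _)))
      refine le_trans ?_ h3
      rw [Real.rpow_neg (by positivity), Real.rpow_natCast, ← inv_pow]
      refine pow_le_pow_left₀ (F.δ_pos σ ξ hξ).le ?_ _
      exact (le_inv_comm₀ (by positivity) (F.δ_pos σ ξ hξ)).1 h2)
  -- `n + 1` steps, because `(1+|y|)^{-n-1}` is integrable on `ℝⁿ`.
  obtain ⟨b, hb, heq⟩ := (isPhase (n := n) (μ := μ) (M := M) (C₀ := C₀) (V := V)
    (N₀ := N₀) (A := A) (B := B) (T := T) (m := m)).exists_gain_iterate (n + 1) (rSym_amp hn _)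
  obtain ⟨D, hD⟩ := lintegral_le_of_locally_expanding (n := n) (X := Fin n → ℂ) c hc hc4 K hK
  -- `Kn` powers of `δ` pay for the volume of the averaging balls and `Kn` for the expansion rate.
  obtain ⟨C, hC, hCb⟩ := (hb (K * n + K * n)).ubd
  refine ⟨C * (|D| * |V|), by positivity, fun σ => ?_⟩
  have hU := σ.isOpen_U
  have ht : 0 < √σ.t := Real.sqrt_pos.2 (zero_lt_one.trans_le σ.one_le_t)
  have h1 := hD σ.U (fun ξ i => grad i σ ξ) (√σ.t) hU σ.compl_nonempty
    (continuousOn_pi.2 fun i => continuousOn_const.add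
      (contDiffOn_pd hU σ.smooth_τ i).continuousOn) ht
    (fun ξ hξ ξ' hξ' => by
      have h := hexp σ ξ hξ ξ' hξ'
      have he : (fun i => grad i σ ξ') - (fun i => grad i σ ξ) =
          (fun i => pd i σ.τ ξ') - fun i => pd i σ.τ ξ := by
        ext i
        simp [grad]
      rw [he]
      exact h)
  refine (heq σ).symm ▸ ?_
  have h2 : ‖∫ ξ in σ.U, Complex.exp (Complex.I * σ.phase ξ) * b σ ξ‖ₑ ≤
      ENNReal.ofReal (C * (|D| * |V|) * (√σ.t ^ n)⁻¹) := by
    refine (enorm_integral_le_lintegral_enorm _).trans ?_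
    calc ∫⁻ ξ in σ.U, ‖Complex.exp (Complex.I * σ.phase ξ) * b σ ξ‖ₑ
        ≤ ∫⁻ ξ in σ.U, ENNReal.ofReal C * ENNReal.ofReal (bdryWt σ.U ξ ^ (K * n + K * n) *
            ((1 + √σ.t * ‖fun i => grad i σ ξ‖) ^ (n + 1))⁻¹) := by
          refine setLIntegral_mono' hU.measurableSet fun ξ hξ => ?_
          rw [← ENNReal.ofReal_mul hC, ← ofReal_norm]
          refine ENNReal.ofReal_le_ofReal ?_
          rw [norm_mul]
          exact (mul_le_of_le_one_left (norm_nonneg _) (isPhase.norm_exp_le (F := F) hξ)).trans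
            (hCb σ ξ hξ)
      _ ≤ ENNReal.ofReal C * (ENNReal.ofReal (|D| * (√σ.t ^ n)⁻¹) * ENNReal.ofReal |V|) := by
          rw [lintegral_const_mul' _ _ ENNReal.ofReal_ne_top]
          refine mul_le_mul_right (h1.trans (mul_le_mul' ?_ (σ.volume_le.trans ?_))) _
          · exact ENNReal.ofReal_le_ofReal
              (mul_le_mul_of_nonneg_right (le_abs_self _) (by positivity))
          · exact ENNReal.ofReal_le_ofReal (le_abs_self _)
      _ = _ := by
          rw [← ENNReal.ofReal_mul (by positivity), ← ENNReal.ofReal_mul hC]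
          congr 1
          ring
  rw [← ofReal_norm] at h2
  exact (ENNReal.ofReal_le_ofReal_iff (by positivity)).1 h2

end PhaseDatum

/-! ### Plancherel and Fourier multiplier operators -/

section Plancherel

open scoped FourierTransform

variable {n : ℕ}

lemma continuous_fourier {f : EuclideanSpace ℝ (Fin n) → ℂ} (hf : Integrable f) :
    Continuous (𝓕 f) :=
  VectorFourier.fourierIntegral_continuous Real.continuous_fourierChar
    (by exact (innerSL ℝ).continuous₂) hf

lemma fourierInv_eq_comp_neg (f : EuclideanSpace ℝ (Fin n) → ℂ) : 𝓕⁻ f = (𝓕 f) ∘ Neg.neg := by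
  ext x
  exact Real.fourierInv_eq_fourier_neg f x

lemma continuous_fourierInv {f : EuclideanSpace ℝ (Fin n) → ℂ} (hf : Integrable f) :
    Continuous (𝓕⁻ f) := by
  rw [fourierInv_eq_comp_neg]
  exact (continuous_fourier hf).comp continuous_neg

/-- Plancherel's theorem for functions in `L¹ ∩ L²`. -/
lemma eLpNorm_fourier_eq {f : EuclideanSpace ℝ (Fin n) → ℂ} (hf : Integrable f)
    (hf2 : MemLp f 2) : eLpNorm (𝓕 f) 2 = eLpNorm f 2 := by
  set u : Lp ℂ 2 (volume : Measure (EuclideanSpace ℝ (Fin n))) := hf2.toLp f with hu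
  set v : Lp ℂ 2 (volume : Measure (EuclideanSpace ℝ (Fin n))) := 𝓕 u with hv
  have hcont := continuous_fourier hf
  -- The `L²` transform and the integral transform agree as distributions: paired with a test
  -- function `G`, both give `∫ 𝓕 G · f`.
  have key : v =ᵐ[volume] 𝓕 f := by
    refine ae_eq_of_integral_contDiff_smul_eq
      ((Lp.memLp v).locallyIntegrable (by norm_num))
      hcont.locallyIntegrable fun g hg hgc => ?_
    set G : 𝓢(EuclideanSpace ℝ (Fin n), ℂ) := HasCompactSupport.toSchwartzMap
      (f := fun x => (g x : ℂ)) (hgc.comp_left (g := fun r : ℝ => (r : ℂ)) (by simp))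
      (Complex.ofRealCLM.contDiff.comp hg) with hG
    have hGx : ∀ x, G x = (g x : ℂ) := fun x => rfl
    have h1 := congrArg (fun L => L G) (Lp.fourier_toTemperedDistribution_eq u)
    simp only [TemperedDistribution.fourier_apply, Lp.toTemperedDistribution_apply] at h1
    have h2 : ∫ x, (𝓕 G) x • u x = ∫ x, (𝓕 G) x • f x := by
      refine integral_congr_ae ?_
      filter_upwards [hf2.coeFn_toLp] with x hx
      rw [hu, hx]
    have h3 : ∫ x, (𝓕 G) x • f x = ∫ x, G x • (𝓕 f) x := by
      have := VectorFourier.integral_fourierIntegral_smul_eq_flip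
        (μ := (volume : Measure (EuclideanSpace ℝ (Fin n)))) (ν := volume)
        (L := innerₗ (EuclideanSpace ℝ (Fin n)))
        Real.continuous_fourierChar (by exact (innerSL ℝ).continuous₂) G.integrable hf
      simpa [flip_innerₗ] using! this
    rw [h2, h3] at h1
    simpa [hGx] using h1.symm
  rw [← eLpNorm_congr_ae key, ← Lp.enorm_def, ← eLpNorm_congr_ae hf2.coeFn_toLp, ← Lp.enorm_def]
  rw [← ofReal_norm, ← ofReal_norm, Lp.norm_fourier_eq]

lemma eLpNorm_fourierInv_eq {f : EuclideanSpace ℝ (Fin n) → ℂ} (hf : Integrable f)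
    (hf2 : MemLp f 2) : eLpNorm (𝓕⁻ f) 2 = eLpNorm f 2 := by
  rw [← eLpNorm_fourier_eq hf hf2]
  have hcont := continuous_fourier hf
  rw [fourierInv_eq_comp_neg, eLpNorm_comp_measurePreserving hcont.aestronglyMeasurable
    (Measure.measurePreserving_neg volume)]

lemma norm_fourier_le {f : EuclideanSpace ℝ (Fin n) → ℂ} (w : EuclideanSpace ℝ (Fin n)) :
    ‖𝓕 f w‖ ≤ ∫ x, ‖f x‖ :=
  VectorFourier.norm_fourierIntegral_le_integral_norm _ _ _ _ _

/-- The Fourier multiplier operator with symbol `m`. -/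
def mulOp (m f : EuclideanSpace ℝ (Fin n) → ℂ) : EuclideanSpace ℝ (Fin n) → ℂ :=
  𝓕⁻ fun w => m w * 𝓕 f w

section mulOp

variable {m f h : EuclideanSpace ℝ (Fin n) → ℂ} {A B : ℝ}

lemma integrable_mul_fourier (hm : Integrable m) (hf : Integrable f) :
    Integrable fun w => m w * 𝓕 f w :=
  hm.mul_bdd (c := ∫ x, ‖f x‖) (continuous_fourier hf).aestronglyMeasurable
    (Filter.Eventually.of_forall fun w => norm_fourier_le w)

lemma continuous_mulOp (hm : Integrable m) (hf : Integrable f) : Continuous (mulOp m f) :=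
  continuous_fourierInv (integrable_mul_fourier hm hf)

/-- The multiplier operator is the convolution with the inverse Fourier transform of its symbol. -/
lemma mulOp_eq_integral (hm : Integrable m) (hf : Integrable f) (x : EuclideanSpace ℝ (Fin n)) :
    mulOp m f x = ∫ y, 𝓕⁻ m (x - y) * f y := by
  have h1 : mulOp m f x = ∫ w, ∫ y,
      Complex.exp (2 * Real.pi * (inner ℝ w (x - y) : ℝ) * Complex.I) * m w * f y := by
    rw [mulOp, Real.fourierInv_eq']
    refine integral_congr_ae (Filter.Eventually.of_forall fun w => ?_)
    simp only [Real.fourier_eq', smul_eq_mul]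
    rw [← mul_assoc, ← integral_const_mul]
    refine integral_congr_ae (Filter.Eventually.of_forall fun y => ?_)
    simp only
    have : Complex.exp (2 * Real.pi * (inner ℝ w (x - y) : ℝ) * Complex.I) =
        Complex.exp (↑(2 * Real.pi * inner ℝ w x) * Complex.I) *
          Complex.exp (↑(-2 * Real.pi * inner ℝ y w) * Complex.I) := by
      rw [← Complex.exp_add, inner_sub_right, real_inner_comm w y]
      push_cast
      ring_nf
    rw [this]
    ring
  rw [h1, integral_integral_swap]
  · refine integral_congr_ae (Filter.Eventually.of_forall fun y => ?_)
    simp only [Real.fourierInv_eq', smul_eq_mul]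
    rw [← integral_mul_const]
    refine integral_congr_ae (Filter.Eventually.of_forall fun w => ?_)
    simp
  · have h2 : Integrable (fun p : EuclideanSpace ℝ (Fin n) × EuclideanSpace ℝ (Fin n) =>
        m p.1 * f p.2) (volume.prod volume) := hm.mul_prod hf
    have h3 := h2.bdd_mul (c := 1) (f := fun p : EuclideanSpace ℝ (Fin n) × EuclideanSpace ℝ (Fin n) =>
      Complex.exp (2 * Real.pi * (inner ℝ p.1 (x - p.2) : ℝ) * Complex.I))
      (Continuous.aestronglyMeasurable (by fun_prop)) (Filter.Eventually.of_forall fun p => by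
        rw [Complex.norm_exp]; simp)
    refine h3.congr (Filter.Eventually.of_forall fun p => ?_)
    simp [Function.uncurry, mul_assoc]

lemma norm_mulOp_le (hm : Integrable m) (hf : Integrable f) (hA : ∀ z, ‖𝓕⁻ m z‖ ≤ A)
    (x : EuclideanSpace ℝ (Fin n)) : ‖mulOp m f x‖ ≤ A * ∫ y, ‖f y‖ := by
  rw [mulOp_eq_integral hm hf, ← integral_const_mul]
  refine norm_integral_le_of_norm_le (hf.norm.const_mul A)
    (Filter.Eventually.of_forall fun y => ?_)
  rw [norm_mul]
  exact mul_le_mul_of_nonneg_right (hA _) (norm_nonneg _)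

lemma eLpNorm_mulOp_two_le (hm : Integrable m) (hf : Integrable f) (hf2 : MemLp f 2)
    (hB : ∀ w, ‖m w‖ ≤ B) : eLpNorm (mulOp m f) 2 ≤ ENNReal.ofReal B * eLpNorm f 2 := by
  have h1 : eLpNorm (fun w => m w * 𝓕 f w) 2 ≤ ENNReal.ofReal B * eLpNorm f 2 := by
    rw [← eLpNorm_fourier_eq hf hf2]
    refine eLpNorm_le_mul_eLpNorm_of_ae_le_mul (Filter.Eventually.of_forall fun w => ?_) _
    rw [norm_mul]
    exact mul_le_mul_of_nonneg_right (hB _) (norm_nonneg _)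
  have h2 := integrable_mul_fourier hm hf
  rw [mulOp, eLpNorm_fourierInv_eq h2 ⟨h2.1, h1.trans_lt (ENNReal.mul_lt_top ENNReal.ofReal_lt_top
    hf2.2)⟩]
  exact h1

/-- The bilinear form of the multiplier operator on `L¹`. -/
lemma norm_integral_mul_mulOp_le_one (hm : Integrable m) (hf : Integrable f) (hh : Integrable h)
    (hA : ∀ z, ‖𝓕⁻ m z‖ ≤ A) :
    ‖∫ x, h x * mulOp m f x‖ ≤ A * ((∫ x, ‖f x‖) * ∫ x, ‖h x‖) := by
  rw [← mul_assoc, ← integral_const_mul]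
  refine norm_integral_le_of_norm_le (hh.norm.const_mul _) (Filter.Eventually.of_forall fun x => ?_)
  rw [norm_mul, mul_comm]
  exact mul_le_mul_of_nonneg_right (norm_mulOp_le hm hf hA x) (norm_nonneg _)

/-- The bilinear form of the multiplier operator on `L²`. -/
lemma norm_integral_mul_mulOp_le_two (hm : Integrable m) (hf : Integrable f) (hf2 : MemLp f 2)
    (hh2 : MemLp h 2) (hB0 : 0 ≤ B) (hB : ∀ w, ‖m w‖ ≤ B) :
    ‖∫ x, h x * mulOp m f x‖ ≤ B * ((∫ x, ‖f x‖ ^ 2) * ∫ x, ‖h x‖ ^ 2) ^ (1 / 2 : ℝ) := by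
  have hsq : ∀ {u : EuclideanSpace ℝ (Fin n) → ℂ}, MemLp u 2 →
      eLpNorm u 2 = ENNReal.ofReal ((∫ x, ‖u x‖ ^ 2) ^ (1 / 2 : ℝ)) := fun {u} hu => by
    rw [hu.eLpNorm_eq_integral_rpow_norm two_ne_zero ENNReal.ofNat_ne_top]
    simp
  have h1 : ‖∫ x, h x * mulOp m f x‖ₑ ≤ eLpNorm h 2 * (ENNReal.ofReal B * eLpNorm f 2) := by
    refine (enorm_integral_le_lintegral_enorm _).trans ?_
    rw [← eLpNorm_one_eq_lintegral_enorm]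
    refine (eLpNorm_smul_le_mul_eLpNorm (p := 2) (q := 2) (r := 1)
      (continuous_mulOp hm hf).aestronglyMeasurable hh2.1).trans ?_
    exact mul_le_mul_right (eLpNorm_mulOp_two_le hm hf hf2 hB) _
  rw [hsq hf2, hsq hh2, ← ofReal_norm, ← ENNReal.ofReal_mul hB0,
    ← ENNReal.ofReal_mul (by positivity), ENNReal.ofReal_le_ofReal_iff (by positivity)] at h1
  refine h1.trans (le_of_eq ?_)
  rw [Real.mul_rpow (by positivity) (by positivity)]
  ring

end mulOp

end Plancherel

/-! ### Riesz–Thorin interpolation -/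

section Interpolation

open scoped FourierTransform

/-- For bounded `l` the derivative in `z` is dominated locally uniformly. The analytic family of the
interpolation argument has this form. -/
lemma differentiable_integral_mul_exp {α : Type*} [MeasurableSpace α] {ν : Measure α} {Φ : α → ℂ}
    {l : α → ℝ} {D : ℝ} (hΦ : Integrable Φ ν) (hl : Measurable l) (hD : ∀ a, |l a| ≤ D) :
    Differentiable ℂ fun z : ℂ => ∫ a, Φ a * Complex.exp (z * (l a : ℂ)) ∂ν := by
  intro z₀
  have hmeas : ∀ z : ℂ, Measurable fun a => Complex.exp (z * (l a : ℂ)) := fun z =>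
    Complex.measurable_exp.comp ((Complex.measurable_ofReal.comp hl).const_mul z)
  have hexp : ∀ z : ℂ, ∀ a, ‖Complex.exp (z * (l a : ℂ))‖ ≤ Real.exp (‖z‖ * D) := fun z a => by
    refine (Complex.norm_exp_le_exp_norm _).trans (Real.exp_le_exp.2 ?_)
    rw [norm_mul, Complex.norm_real, Real.norm_eq_abs]
    exact mul_le_mul_of_nonneg_left (hD a) (norm_nonneg _)
  have h := hasDerivAt_integral_of_dominated_loc_of_deriv_le (μ := ν) (𝕜 := ℂ) (x₀ := z₀)
    (F := fun z a => Φ a * Complex.exp (z * (l a : ℂ)))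
    (F' := fun z a => Φ a * (Complex.exp (z * (l a : ℂ)) * (l a : ℂ)))
    (s := Metric.ball z₀ 1) (bound := fun a => ‖Φ a‖ * (Real.exp ((‖z₀‖ + 1) * D) * D))
    (Metric.ball_mem_nhds z₀ one_pos)
    (Filter.Eventually.of_forall fun z => hΦ.1.mul (hmeas z).aestronglyMeasurable)
    (hΦ.mul_bdd (c := Real.exp (‖z₀‖ * D)) (hmeas z₀).aestronglyMeasurable
      (Filter.Eventually.of_forall (hexp z₀)))
    (hΦ.1.mul ((hmeas z₀).aestronglyMeasurable.mul
      (Complex.measurable_ofReal.comp hl).aestronglyMeasurable))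
    (Filter.Eventually.of_forall fun a z hz => ?_) (hΦ.norm.mul_const _)
    (Filter.Eventually.of_forall fun a z _ => ?_)
  · exact h.2.differentiableAt
  · have hD0 : 0 ≤ D := (abs_nonneg _).trans (hD a)
    have hz1 : ‖z‖ ≤ ‖z₀‖ + 1 := by
      have h1 := norm_add_le z₀ (z - z₀)
      rw [Metric.mem_ball, dist_eq_norm] at hz
      rw [add_sub_cancel] at h1
      linarith
    rw [norm_mul, norm_mul, Complex.norm_real, Real.norm_eq_abs]
    refine mul_le_mul_of_nonneg_left (mul_le_mul ((hexp z a).trans ?_) (hD a) (abs_nonneg _)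
      (Real.exp_nonneg _)) (norm_nonneg _)
    exact Real.exp_le_exp.2 (mul_le_mul_of_nonneg_right hz1 hD0)
  · have h1 : HasDerivAt (fun z : ℂ => z * (l a : ℂ)) (l a : ℂ) z := by
      simpa using (hasDerivAt_id z).mul_const (l a : ℂ)
    exact h1.cexp.const_mul (Φ a)

variable {n : ℕ}

/-- Measurable functions that are bounded above and away from zero on their support, which has
finite measure. -/
structure Tame (R : ℝ) (f : EuclideanSpace ℝ (Fin n) → ℂ) : Prop where
  measurable : Measurable f
  one_le : 1 ≤ R
  ge : ∀ x, f x ≠ 0 → R⁻¹ ≤ ‖f x‖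
  le : ∀ x, ‖f x‖ ≤ R
  finite : volume (Function.support f) ≠ ⊤

/-- The function `sgn f |f|^w`. -/
def phasePow (f : EuclideanSpace ℝ (Fin n) → ℂ) (w : ℂ) (x : EuclideanSpace ℝ (Fin n)) : ℂ :=
  f x * Complex.exp ((w - 1) * (Real.log ‖f x‖ : ℂ))

section Tame

variable {f h : EuclideanSpace ℝ (Fin n) → ℂ} {R R' : ℝ}

/-- This is what tameness is for: with a bounded logarithm, `sgn f |f|^w` is entire in `w` with
bounds on vertical strips. Zeros of `f` are harmless as `log 0 = 0`. -/
lemma Tame.abs_log_le (hf : Tame R f) (x : EuclideanSpace ℝ (Fin n)) :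
    |Real.log ‖f x‖| ≤ Real.log R := by
  by_cases h : f x = 0
  · simpa [h] using Real.log_nonneg hf.one_le
  · have h0 : 0 < ‖f x‖ := norm_pos_iff.2 h
    have hR : 0 < R := zero_lt_one.trans_le hf.one_le
    rw [abs_le, ← Real.log_inv]
    exact ⟨Real.log_le_log (inv_pos.2 hR) (hf.ge x h), Real.log_le_log h0 (hf.le x)⟩

lemma Tame.measurable_phasePow (hf : Tame R f) (w : ℂ) : Measurable (phasePow f w) :=
  hf.measurable.mul (Complex.measurable_exp.comp ((Complex.measurable_ofReal.comp
    (Real.measurable_log.comp hf.measurable.norm)).const_mul _))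

lemma Tame.memLp_phasePow (hf : Tame R f) (w : ℂ) (p : ℝ≥0∞) : MemLp (phasePow f w) p := by
  have hR : 0 < R := zero_lt_one.trans_le hf.one_le
  refine (memLp_indicator_const (μ := volume) p (s := Function.support f)
    (hf.measurable (MeasurableSet.singleton 0)).compl
    (R * Real.exp (‖w - 1‖ * Real.log R)) (Or.inr hf.finite)).mono
    (hf.measurable_phasePow w).aestronglyMeasurable (Filter.Eventually.of_forall fun x => ?_)
  by_cases h : f x = 0
  · simp [phasePow, h]
  · rw [Set.indicator_of_mem (Function.mem_support.2 h), Real.norm_of_nonneg (by positivity),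
      phasePow, norm_mul]
    refine mul_le_mul (hf.le x) ((Complex.norm_exp_le_exp_norm _).trans (Real.exp_le_exp.2 ?_))
      (norm_nonneg _) hR.le
    rw [norm_mul, Complex.norm_real, Real.norm_eq_abs]
    exact mul_le_mul_of_nonneg_left (hf.abs_log_le x) (norm_nonneg _)

lemma Tame.integrable_phasePow (hf : Tame R f) (w : ℂ) : Integrable (phasePow f w) :=
  memLp_one_iff_integrable.1 (hf.memLp_phasePow w 1)

lemma norm_phasePow (f : EuclideanSpace ℝ (Fin n) → ℂ) {w : ℂ} (hw : 0 < w.re)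
    (x : EuclideanSpace ℝ (Fin n)) : ‖phasePow f w x‖ = ‖f x‖ ^ w.re := by
  by_cases h : f x = 0
  · simp [phasePow, h, Real.zero_rpow hw.ne']
  · have h0 : 0 < ‖f x‖ := norm_pos_iff.2 h
    rw [phasePow, norm_mul, Complex.norm_exp, Complex.re_mul_ofReal, Complex.sub_re,
      Complex.one_re, mul_comm (w.re - 1), ← Real.rpow_def_of_pos h0, ← Real.rpow_one_add' h0.le
      (by simpa using hw.ne')]
    congr 1
    ring

lemma phasePow_one (f : EuclideanSpace ℝ (Fin n) → ℂ) : phasePow f 1 = f := by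
  ext x
  simp [phasePow]

/-- Puts all dependence on `z` into an exponential with bounded real coefficient. -/
lemma phasePow_split (f : EuclideanSpace ℝ (Fin n) → ℂ) (κ : ℝ) (z : ℂ)
    (x : EuclideanSpace ℝ (Fin n)) : phasePow f (κ * (1 + z)) x =
      phasePow f κ x * Complex.exp (z * ((κ * Real.log ‖f x‖ : ℝ) : ℂ)) := by
  rw [phasePow, phasePow, mul_assoc, ← Complex.exp_add]
  congr 2
  push_cast
  ring

lemma Tame.integrable (hf : Tame R f) : Integrable f := by
  simpa [phasePow_one] using hf.integrable_phasePow 1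

variable {m : EuclideanSpace ℝ (Fin n) → ℂ} {A B : ℝ}

/-- Riesz–Thorin interpolation for the bilinear form of a multiplier operator. -/
lemma Tame.norm_integral_mul_mulOp_le (hf : Tame R f) (hh : Tame R' h) (hm : Integrable m)
    (hA : ∀ z, ‖𝓕⁻ m z‖ ≤ A) (hB : ∀ w, ‖m w‖ ≤ B) {θ : ℝ} (h0 : 0 ≤ θ) (h1 : θ ≤ 1) :
    ‖∫ x, h x * mulOp m f x‖ ≤ B ^ (1 - θ) * A ^ θ *
      ((∫ x, ‖f x‖ ^ (2 / (1 + θ))) * ∫ x, ‖h x‖ ^ (2 / (1 + θ))) ^ ((1 + θ) / 2) := by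
  have hB0 : 0 ≤ B := (norm_nonneg _).trans (hB 0)
  have hA0 : 0 ≤ A := (norm_nonneg _).trans (hA 0)
  -- The powers `κ(1+z)` have real part `κ` on `Re z = 0`, `2κ` on `Re z = 1`, and equal `1` at `z =
  -- θ`. Hence the `L²` norm on one edge and the `L¹` norm on the other are powers of the same
  -- integral of `|f|^{2κ}`, where `2κ = 2/(1+θ)` is the Lebesgue exponent.
  set κ : ℝ := 1 / (1 + θ) with hκ
  have hκ0 : 0 < κ := by positivity
  have hκ2 : 2 / (1 + θ) = κ * 2 := by rw [hκ]; ring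
  rw [hκ2]
  set If := ∫ x, ‖f x‖ ^ (κ * 2) with hIf
  set Ih := ∫ x, ‖h x‖ ^ (κ * 2) with hIh
  have hIf0 : 0 ≤ If := integral_nonneg fun x => by positivity
  have hIh0 : 0 ≤ Ih := integral_nonneg fun x => by positivity
  set F : ℂ → ℂ := fun z => ∫ x, phasePow h (κ * (1 + z)) x *
    mulOp m (phasePow f (κ * (1 + z))) x with hF
  have hre : ∀ z : ℂ, ((κ : ℂ) * (1 + z)).re = κ * (1 + z.re) := fun z => by simp
  set Φ : EuclideanSpace ℝ (Fin n) × EuclideanSpace ℝ (Fin n) → ℂ := fun q =>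
    𝓕⁻ m (q.1 - q.2) * (phasePow h κ q.1 * phasePow f κ q.2) with hΦ
  set l : EuclideanSpace ℝ (Fin n) × EuclideanSpace ℝ (Fin n) → ℝ := fun q =>
    κ * Real.log ‖h q.1‖ + κ * Real.log ‖f q.2‖ with hl
  have hΦi : Integrable Φ (volume.prod volume) :=
    ((hh.integrable_phasePow κ).mul_prod (hf.integrable_phasePow κ)).bdd_mul (c := A)
      ((continuous_fourierInv hm).comp (continuous_fst.sub continuous_snd)).aestronglyMeasurable
      (Filter.Eventually.of_forall fun q => hA _)
  have hlm : Measurable l :=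
    ((Real.measurable_log.comp (hh.measurable.comp measurable_fst).norm).const_mul κ).add
      ((Real.measurable_log.comp (hf.measurable.comp measurable_snd).norm).const_mul κ)
  set D := κ * Real.log R' + κ * Real.log R with hD
  have hlD : ∀ q, |l q| ≤ D := fun q => by
    refine (abs_add_le _ _).trans (add_le_add ?_ ?_) <;> rw [abs_mul, abs_of_pos hκ0]
    · exact mul_le_mul_of_nonneg_left (hh.abs_log_le _) hκ0.le
    · exact mul_le_mul_of_nonneg_left (hf.abs_log_le _) hκ0.le
  have hexp : ∀ z : ℂ, ∀ q, ‖Complex.exp (z * (l q : ℂ))‖ ≤ Real.exp (|z.re| * D) := fun z q => by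
    rw [Complex.norm_exp, Complex.re_mul_ofReal]
    refine Real.exp_le_exp.2 ((le_abs_self _).trans ?_)
    rw [abs_mul]
    exact mul_le_mul_of_nonneg_left (hlD q) (abs_nonneg _)
  have hint : ∀ z : ℂ, Integrable (fun q => Φ q * Complex.exp (z * (l q : ℂ)))
      (volume.prod volume) := fun z =>
    hΦi.mul_bdd (c := Real.exp (|z.re| * D)) (Complex.measurable_exp.comp
      ((Complex.measurable_ofReal.comp hlm).const_mul z)).aestronglyMeasurable
      (Filter.Eventually.of_forall (hexp z))
  have hFeq : F = fun z => ∫ q, Φ q * Complex.exp (z * (l q : ℂ)) ∂(volume.prod volume) := by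
    ext z
    rw [integral_prod _ (hint z)]
    refine integral_congr_ae (Filter.Eventually.of_forall fun x => ?_)
    simp only
    rw [mulOp_eq_integral hm (hf.integrable_phasePow _), ← integral_const_mul]
    refine integral_congr_ae (Filter.Eventually.of_forall fun y => ?_)
    simp only [hΦ, hl, phasePow_split]
    rw [Complex.ofReal_add, mul_add, Complex.exp_add]
    ring
  have hdiff : Differentiable ℂ F := by
    rw [hFeq]
    exact differentiable_integral_mul_exp hΦi hlm hlD
  have hbdd : BddAbove ((norm ∘ F) '' Complex.HadamardThreeLines.verticalClosedStrip 0 1) := by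
    refine ⟨∫ q, ‖Φ q‖ * Real.exp D ∂(volume.prod volume), ?_⟩
    rintro _ ⟨z, hz, rfl⟩
    have hz' : 0 ≤ z.re ∧ z.re ≤ 1 := hz
    have hD0 : 0 ≤ D := (abs_nonneg _).trans (hlD 0)
    simp only [Function.comp, hFeq]
    refine norm_integral_le_of_norm_le (hΦi.norm.mul_const _)
      (Filter.Eventually.of_forall fun q => ?_)
    rw [norm_mul]
    refine mul_le_mul_of_nonneg_left ((hexp z q).trans (Real.exp_le_exp.2 ?_)) (norm_nonneg _)
    rw [abs_of_nonneg hz'.1]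
    exact mul_le_of_le_one_left hD0 hz'.2
  have hsq : ∀ {u : EuclideanSpace ℝ (Fin n) → ℂ} {z : ℂ}, z.re = 0 →
      ∫ x, ‖phasePow u (κ * (1 + z)) x‖ ^ 2 = ∫ x, ‖u x‖ ^ (κ * 2) := fun {u z} hz => by
    refine integral_congr_ae (Filter.Eventually.of_forall fun x => ?_)
    simp only
    rw [norm_phasePow u (by rw [hre, hz]; linarith), hre, hz, add_zero, mul_one,
      Real.rpow_mul (norm_nonneg _), Real.rpow_two]
  have hone : ∀ {u : EuclideanSpace ℝ (Fin n) → ℂ} {z : ℂ}, z.re = 1 →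
      ∫ x, ‖phasePow u (κ * (1 + z)) x‖ = ∫ x, ‖u x‖ ^ (κ * 2) := fun {u z} hz => by
    refine integral_congr_ae (Filter.Eventually.of_forall fun x => ?_)
    simp only
    rw [norm_phasePow u (by rw [hre, hz]; linarith), hre, hz]
    norm_num
  -- The edge bounds carry `(If * Ih)` to the powers `1/2` and `1`, which interpolate to `(1-θ)/2 +
  -- θ = (1+θ)/2`.
  have key := Complex.HadamardThreeLines.norm_le_interp_of_mem_verticalClosedStrip₀₁' F
    (z := (θ : ℂ)) (a := B * (If * Ih) ^ (1 / 2 : ℝ)) (b := A * (If * Ih)) ⟨by simpa, by simpa⟩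
    hdiff.diffContOnCl hbdd (fun z hz => ?_) (fun z hz => ?_)
  · have hFθ : F θ = ∫ x, h x * mulOp m f x := by
      have : (κ : ℂ) * (1 + θ) = 1 := by
        have : κ * (1 + θ) = 1 := by rw [hκ]; field_simp
        exact_mod_cast this
      simp only [hF, this, phasePow_one]
    rw [hFθ, Complex.ofReal_re] at key
    refine key.trans (le_of_eq ?_)
    rw [Real.mul_rpow hB0 (by positivity), Real.mul_rpow hA0 (by positivity),
      ← Real.rpow_mul (by positivity)]
    rw [show B ^ (1 - θ) * (If * Ih) ^ (1 / 2 * (1 - θ)) * (A ^ θ * (If * Ih) ^ θ) =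
      B ^ (1 - θ) * A ^ θ * ((If * Ih) ^ (1 / 2 * (1 - θ)) * (If * Ih) ^ θ) by ring,
      ← Real.rpow_add_of_nonneg (by positivity) (by linarith) h0]
    congr 2
    ring
  · have hz : z.re = 0 := hz
    have := norm_integral_mul_mulOp_le_two (h := phasePow h (κ * (1 + z))) hm
      (hf.integrable_phasePow (κ * (1 + z))) (hf.memLp_phasePow _ 2) (hh.memLp_phasePow _ 2) hB0 hB
    rwa [hsq hz, hsq hz] at this
  · have hz : z.re = 1 := hz
    have := norm_integral_mul_mulOp_le_one hm
      (hf.integrable_phasePow (κ * (1 + z))) (hh.integrable_phasePow (κ * (1 + z))) hA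
    rwa [hone hz, hone hz] at this

/-- The interpolated bilinear estimate for a general first argument. -/
lemma Tame.norm_integral_mul_mulOp_le' {g : EuclideanSpace ℝ (Fin n) → ℂ} (hg : Measurable g)
    (hgi : Integrable g) (hh : Tame R' h) (hm : Integrable m)
    (hA : ∀ z, ‖𝓕⁻ m z‖ ≤ A) (hB : ∀ w, ‖m w‖ ≤ B) {θ : ℝ} (h0 : 0 ≤ θ) (h1 : θ ≤ 1)
    (hgp : Integrable fun x => ‖g x‖ ^ (2 / (1 + θ))) :
    ‖∫ x, h x * mulOp m g x‖ ≤ B ^ (1 - θ) * A ^ θ *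
      ((∫ x, ‖g x‖ ^ (2 / (1 + θ))) * ∫ x, ‖h x‖ ^ (2 / (1 + θ))) ^ ((1 + θ) / 2) := by
  have hB0 : 0 ≤ B := (norm_nonneg _).trans (hB 0)
  have hA0 : 0 ≤ A := (norm_nonneg _).trans (hA 0)
  have hp0 : 0 < 2 / (1 + θ) := by positivity
  -- Restricting `g` to these level sets makes it tame, the lower level giving finite measure by
  -- integrability. Dominated convergence removes the truncation.
  set S : ℕ → Set (EuclideanSpace ℝ (Fin n)) := fun j =>
    {x | ((j : ℝ) + 1)⁻¹ ≤ ‖g x‖} ∩ {x | ‖g x‖ ≤ (j : ℝ) + 1} with hS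
  have hSm : ∀ j, MeasurableSet (S j) := fun j =>
    (measurableSet_le measurable_const hg.norm).inter (measurableSet_le hg.norm measurable_const)
  set G : ℕ → EuclideanSpace ℝ (Fin n) → ℂ := fun j => (S j).indicator g with hG
  have hGt : ∀ j : ℕ, Tame ((j : ℝ) + 1) (G j) := fun j => by
    refine ⟨hg.indicator (hSm j), by simp, fun x hx => ?_, fun x => ?_, ?_⟩
    · have hxS : x ∈ S j := by
        by_contra hc
        exact hx (Set.indicator_of_notMem hc g)
      rw [hG]
      simpa [hxS] using hxS.1
    · by_cases hxS : x ∈ S j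
      · simpa [hG, hxS] using hxS.2
      · simp only [hG, hxS, not_false_eq_true, Set.indicator_of_notMem, norm_zero]
        positivity
    · refine ((measure_mono (fun x hx => ?_)).trans_lt
        (hgi.measure_norm_ge_lt_top (ε := ((j : ℝ) + 1)⁻¹) (by positivity))).ne
      by_contra hc
      exact hx (Set.indicator_of_notMem (fun h => hc h.1) g)
  have hGle : ∀ j x, ‖G j x‖ ≤ ‖g x‖ := fun j x => norm_indicator_le_norm_self _ _
  have hGlim : ∀ x, Filter.Tendsto (fun j => G j x) Filter.atTop (nhds (g x)) := fun x => by
    by_cases hx : g x = 0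
    · have : ∀ j, G j x = 0 := fun j => by simp [hG, Set.indicator, hx]
      simp [this, hx]
    · have hpos : 0 < ‖g x‖ := norm_pos_iff.2 hx
      obtain ⟨J₁, hJ₁⟩ := exists_nat_ge ‖g x‖
      obtain ⟨J₂, hJ₂⟩ := exists_nat_ge ‖g x‖⁻¹
      refine tendsto_const_nhds.congr' ?_
      filter_upwards [Filter.eventually_ge_atTop (max J₁ J₂)] with j hj
      have e1 : (J₁ : ℝ) ≤ j := by exact_mod_cast (le_max_left _ _).trans hj
      have e2 : (J₂ : ℝ) ≤ j := by exact_mod_cast (le_max_right _ _).trans hj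
      have hxS : x ∈ S j := by
        refine ⟨?_, ?_⟩
        · exact (inv_le_comm₀ (by positivity) hpos).2 (by linarith)
        · change ‖g x‖ ≤ (j : ℝ) + 1
          linarith
      simp [hG, hxS]
  have hlim1 : ∀ x, Filter.Tendsto (fun j => mulOp m (G j) x) Filter.atTop
      (nhds (mulOp m g x)) := fun x => by
    simp_rw [fun j => mulOp_eq_integral hm (hGt j).integrable x, mulOp_eq_integral hm hgi x]
    refine tendsto_integral_of_dominated_convergence (fun y => A * ‖g y‖) (fun j => ?_)
      (hgi.norm.const_mul A) (fun j => Filter.Eventually.of_forall fun y => ?_)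
      (Filter.Eventually.of_forall fun y => (hGlim y).const_mul _)
    · exact ((continuous_fourierInv hm).comp
        (continuous_const.sub continuous_id)).aestronglyMeasurable.mul (hGt j).integrable.1
    · rw [norm_mul]
      exact mul_le_mul (hA _) (hGle j y) (norm_nonneg _) hA0
  have hlim2 : Filter.Tendsto (fun j => ∫ x, h x * mulOp m (G j) x) Filter.atTop
      (nhds (∫ x, h x * mulOp m g x)) := by
    refine tendsto_integral_of_dominated_convergence (fun x => ‖h x‖ * (A * ∫ y, ‖g y‖))
      (fun j => hh.integrable.1.mul
        (continuous_mulOp hm (hGt j).integrable).aestronglyMeasurable)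
      (hh.integrable.norm.mul_const _) (fun j => Filter.Eventually.of_forall fun x => ?_)
      (Filter.Eventually.of_forall fun x => (hlim1 x).const_mul _)
    rw [norm_mul]
    refine mul_le_mul_of_nonneg_left ((norm_mulOp_le hm (hGt j).integrable hA x).trans
      (mul_le_mul_of_nonneg_left ?_ hA0)) (norm_nonneg _)
    exact integral_mono (hGt j).integrable.norm hgi.norm (hGle j)
  refine le_of_tendsto' hlim2.norm fun j =>
    ((hGt j).norm_integral_mul_mulOp_le hh hm hA hB h0 h1).trans ?_
  refine mul_le_mul_of_nonneg_left (Real.rpow_le_rpow ?_ (mul_le_mul_of_nonneg_right ?_ ?_) ?_)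
    (by positivity)
  · exact mul_nonneg (integral_nonneg fun x => by positivity)
      (integral_nonneg fun x => by positivity)
  · exact integral_mono_of_nonneg (Filter.Eventually.of_forall fun x => by positivity) hgp
      (Filter.Eventually.of_forall fun x =>
        Real.rpow_le_rpow (norm_nonneg _) (hGle j x) hp0.le)
  · exact integral_nonneg fun x => by positivity
  · positivity

end Tame

end Interpolation

/-! ### From the bilinear estimate to the operator bound -/

section Duality

open scoped FourierTransform

variable {n : ℕ} {m : EuclideanSpace ℝ (Fin n) → ℂ} {A B : ℝ}

/-- One divides by `J^{(1+θ)/2}`, which needs `J` finite; hence the truncation sets in the duality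
argument. -/
lemma rpow_le_of_le_mul_rpow {J D θ : ℝ} (hJ : 0 ≤ J) (hθ1 : θ < 1)
    (h : J ≤ D * J ^ ((1 + θ) / 2)) (hD : 0 ≤ D) : J ≤ D ^ (2 / (1 - θ)) := by
  rcases hJ.eq_or_lt with rfl | hpos
  · positivity
  have h1 : J ^ ((1 - θ) / 2) ≤ D := by
    have h2 : J ^ ((1 - θ) / 2) * J ^ ((1 + θ) / 2) ≤ D * J ^ ((1 + θ) / 2) := by
      rw [← Real.rpow_add hpos]
      convert h using 1
      rw [show (1 - θ) / 2 + (1 + θ) / 2 = 1 by ring, Real.rpow_one]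
    exact le_of_mul_le_mul_right h2 (by positivity)
  have h3 := Real.rpow_le_rpow (by positivity) h1 (z := 2 / (1 - θ))
    (div_nonneg zero_le_two (by linarith))
  rw [← Real.rpow_mul hJ] at h3
  have h4 : (1 - θ) / 2 * (2 / (1 - θ)) = 1 := by
    have : 1 - θ ≠ 0 := by linarith
    field_simp
  rwa [h4, Real.rpow_one] at h3

/-- The strong type estimate on the truncation sets. -/
lemma setLIntegral_mulOp_rpow_le {g : EuclideanSpace ℝ (Fin n) → ℂ} (hg : Measurable g)
    (hgi : Integrable g) (hm : Integrable m) (hA : ∀ z, ‖𝓕⁻ m z‖ ≤ A) (hB : ∀ w, ‖m w‖ ≤ B)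
    {θ : ℝ} (h0 : 0 ≤ θ) (h1 : θ < 1) (hgp : Integrable fun x => ‖g x‖ ^ (2 / (1 + θ))) (k : ℕ) :
    ∫⁻ x in {x | ‖x‖ ≤ k} ∩ {x | ((k : ℝ) + 1)⁻¹ ≤ ‖mulOp m g x‖}, ‖mulOp m g x‖ₑ ^ (2 / (1 - θ)) ≤
      ENNReal.ofReal ((B ^ (1 - θ) * A ^ θ * (∫ x, ‖g x‖ ^ (2 / (1 + θ))) ^ ((1 + θ) / 2)) ^
        (2 / (1 - θ))) := by
  have hB0 : 0 ≤ B := (norm_nonneg _).trans (hB 0)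
  have hA0 : 0 ≤ A := (norm_nonneg _).trans (hA 0)
  set u := mulOp m g with hu
  have huc : Continuous u := continuous_mulOp hm hgi
  set q := 2 / (1 - θ) with hq
  have hq2 : 2 ≤ q := by
    rw [hq, le_div_iff₀ (by linarith)]
    linarith
  set S := {x : EuclideanSpace ℝ (Fin n) | ‖x‖ ≤ k} ∩ {x | ((k : ℝ) + 1)⁻¹ ≤ ‖u x‖} with hS
  have hSm : MeasurableSet S :=
    ((isClosed_le continuous_norm continuous_const).inter
      (isClosed_le continuous_const huc.norm)).measurableSet
  have hSf : volume S ≠ ⊤ := by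
    refine ((measure_mono (fun x hx => ?_)).trans_lt (measure_closedBall_lt_top
      (x := (0 : EuclideanSpace ℝ (Fin n))) (r := k))).ne
    simpa using hx.1
  set D := max ((k : ℝ) + 1) (A * ∫ y, ‖g y‖) with hD
  have hD1 : 1 ≤ D := le_max_of_le_left (by simp)
  have hD0 : 0 < D := zero_lt_one.trans_le hD1
  have huD : ∀ x, ‖u x‖ ≤ D := fun x => (norm_mulOp_le hm hgi hA x).trans (le_max_right _ _)
  have hpos : ∀ x ∈ S, 0 < ‖u x‖ := fun x hx => (by positivity : (0 : ℝ) < ((k : ℝ) + 1)⁻¹).trans_le hx.2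
  -- The extremal function of the duality: `h u = |u|^q`, and `|h|^p = |u|^q` with `p = 2/(1+θ)`
  -- because `(q-1)p = q`. The bilinear estimate becomes `J ≤ const · J^{1/p}`. The truncation makes
  -- `h` tame.
  set h : EuclideanSpace ℝ (Fin n) → ℂ := S.indicator fun x =>
    (starRingEnd ℂ) (u x) * ((‖u x‖ ^ (q - 2) : ℝ) : ℂ) with hh
  have hhS : ∀ x ∈ S, ‖h x‖ = ‖u x‖ ^ (q - 1) := fun x hx => by
    simp only [hh, Set.indicator_of_mem hx, norm_mul, RCLike.norm_conj, Complex.norm_real]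
    rw [Real.norm_of_nonneg (by positivity), ← Real.rpow_one_add' (norm_nonneg _) (by linarith)]
    congr 1
    ring
  have hhS' : ∀ x ∉ S, h x = 0 := fun x hx => Set.indicator_of_notMem hx _
  have hht : Tame (D ^ (q - 1)) h := by
    refine ⟨?_, Real.one_le_rpow hD1 (by linarith), fun x hx => ?_, fun x => ?_, ?_⟩
    · refine Measurable.indicator ?_ hSm
      refine (Complex.continuous_conj.comp huc).measurable.mul (Complex.measurable_ofReal.comp ?_)
      exact huc.norm.measurable.pow_const _
    · have hxS : x ∈ S := by
        by_contra hc
        exact hx (hhS' x hc)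
      rw [hhS x hxS, ← Real.inv_rpow hD0.le]
      refine Real.rpow_le_rpow (by positivity) (le_trans ?_ hxS.2) (by linarith)
      exact inv_anti₀ (by positivity) (le_max_left _ _)
    · by_cases hxS : x ∈ S
      · rw [hhS x hxS]
        exact Real.rpow_le_rpow (norm_nonneg _) (huD x) (by linarith)
      · rw [hhS' x hxS, norm_zero]
        positivity
    · refine ((measure_mono fun x hx => ?_).trans_lt hSf.lt_top).ne
      by_contra hc
      exact hx (hhS' x hc)
  set J := ∫ x in S, ‖u x‖ ^ q with hJ
  have hJ0 : 0 ≤ J := integral_nonneg fun x => by positivity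
  have hJ1 : ∫ x, h x * u x = (J : ℂ) := by
    rw [hJ, ← integral_complex_ofReal, ← integral_indicator hSm]
    refine integral_congr_ae (Filter.Eventually.of_forall fun x => ?_)
    by_cases hxS : x ∈ S
    · simp only [hh, Set.indicator_of_mem hxS]
      rw [mul_right_comm, mul_comm ((starRingEnd ℂ) (u x)), Complex.mul_conj']
      norm_cast
      rw [← Real.rpow_natCast, ← Real.rpow_add (hpos x hxS)]
      congr 1
      push_cast
      ring
    · simp [hhS' x hxS, hxS]
  have hJ2 : ∫ x, ‖h x‖ ^ (2 / (1 + θ)) = J := by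
    rw [hJ, ← integral_indicator hSm]
    refine integral_congr_ae (Filter.Eventually.of_forall fun x => ?_)
    by_cases hxS : x ∈ S
    · simp only [Set.indicator_of_mem hxS, hhS x hxS]
      rw [← Real.rpow_mul (norm_nonneg _)]
      congr 1
      have e1 : 1 - θ ≠ 0 := by linarith
      have e2 : 1 + θ ≠ 0 := by linarith
      rw [hq]
      field_simp
      ring
    · simp only [hhS' x hxS, hxS, not_false_eq_true, Set.indicator_of_notMem, norm_zero]
      exact Real.zero_rpow (by positivity)
  have key := hht.norm_integral_mul_mulOp_le' hg hgi hm hA hB h0 h1.le hgp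
  have hG0 : 0 ≤ ∫ x, ‖g x‖ ^ (2 / (1 + θ)) := integral_nonneg fun x => by positivity
  rw [hJ1, hJ2, Complex.norm_real, Real.norm_of_nonneg hJ0, Real.mul_rpow hG0 hJ0, ← mul_assoc]
    at key
  have hfin := rpow_le_of_le_mul_rpow hJ0 h1 key (by positivity)
  refine le_trans (le_of_eq ?_) (ENNReal.ofReal_le_ofReal hfin)
  have hint : IntegrableOn (fun x => ‖u x‖ ^ q) S := by
    have : IsFiniteMeasure (volume.restrict S) := isFiniteMeasure_restrict.2 hSf
    refine Integrable.of_bound (huc.norm.measurable.pow_const _).aestronglyMeasurable (D ^ q)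
      (Filter.Eventually.of_forall fun x => ?_)
    rw [Real.norm_of_nonneg (by positivity)]
    exact Real.rpow_le_rpow (norm_nonneg _) (huD x) (by linarith)
  rw [hJ, ofReal_integral_eq_lintegral_ofReal hint
    (Filter.Eventually.of_forall fun x => by positivity)]
  refine lintegral_congr fun x => ?_
  rw [← ENNReal.ofReal_rpow_of_nonneg (norm_nonneg _) (by linarith), ofReal_norm]

/-- The `L^p`–`L^q` estimate for a Fourier multiplier operator with bounded symbol and bounded
kernel. -/
theorem eLpNorm_mulOp_le (hm : Integrable m) (hA : ∀ z, ‖𝓕⁻ m z‖ ≤ A) (hB : ∀ w, ‖m w‖ ≤ B)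
    (g : 𝓢(EuclideanSpace ℝ (Fin n), ℂ)) {p q : ℝ≥0∞} (hp1 : 1 ≤ p) (hp2 : p ≤ 2)
    (hpq : p⁻¹ + q⁻¹ = 1) :
    eLpNorm (mulOp m g) q ≤ ENNReal.ofReal (B ^ (1 - ((p⁻¹).toReal - (q⁻¹).toReal)) *
      A ^ ((p⁻¹).toReal - (q⁻¹).toReal)) * eLpNorm g p := by
  have hB0 : 0 ≤ B := (norm_nonneg _).trans (hB 0)
  have hA0 : 0 ≤ A := (norm_nonneg _).trans (hA 0)
  have hgi : Integrable g := g.integrable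
  -- For `p = 1` one has `θ = 1` and `q = ∞`; the exponent `2/(1-θ)` is meaningless and the kernel
  -- bound applies directly.
  rcases hp1.eq_or_lt with rfl | hp1
  · have hq : q⁻¹ = 0 := by
      exact (ENNReal.add_right_inj ENNReal.one_ne_top).1 (by simpa using hpq)
    have hq' : q = ⊤ := ENNReal.inv_eq_zero.1 hq
    subst hq'
    simp only [inv_one, ENNReal.toReal_one, ENNReal.inv_top, ENNReal.toReal_zero, sub_zero,
      sub_self, Real.rpow_zero, one_mul, Real.rpow_one, eLpNorm_exponent_top]
    refine eLpNormEssSup_le_of_ae_bound (C := A * ∫ y, ‖g y‖)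
      (Filter.Eventually.of_forall fun x => norm_mulOp_le hm hgi hA x) |>.trans (le_of_eq ?_)
    rw [ENNReal.ofReal_mul hA0, eLpNorm_one_eq_lintegral_enorm,
      ofReal_integral_norm_eq_lintegral_enorm hgi]
  · have hp0 : p ≠ 0 := (zero_lt_one.trans hp1).ne'
    have hpt : p ≠ ⊤ := (hp2.trans_lt ENNReal.ofNat_lt_top).ne
    set a := (p⁻¹).toReal with ha
    set b := (q⁻¹).toReal with hb
    have hpi : p⁻¹ ≠ ⊤ := ENNReal.inv_ne_top.2 hp0
    have hqi : q⁻¹ ≠ ⊤ := by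
      intro hq
      simp [hq] at hpq
    have hab : a + b = 1 := by
      rw [ha, hb, ← ENNReal.toReal_add hpi hqi, hpq, ENNReal.toReal_one]
    have ha1 : a < 1 := by
      have : p⁻¹ < 1 := ENNReal.inv_lt_one.2 hp1
      have := (ENNReal.toReal_lt_toReal hpi ENNReal.one_ne_top).2 this
      rw [ENNReal.toReal_one] at this
      exact this
    have ha2 : 1 / 2 ≤ a := by
      have h := (ENNReal.toReal_le_toReal (by simp) hpi).2 (ENNReal.inv_le_inv.2 hp2)
      rw [ENNReal.toReal_inv, ENNReal.toReal_ofNat, ← one_div] at h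
      exact h
    have hpr : p.toReal = 2 / (1 + (a - b)) := by
      have : p.toReal = a⁻¹ := by rw [ha, ENNReal.toReal_inv, inv_inv]
      rw [this, show 1 + (a - b) = 2 * a by linarith]
      field_simp
    have hqr : q.toReal = 2 / (1 - (a - b)) := by
      have : q.toReal = b⁻¹ := by rw [hb, ENNReal.toReal_inv, inv_inv]
      rw [this, show 1 - (a - b) = 2 * b by linarith]
      field_simp
    have hb0 : 0 < b := by linarith
    have hq0 : q ≠ 0 := fun h => hqi (by simp [h])
    have hqt : q ≠ ⊤ := fun h => by simp [hb, h] at hb0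
    set θ := a - b with hθ
    have hθ0 : 0 ≤ θ := by linarith
    have hθ1 : θ < 1 := by linarith
    have hmem : MemLp g p := g.memLp p volume
    have hgp : Integrable fun x => ‖g x‖ ^ (2 / (1 + θ)) := by
      rw [← hpr]
      exact hmem.integrable_norm_rpow hp0 hpt
    set u := mulOp m g with hu
    have huc : Continuous u := continuous_mulOp hm hgi
    set I := ∫ x, ‖g x‖ ^ (2 / (1 + θ)) with hI
    have hI0 : 0 ≤ I := integral_nonneg fun x => by positivity
    set Q := B ^ (1 - θ) * A ^ θ * I ^ ((1 + θ) / 2) with hQ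
    have hQ0 : 0 ≤ Q := by positivity
    have hr0 : 0 < 2 / (1 - θ) := div_pos two_pos (by linarith)
    set S : ℕ → Set (EuclideanSpace ℝ (Fin n)) := fun k =>
      {x | ‖x‖ ≤ k} ∩ {x | ((k : ℝ) + 1)⁻¹ ≤ ‖u x‖} with hS
    have hSmono : Monotone S := fun k l hkl x hx => by
      have hkl' : (k : ℝ) ≤ l := by exact_mod_cast hkl
      refine ⟨le_trans hx.1 hkl', ?_⟩
      change ((l : ℝ) + 1)⁻¹ ≤ ‖u x‖
      refine le_trans ?_ hx.2
      exact inv_anti₀ (by positivity) (by linarith)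
    -- The sets `S k` increase to a set containing the support of `u`, so their common bound passes
    -- to the whole integral.
    have hall : ∫⁻ x, ‖u x‖ₑ ^ (2 / (1 - θ)) ≤ ENNReal.ofReal (Q ^ (2 / (1 - θ))) := by
      have h1 : ∫⁻ x, ‖u x‖ₑ ^ (2 / (1 - θ)) = ∫⁻ x in ⋃ k, S k, ‖u x‖ₑ ^ (2 / (1 - θ)) := by
        refine (setLIntegral_eq_of_support_subset fun x hx => ?_).symm
        have hx0 : u x ≠ 0 := fun h => hx (by simp [h, hr0])
        have hpos : 0 < ‖u x‖ := norm_pos_iff.2 hx0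
        obtain ⟨J₁, hJ₁⟩ := exists_nat_ge ‖x‖
        obtain ⟨J₂, hJ₂⟩ := exists_nat_ge ‖u x‖⁻¹
        refine Set.mem_iUnion.2 ⟨max J₁ J₂, ?_, ?_⟩
        · exact hJ₁.trans (by exact_mod_cast le_max_left _ _)
        · refine (inv_le_comm₀ (by positivity) hpos).2 (hJ₂.trans ?_)
          have : (J₂ : ℝ) ≤ ((max J₁ J₂ : ℕ) : ℝ) := by exact_mod_cast le_max_right _ _
          linarith
      rw [h1, setLIntegral_iUnion_of_directed _ hSmono.directed_le]
      exact iSup_le fun k =>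
        setLIntegral_mulOp_rpow_le g.continuous.measurable hgi hm hA hB hθ0 hθ1 hgp k
    rw [eLpNorm_eq_lintegral_rpow_enorm_toReal hq0 hqt, hqr,
      hmem.eLpNorm_eq_integral_rpow_norm hp0 hpt, hpr, ← hI, ← ENNReal.ofReal_mul (by positivity)]
    have h2 := ENNReal.rpow_le_rpow hall (z := 1 / (2 / (1 - θ))) (by positivity)
    refine h2.trans (le_of_eq ?_)
    rw [← ENNReal.ofReal_rpow_of_nonneg hQ0 hr0.le, ← ENNReal.rpow_mul, mul_one_div_cancel hr0.ne',
      ENNReal.rpow_one, hQ]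
    congr 3
    rw [inv_div]

end Duality

/-! ### Normalisation and bounds for the symbol and its kernel -/

section Decay

open scoped FourierTransform

variable {n : ℕ}

lemma integral_eq_two_pi_pow_mul (F : EuclideanSpace ℝ (Fin n) → ℂ) :
    ∫ ξ, F ξ = (((2 * Real.pi) ^ n : ℝ) : ℂ) * ∫ w, F ((2 * Real.pi) • w) := by
  rw [Measure.integral_comp_smul, finrank_euclideanSpace, Fintype.card_fin,
    abs_of_nonneg (by positivity), Complex.real_smul, ← mul_assoc, ← Complex.ofReal_mul,
    mul_inv_cancel₀ (by positivity), Complex.ofReal_one, one_mul]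

lemma fourierHat_two_pi_smul (f : EuclideanSpace ℝ (Fin n) → ℂ) (w : EuclideanSpace ℝ (Fin n)) :
    fourierHat f ((2 * Real.pi) • w) = 𝓕 f w := by
  rw [fourierHat, Real.fourier_eq']
  refine integral_congr_ae (Filter.Eventually.of_forall fun x => ?_)
  simp only [smul_eq_mul, inner_smul_right]
  congr 2
  push_cast
  ring

lemma fourierInv_eq_exp (f : EuclideanSpace ℝ (Fin n) → ℂ) (x : EuclideanSpace ℝ (Fin n)) :
    𝓕⁻ f x = ∫ w, Complex.exp (Complex.I * (inner ℝ x ((2 * Real.pi) • w) : ℝ)) * f w := by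
  rw [Real.fourierInv_eq']
  refine integral_congr_ae (Filter.Eventually.of_forall fun w => ?_)
  simp only [smul_eq_mul, inner_smul_right, real_inner_comm x w]
  congr 2
  push_cast
  ring

lemma hasTemperateGrowth_bracket (s : ℝ) : Function.HasTemperateGrowth
    fun w : EuclideanSpace ℝ (Fin n) => (1 + ‖(2 * Real.pi) • w‖ ^ 2) ^ s :=
  (Function.hasTemperateGrowth_one_add_norm_sq_rpow (EuclideanSpace ℝ (Fin n)) s).comp
    ((2 * Real.pi) • ContinuousLinearMap.id ℝ (EuclideanSpace ℝ (Fin n))).hasTemperateGrowth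

/-- The Bessel potential of a Schwartz function as a Schwartz function. -/
def besselSchwartz (s : ℝ) (f : 𝓢(EuclideanSpace ℝ (Fin n), ℂ)) :
    𝓢(EuclideanSpace ℝ (Fin n), ℂ) :=
  𝓕⁻ (SchwartzMap.smulLeftCLM ℂ
    (fun w : EuclideanSpace ℝ (Fin n) => (1 + ‖(2 * Real.pi) • w‖ ^ 2) ^ (s / 2)) (𝓕 f))

lemma fourier_besselSchwartz (s : ℝ) (f : 𝓢(EuclideanSpace ℝ (Fin n), ℂ))
    (w : EuclideanSpace ℝ (Fin n)) :
    𝓕 (besselSchwartz s f : EuclideanSpace ℝ (Fin n) → ℂ) w =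
      (((1 + ‖(2 * Real.pi) • w‖ ^ 2) ^ (s / 2) : ℝ) : ℂ) *
        𝓕 (f : EuclideanSpace ℝ (Fin n) → ℂ) w := by
  rw [← SchwartzMap.fourier_coe, besselSchwartz, FourierTransform.fourier_fourierInv_eq,
    SchwartzMap.smulLeftCLM_apply_apply (hasTemperateGrowth_bracket _), Complex.real_smul,
    SchwartzMap.fourier_coe]

lemma besselPot_eq (s : ℝ) (f : 𝓢(EuclideanSpace ℝ (Fin n), ℂ)) :
    besselPot s f = besselSchwartz s f := by
  ext x
  rw [besselPot, integral_eq_two_pi_pow_mul, besselSchwartz, SchwartzMap.fourierInv_coe,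
    fourierInv_eq_exp, Complex.real_smul, ← mul_assoc, ← Complex.ofReal_mul,
    inv_mul_cancel₀ (by positivity), Complex.ofReal_one, one_mul]
  refine integral_congr_ae (Filter.Eventually.of_forall fun w => ?_)
  simp only [SchwartzMap.smulLeftCLM_apply_apply (hasTemperateGrowth_bracket _),
    Complex.real_smul, fourierHat_two_pi_smul, SchwartzMap.fourier_coe, mul_assoc]

/-- The symbol `e^{i t τ} a χ ⟨ξ⟩^{-s}`. -/
def oscSymbol (τ a χ : EuclideanSpace ℝ (Fin n) → ℂ) (t s : ℝ) (ξ : EuclideanSpace ℝ (Fin n)) : ℂ :=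
  Complex.exp (Complex.I * (τ ξ * (t : ℂ))) *
    (a ξ * χ ξ * (((1 + ‖ξ‖ ^ 2) ^ (-(s / 2)) : ℝ) : ℂ))

/-- The factors `⟨ξ⟩^{-s}` and `⟨ξ⟩^s` are inserted, one joining the symbol and the other `f`; the
dilation by `2π` matches the two Fourier conventions. -/
lemma oscMultiplier_eq (τ a χ : EuclideanSpace ℝ (Fin n) → ℂ) (t s : ℝ)
    (f : 𝓢(EuclideanSpace ℝ (Fin n), ℂ)) :
    oscMultiplier τ a χ t f = (((2 * Real.pi) ^ n : ℝ) : ℂ) •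
      mulOp (fun w => oscSymbol τ a χ t s ((2 * Real.pi) • w)) (besselSchwartz s f) := by
  ext x
  rw [oscMultiplier, integral_eq_two_pi_pow_mul, Pi.smul_apply, mulOp, fourierInv_eq_exp,
    smul_eq_mul]
  congr 1
  refine integral_congr_ae (Filter.Eventually.of_forall fun w => ?_)
  simp only [fourierHat_two_pi_smul, fourier_besselSchwartz, oscSymbol]
  have h1 : (((1 + ‖(2 * Real.pi) • w‖ ^ 2) ^ (-(s / 2)) : ℝ) : ℂ) *
      (((1 + ‖(2 * Real.pi) • w‖ ^ 2) ^ (s / 2) : ℝ) : ℂ) = 1 := by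
    rw [← Complex.ofReal_mul, ← Real.rpow_add (by positivity), neg_add_cancel, Real.rpow_zero,
      Complex.ofReal_one]
  rw [mul_add, Complex.exp_add]
  linear_combination (-(Complex.exp (Complex.I * (inner ℝ x ((2 * Real.pi) • w) : ℝ)) *
    Complex.exp (Complex.I * (τ ((2 * Real.pi) • w) * (t : ℂ))) * a ((2 * Real.pi) • w) *
    χ ((2 * Real.pi) • w) * 𝓕 (f : EuclideanSpace ℝ (Fin n) → ℂ) w)) * h1

/-- Rescaling produces the factor `(2π)^{-n} ≤ 1`, which is dropped. -/
lemma fourierInv_oscSymbol (τ a χ : EuclideanSpace ℝ (Fin n) → ℂ) (t s : ℝ)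
    (z : EuclideanSpace ℝ (Fin n)) :
    ‖𝓕⁻ (fun w => oscSymbol τ a χ t s ((2 * Real.pi) • w)) z‖ ≤
      ‖∫ ξ, Complex.exp (Complex.I * (inner ℝ z ξ : ℝ)) * oscSymbol τ a χ t s ξ‖ := by
  rw [fourierInv_eq_exp, integral_eq_two_pi_pow_mul
    (fun ξ => Complex.exp (Complex.I * (inner ℝ z ξ : ℝ)) * oscSymbol τ a χ t s ξ), norm_mul,
    Complex.norm_real, Real.norm_of_nonneg (by positivity)]
  refine le_mul_of_one_le_left (norm_nonneg _) (one_le_pow₀ ?_)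
  linarith [Real.pi_gt_three]

/-- The pointwise bounds for the symbol and for its kernel. -/
lemma exists_oscSymbol_bound (hn : 1 ≤ n) (μ M C₀ : ℝ) (hC₀ : 0 < C₀) (V N₀ : ℝ)
    (A B T m : ℕ → ℝ) :
    ∃ C : ℝ, 0 < C ∧
      ∀ (U : Set (EuclideanSpace ℝ (Fin n))) (τ a χ : EuclideanSpace ℝ (Fin n) → ℂ),
        IsOpen U → Bornology.IsBounded U → volume U ≤ ENNReal.ofReal V →
        ContDiffOn ℝ ∞ τ U →
        (∀ ξ ∈ U, 0 ≤ (τ ξ).im) →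
        (∀ k : ℕ, ∀ ξ ∈ U, ‖iteratedFDeriv ℝ k τ ξ‖ ≤ T k * (1 + ‖ξ‖) ^ m k) →
        (∀ ξ ∈ U, C₀ * (1 + ‖ξ‖) ^ (-M) ≤ ‖(hess τ ξ).det‖) →
        SymbolBoundOn U (-μ) A a →
        SymbolBoundOn Set.univ 0 B χ →
        (∀ ξ ∉ U, ∀ k : ℕ, iteratedFDeriv ℝ k χ ξ = 0) →
        ∀ t : ℝ, 0 ≤ t → ∀ s : ℝ, |s| ≤ N₀ →
          Integrable (oscSymbol τ a χ t s) ∧ (∀ ξ, ‖oscSymbol τ a χ t s ξ‖ ≤ C) ∧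
          ∀ z, ‖∫ ξ, Complex.exp (Complex.I * (inner ℝ z ξ : ℝ)) * oscSymbol τ a χ t s ξ‖ ≤
            C * (1 + t) ^ (-((n : ℝ) / 2)) := by
  obtain ⟨C₁, hC₁, hb⟩ := (PhaseDatum.rSym_amp (μ := μ) (M := M) (C₀ := C₀) (V := V) (N₀ := N₀)
    (A := A) (B := B) (T := T) (m := m) hn 0 0).ubd
  obtain ⟨C₂, hC₂, hk⟩ := PhaseDatum.exists_kernel_bound (μ := μ) (M := M) (V := V) (N₀ := N₀)
    (A := A) (B := B) (T := T) (m := m) hn hC₀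
  set E₀ := C₁ + C₂ + C₁ * |V| + 1 with hE₀
  have hE₀0 : 0 < E₀ := by positivity
  have h2n : (1 : ℝ) ≤ 2 ^ ((n : ℝ) / 2) := Real.one_le_rpow one_le_two (by positivity)
  refine ⟨E₀ * 2 ^ ((n : ℝ) / 2), by positivity, fun U τ a χ hU hbd hV hτ him hτb hdet ha hχ hflat t
    ht s hs => ?_⟩
  have hne : Uᶜ.Nonempty := by
    have : Nonempty (Fin n) := ⟨⟨0, hn⟩⟩
    rw [Set.nonempty_compl]
    rintro rfl
    exact NormedSpace.unbounded_univ ℝ (EuclideanSpace ℝ (Fin n)) hbd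
  have hχ0 : ∀ ξ ∉ U, χ ξ = 0 := fun ξ hξ => by
    have := congrArg norm (hflat ξ hξ 0)
    rwa [norm_iteratedFDeriv_zero, norm_zero, norm_eq_zero] at this
  have hsupp : ∀ ξ ∉ U, oscSymbol τ a χ t s ξ = 0 := fun ξ hξ => by simp [oscSymbol, hχ0 ξ hξ]
  -- Time `max t 1` makes the scale at least one. For `t ≥ 1` this is the true time; for `t ≤ 1` the
  -- kernel is at most the symbol bound times the volume.
  let σ : EuclideanSpace ℝ (Fin n) → PhaseDatum n μ M C₀ V N₀ A B T m := fun z =>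
    { U := U, τ := τ, a := a, χ := χ, x := z, t := max t 1, N := s, isOpen_U := hU
      compl_nonempty := hne, volume_le := hV, smooth_τ := hτ, im_nonneg := him, bound_τ := hτb
      det_ge := hdet, symbol_a := ha, symbol_χ := hχ, flat_χ := hflat
      one_le_t := le_max_right _ _, abs_N_le := hs }
  have hexp : ∀ ξ ∈ U, ‖Complex.exp (Complex.I * (τ ξ * (t : ℂ)))‖ ≤ 1 := fun ξ hξ => by
    rw [Complex.norm_exp]
    simpa using mul_nonneg (him ξ hξ) ht
  have hbound : ∀ ξ, ‖oscSymbol τ a χ t s ξ‖ ≤ C₁ := fun ξ => by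
    by_cases hξ : ξ ∈ U
    · have h1 := hb (σ 0) ξ hξ
      simp only [pow_zero, mul_one] at h1
      rw [oscSymbol, norm_mul]
      exact (mul_le_of_le_one_left (norm_nonneg _) (hexp ξ hξ)).trans h1
    · rw [hsupp ξ hξ, norm_zero]
      exact hC₁
  have hVf : volume U ≠ ⊤ := (hV.trans_lt ENNReal.ofReal_lt_top).ne
  have hind : oscSymbol τ a χ t s = U.indicator (oscSymbol τ a χ t s) := by
    ext ξ
    by_cases hξ : ξ ∈ U
    · simp [hξ]
    · simp [hξ, hsupp ξ hξ]
  have hcont : ContinuousOn (oscSymbol τ a χ t s) U := by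
    refine ((continuousOn_const.mul (hτ.continuousOn.mul continuousOn_const)).cexp).mul
      ((ha.1.continuousOn.mul (hχ.1.continuousOn.mono (Set.subset_univ U))).mul
        (Continuous.continuousOn (Complex.continuous_ofReal.comp ?_)))
    exact (continuous_const.add (continuous_norm.pow 2)).rpow_const fun ξ =>
      Or.inl (by positivity : (0 : ℝ) < 1 + ‖ξ‖ ^ 2).ne'
  have hint : Integrable (oscSymbol τ a χ t s) := by
    rw [hind, integrable_indicator_iff hU.measurableSet]
    have : IsFiniteMeasure (volume.restrict U) := isFiniteMeasure_restrict.2 hVf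
    exact Integrable.of_bound (hcont.aestronglyMeasurable hU.measurableSet) C₁
      (Filter.Eventually.of_forall hbound)
  have hkU : ∀ z, ∫ ξ, Complex.exp (Complex.I * (inner ℝ z ξ : ℝ)) * oscSymbol τ a χ t s ξ =
      ∫ ξ in U, Complex.exp (Complex.I * (inner ℝ z ξ : ℝ)) * oscSymbol τ a χ t s ξ := fun z =>
    (setIntegral_eq_integral_of_forall_compl_eq_zero fun ξ hξ => by rw [hsupp ξ hξ, mul_zero]).symm
  refine ⟨hint, fun ξ => (hbound ξ).trans ?_, fun z => ?_⟩
  · have : C₁ ≤ E₀ := by rw [hE₀]; linarith [mul_nonneg hC₁ (abs_nonneg V)]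
    nlinarith
  have hker : ‖∫ ξ, Complex.exp (Complex.I * (inner ℝ z ξ : ℝ)) * oscSymbol τ a χ t s ξ‖ ≤
      E₀ * (√(max t 1) ^ n)⁻¹ := by
    rcases le_total 1 t with h | h
    · have h1 := hk (σ z)
      have h2 : ∫ ξ in (σ z).U, Complex.exp (Complex.I * (σ z).phase ξ) * (σ z).amp ξ =
          ∫ ξ, Complex.exp (Complex.I * (inner ℝ z ξ : ℝ)) * oscSymbol τ a χ t s ξ := by
        rw [hkU]
        refine setIntegral_congr_fun hU.measurableSet fun ξ _ => ?_
        simp only [PhaseDatum.phase, PhaseDatum.amp, oscSymbol, σ, max_eq_left h]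
        rw [mul_add, Complex.exp_add, mul_assoc]
      rw [h2] at h1
      refine h1.trans (mul_le_mul_of_nonneg_right ?_ (by positivity))
      rw [hE₀]
      linarith [mul_nonneg hC₁ (abs_nonneg V)]
    · rw [max_eq_right h, Real.sqrt_one, one_pow, inv_one, mul_one, hkU]
      have h1 := norm_setIntegral_le_of_norm_le_const (μ := volume) (s := U) (C := C₁)
        (f := fun ξ => Complex.exp (Complex.I * (inner ℝ z ξ : ℝ)) * oscSymbol τ a χ t s ξ)
        hVf.lt_top (fun ξ _ => by
          rw [norm_mul, Complex.norm_exp]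
          simpa using hbound ξ)
      refine h1.trans ?_
      have h2 : volume.real U ≤ |V| := by
        rw [Measure.real]
        refine ENNReal.toReal_le_of_le_ofReal (abs_nonneg V) (hV.trans ?_)
        exact ENNReal.ofReal_le_ofReal (le_abs_self V)
      have h3 := mul_le_mul_of_nonneg_left h2 hC₁
      rw [hE₀]
      linarith
  refine hker.trans ?_
  rw [mul_assoc]
  refine mul_le_mul_of_nonneg_left ?_ hE₀0.le
  -- The source of the factor `2^{n/2}` in the constant.
  have h1 : (1 + t) / 2 ≤ max t 1 := by
    rcases le_total 1 t with h | h
    · rw [max_eq_left h]; linarith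
    · rw [max_eq_right h]; linarith
  have h2 : ((1 + t) / 2) ^ ((n : ℝ) / 2) ≤ √(max t 1) ^ n := by
    rw [Real.sqrt_eq_rpow, ← Real.rpow_natCast, ← Real.rpow_mul (by positivity),
      show (1 / 2 : ℝ) * n = (n : ℝ) / 2 by ring]
    exact Real.rpow_le_rpow (by positivity) h1 (by positivity)
  refine (inv_anti₀ (by positivity) h2).trans (le_of_eq ?_)
  rw [Real.div_rpow (by positivity) zero_le_two, inv_div, Real.rpow_neg (by positivity),
    div_eq_mul_inv]

end Decay

end FourierDecay

end

/-! ### The decay estimate -/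

theorem mainTheorem4 (n : ℕ) (hn : 1 ≤ n) (μ M C₀ : ℝ) (hC₀ : 0 < C₀) (V : ℝ)
    (A B T m : ℕ → ℝ) :
    ∃ C : ℝ, 0 < C ∧
      ∀ (U : Set (EuclideanSpace ℝ (Fin n))) (τ a χ : EuclideanSpace ℝ (Fin n) → ℂ),
        IsOpen U → Bornology.IsBounded U → volume U ≤ ENNReal.ofReal V →
        ContDiffOn ℝ ∞ τ U →
        (∀ ξ ∈ U, 0 ≤ (τ ξ).im) →
        (∀ k : ℕ, ∀ ξ ∈ U, ‖iteratedFDeriv ℝ k τ ξ‖ ≤ T k * (1 + ‖ξ‖) ^ m k) →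
        (∀ ξ ∈ U, C₀ * (1 + ‖ξ‖) ^ (-M) ≤ ‖(FourierDecay.hess τ ξ).det‖) →
        FourierDecay.HasUniqueNondegCritPoint U τ →
        FourierDecay.SymbolBoundOn U (-μ) A a →
        FourierDecay.SymbolBoundOn Set.univ 0 B χ →
        (∀ ξ ∉ U, ∀ k : ℕ, iteratedFDeriv ℝ k χ ξ = 0) →
        ∀ p q : ℝ≥0∞, 1 ≤ p → p ≤ 2 → p⁻¹ + q⁻¹ = 1 →
        ∀ t : ℝ, 0 ≤ t → ∀ f : 𝓢(EuclideanSpace ℝ (Fin n), ℂ),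
          eLpNorm (FourierDecay.oscMultiplier τ a χ t f) q volume ≤
            ENNReal.ofReal
                (C * (1 + t) ^ (-((n : ℝ) / 2) * ((p⁻¹).toReal - (q⁻¹).toReal))) *
              FourierDecay.sobolevNorm p
                (M / 2 * ((p⁻¹).toReal - (q⁻¹).toReal) - μ) f := by
  -- As `0 ≤ θ ≤ 1`, `|M|/2 + |μ|` bounds the Sobolev order for every `p`, so one constant serves
  -- all exponents.
  obtain ⟨D, hD0, hD⟩ := FourierDecay.exists_oscSymbol_bound hn μ M C₀ hC₀ V (|M| / 2 + |μ|) A B T m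
  refine ⟨(2 * Real.pi) ^ n * D, by positivity, fun U τ a χ hU hbd hV hτ him hτb hdet _ ha hχ hflat
    p q hp1 hp2 hpq t ht f => ?_⟩
  set θ := (p⁻¹).toReal - (q⁻¹).toReal with hθ
  have hp0 : p ≠ 0 := (zero_lt_one.trans_le hp1).ne'
  have hpi : p⁻¹ ≠ ⊤ := ENNReal.inv_ne_top.2 hp0
  have hqi : q⁻¹ ≠ ⊤ := by
    intro hq
    simp [hq] at hpq
  have hab : (p⁻¹).toReal + (q⁻¹).toReal = 1 := by
    rw [← ENNReal.toReal_add hpi hqi, hpq, ENNReal.toReal_one]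
  have ha2 : 1 / 2 ≤ (p⁻¹).toReal := by
    have h := (ENNReal.toReal_le_toReal (by simp) hpi).2 (ENNReal.inv_le_inv.2 hp2)
    rwa [ENNReal.toReal_inv, ENNReal.toReal_ofNat, ← one_div] at h
  have hb0 : 0 ≤ (q⁻¹).toReal := ENNReal.toReal_nonneg
  have hθ0 : 0 ≤ θ := by linarith
  have hθ1 : θ ≤ 1 := by linarith
  set s := M / 2 * θ - μ with hs
  have hsN : |s| ≤ |M| / 2 + |μ| := by
    refine (abs_sub _ _).trans (add_le_add ?_ le_rfl)
    rw [abs_mul, abs_div, abs_two, abs_of_nonneg hθ0]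
    exact mul_le_of_le_one_right (by positivity) hθ1
  obtain ⟨hint, hsym, hker⟩ := hD U τ a χ hU hbd hV hτ him hτb hdet ha hχ hflat t ht s hsN
  have key := FourierDecay.eLpNorm_mulOp_le
    (hint.comp_smul (R := 2 * Real.pi) (by positivity))
    (fun z => (FourierDecay.fourierInv_oscSymbol τ a χ t s z).trans (hker z))
    (fun w => hsym _) (FourierDecay.besselSchwartz s f) hp1 hp2 hpq
  rw [FourierDecay.sobolevNorm, FourierDecay.besselPot_eq, FourierDecay.oscMultiplier_eq τ a χ t s f,
    eLpNorm_const_smul]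
  refine (mul_le_mul_right key _).trans (le_of_eq ?_)
  rw [← mul_assoc, ← ofReal_norm, Complex.norm_real, Real.norm_of_nonneg (by positivity),
    ← ENNReal.ofReal_mul (by positivity), ← hθ]
  congr 2
  -- `D^{1-θ} (D (1+t)^{-n/2})^θ = D (1+t)^{-nθ/2}`.
  rw [Real.mul_rpow hD0.le (by positivity), ← Real.rpow_mul (by positivity), ← mul_assoc (D ^ _),
    ← Real.rpow_add hD0, sub_add_cancel, Real.rpow_one, mul_assoc]
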